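/- For $k\in\mathbb N$ and $s>0$ let $H^{k,s}(\mathbb{R})$ be the space of all $f\in L^2(\mathbb{R})$ whose weak derivatives $\partial^j f$, $1\le j\le k$, exist and satisfy $(1+|x|^s)\,\partial^j f\in L^2(\mathbb{R})$. Let $u\in H^{4,2}(\mathbb{R})$ be real-valued (identified with its continuous representative, which is $C^3$), and put $m=u-u_{xx}$, $q=\sqrt{m^2+1}$, $p(x)=x-\int_x^\infty (q(y)-1)\,dy$, $\sigma_1=\begin{pmatrix}0&1\\1&0\end{pmatrix}$, $\sigma_3=\begin{pmatrix}1&0\\0&-1\end{pmatrix}$, $$F=\sqrt{\tfrac{q+1}{2q}}\begin{pmatrix}1&\frac{-im}{q+1}\\ \frac{-im}{q+1}&1\end{pmatrix},\qquad P(x,z)=\frac{i m_x}{2q^2}\sigma_1+\frac{m}{2zq}\begin{pmatrix}-im&1\\-1&im\end{pmatrix}.$$ Then for every real $z\ne0$ there are unique Jost functions $\mu_\pm(\cdot,z):\mathbb{R}\to\mathbb{C}^{2\times2}$ with $$(\mu_\pm)_x=-\tfrac{i}{4}\bigl(z-\tfrac1z\bigr)q\,[\sigma_3,\mu_\pm]+P\mu_\pm,\qquad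 \mu_\pm\to I\quad (x\to\pm\infty),$$ and, with $\Phi_\pm=F\mu_\pm e^{-\frac i4(z-\frac1z)p\,\sigma_3}$, there is a unique matrix $S(z)$, independent of $x$, such that $\Phi_-=\Phi_+S(z)$. Write $a(z)=S_{11}(z)$, $b(z)=S_{21}(z)$, and assume that there are no spectral singularities, i.e. $a(z)\neq0$ for all real $z\ne0$. Then the reflection coefficient $r(z)=b(z)/a(z)$ belongs to $H^{1,1}(\mathbb{R})$, and moreover $z\,r(z)\in L^2(\mathbb{R})$. -/

import Mathlib

open MeasureTheory Filter Topology
open scoped ContDiff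

namespace MCH

/-! ### Weighted Sobolev spaces on the real line -/

/-- `g` is a weak derivative of `f` on `ℝ`. -/
def IsWeakDeriv {E : Type*} [NormedAddCommGroup E] [NormedSpace ℝ E] (f g : ℝ → E) : Prop :=
  LocallyIntegrable f ∧ LocallyIntegrable g ∧
    ∀ φ : ℝ → ℝ, ContDiff ℝ ∞ φ → HasCompactSupport φ →
      ∫ x, deriv φ x • f x = -∫ x, φ x • g x

/-- `f ∈ H^{k,s}(ℝ)`: `f ∈ L²(ℝ)`, and for `j = 1, …, k` the weak derivative `∂ʲ f = D j` exists
and satisfies `(1 + |x|^s) ∂ʲ f ∈ L²(ℝ)`. -/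
def MemH {E : Type*} [NormedAddCommGroup E] [NormedSpace ℝ E]
    (k : ℕ) (s : ℝ) (f : ℝ → E) : Prop :=
  MemLp f 2 volume ∧
    ∃ D : ℕ → ℝ → E, D 0 = f ∧
      ∀ j < k, IsWeakDeriv (D j) (D (j + 1)) ∧
        MemLp (fun x => (1 + |x| ^ s) • D (j + 1) x) 2 volume

/-! ### The `x`-part of the Lax pair of the modified Camassa–Holm equation -/

/-- The momentum `m = u - u_xx`. -/
noncomputable def momentum (u : ℝ → ℝ) (x : ℝ) : ℝ := u x - deriv (deriv u) x

/-- `q = √(m² + 1)`. -/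
noncomputable def q (m : ℝ → ℝ) (x : ℝ) : ℝ := Real.sqrt (m x ^ 2 + 1)

/-- `p(x) = x - ∫ₓ^∞ (q - 1) dy`. -/
noncomputable def p (m : ℝ → ℝ) (x : ℝ) : ℝ := x - ∫ y in Set.Ioi x, (q m y - 1)

/-- The Pauli matrix `σ₁`. -/
def σ₁ : Matrix (Fin 2) (Fin 2) ℂ := !![0, 1; 1, 0]

/-- The Pauli matrix `σ₃`. -/
def σ₃ : Matrix (Fin 2) (Fin 2) ℂ := !![1, 0; 0, -1]

/-- The gauge matrix `F`. -/
noncomputable def F (m : ℝ → ℝ) (x : ℝ) : Matrix (Fin 2) (Fin 2) ℂ :=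
  (Real.sqrt ((q m x + 1) / (2 * q m x)) : ℂ) •
    !![1, -Complex.I * m x / (q m x + 1); -Complex.I * m x / (q m x + 1), 1]

/-- The matrix `P = (i m_x / (2 q²)) σ₁ + (m / (2 z q)) (-i m, 1; -1, i m)`. -/
noncomputable def P (m : ℝ → ℝ) (z x : ℝ) : Matrix (Fin 2) (Fin 2) ℂ :=
  (Complex.I * (deriv m x : ℝ) / (2 * (q m x : ℂ) ^ 2)) • σ₁ +
    ((m x : ℂ) / (2 * z * q m x)) • !![-Complex.I * m x, 1; -1, Complex.I * m x]

/-- `μ` solves `μ_x = -(i/4)(z - 1/z) p_x [σ₃, μ] + P μ` (where `p_x = q`) and `μ → I` along `l`.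
The Jost functions `μ₊(·, z)` and `μ₋(·, z)` are the cases `l = atTop` and `l = atBot`. -/
def IsJost (m : ℝ → ℝ) (z : ℝ) (l : Filter ℝ) (μ : ℝ → Matrix (Fin 2) (Fin 2) ℂ) : Prop :=
  (∀ x i j, HasDerivAt (fun y => μ y i j)
    ((-(Complex.I / 4 * (z - 1 / z) * q m x) • (σ₃ * μ x - μ x * σ₃) + P m z x * μ x) i j) x) ∧
  Tendsto μ l (𝓝 1)

/-- The solution `Φ = F μ exp(-(i/4)(z - 1/z) p σ₃)` of the original Lax equation. -/
noncomputable def Phi (m : ℝ → ℝ) (z : ℝ) (μ : ℝ → Matrix (Fin 2) (Fin 2) ℂ) (x : ℝ) :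
    Matrix (Fin 2) (Fin 2) ℂ :=
  F m x * μ x *
    !![Complex.exp (-(Complex.I / 4 * (z - 1 / z) * p m x)), 0;
       0, Complex.exp (Complex.I / 4 * (z - 1 / z) * p m x)]

/-- `S` is a scattering matrix at the real spectral parameter `z`: `Φ₋ = Φ₊ S` on `ℝ`. -/
def IsScatteringMatrix (m : ℝ → ℝ) (z : ℝ) (S : Matrix (Fin 2) (Fin 2) ℂ) : Prop :=
  ∃ μp μm : ℝ → Matrix (Fin 2) (Fin 2) ℂ, IsJost m z atTop μp ∧ IsJost m z atBot μm ∧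
    ∀ x, Phi m z μm x = Phi m z μp x * S

end MCH

/-! Put θ = (z − 1/z)/4. Conjugating by e^{2iθp} turns the Jost equation into a linear system with
an integrable coefficient matrix that is trace-free and skew-Hermitian. Its diagonal is ∓iA/z and
its off-diagonal entries are e^{±2iθp}(iG ± B/z), where A = m²/2q, B = m/2q and G = m_x/2q²
(`MomentumDecay.isJost_iff`). Hence |w₁|² + |w₂|² is conserved, which gives uniqueness and global
bounds. The solution starting from (1, 0) at −∞ tends to some (a, b) at +∞, and S has columns (a, b)
and (−b̄, ā) (`MomentumDecay.isScatteringMatrix_iff`).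

The frequency is unchanged by z ↦ −1/z, and an explicit gauge transformation carries solutions at z
to solutions at −1/z, with a ↦ a and b ↦ −b. So r(−1/z) = −r(z), and only |z| > 1 needs analysis.
The inversion turns the L² norm of r' on |z| < 1 into that of z r' on |z| > 1. A bound r = O(1/z) at
infinity becomes r = O(z) at 0, so no singular part of the weak derivative sits there
(`memH_of_inversion`). What remains is that z r and z r' are square-integrable on |z| > 1.

For z r, write G = qK with K absolutely continuous. Integrating by parts against the phase gains
1/θ, so w₂ = O(1/z) uniformly, w₁ − 1 = O(1/z), and a → 1. To leading order z b is a combination of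
the oscillatory integrals of B and K'. After the substitution y = p(x) these are Fourier transforms,
in L² by Plancherel (`lintegral_osc_sq_le`). The errors are O(1/z), which is square-integrable on
|z| > 1.

For z r', the numerator of r(z') − r(z) is a(z)b(z') − b(z)a(z'), the limit at +∞ of a Wronskian of
solutions at two spectral parameters. It equals the integral of coefficient differences times
products of solutions (`Coeffs.IsJostPair.wronskian_top`). Thus only the explicit coefficients are
differentiated in z; of the solutions one needs continuity in z and bounds. Differentiating the
phase produces a factor p, comparable to x. The G-term is harmless: pG is integrable, and pK is
absolutely continuous, so one more integration by parts gains 1/z. The A-term gains 1/z² from the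
derivative of 1/z.

The B-term is the delicate one. The function u itself carries no weight, so Hardy's inequality
yields only xm in L², and pB need not be integrable. The amplitude w(z)w(z') is therefore split into
a constant, a multiple of a smooth step joining its two limits, and a remainder. The first two
pieces lead to θ-derivatives of oscillatory integrals, which are in L² by difference quotients and
Fatou (`memLp_deriv_osc`). The remainder is dominated by tails of the coefficients, again in L² by
Hardy, and these pair with pB in L² (`RegularCoeffs.exists_tendsto_slope_B`).

Finally |a| is bounded below on |z| ≥ 1: a → 1 at infinity, and a is continuous without zeros on the
compact remainder. -/

namespace MCH

/-! ### Square-integrable functions and the Fourier transform -/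

section SquareIntegrable

variable {α E : Type*} [MeasurableSpace α] [NormedAddCommGroup E] {μ : Measure α}

theorem eLpNorm_two_sq (f : α → E) : eLpNorm f 2 μ ^ 2 = ∫⁻ x, ‖f x‖ₑ ^ 2 ∂μ := by
  rw [eLpNorm_eq_lintegral_rpow_enorm_toReal (by norm_num) (by norm_num)]
  simp only [ENNReal.toReal_ofNat, ENNReal.rpow_ofNat, one_div]
  rw [← ENNReal.rpow_natCast, ← ENNReal.rpow_mul]
  norm_num

theorem memLp_two_iff_lintegral {f : α → E} (hf : AEStronglyMeasurable f μ) :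
    MemLp f 2 μ ↔ ∫⁻ x, ‖f x‖ₑ ^ 2 ∂μ < ⊤ := by
  rw [← eLpNorm_two_sq]
  constructor
  · intro h
    exact ENNReal.pow_lt_top h.2
  · intro h
    refine ⟨hf, ?_⟩
    by_contra hc
    rw [not_lt, top_le_iff] at hc
    simp [hc] at h

theorem _root_.MeasureTheory.MemLp.lintegral_two_lt_top {f : α → E} (hf : MemLp f 2 μ) :
    ∫⁻ x, ‖f x‖ₑ ^ 2 ∂μ < ⊤ := (memLp_two_iff_lintegral hf.1).1 hf

end SquareIntegrable

theorem lintegral_comp_le {s : Set ℝ} (hs : MeasurableSet s) {φ φ' : ℝ → ℝ}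
    (hφ : ∀ x ∈ s, HasDerivAt φ (φ' x) x) (hinj : Set.InjOn φ s) {c : ℝ} (hc : 0 < c)
    (hc' : ∀ x ∈ s, c ≤ |φ' x|) (g : ℝ → ENNReal) :
    ∫⁻ x in s, g (φ x) ≤ ENNReal.ofReal c⁻¹ * ∫⁻ y, g y := by
  have h1 : ∫⁻ y in φ '' s, g y = ∫⁻ x in s, ENNReal.ofReal |φ' x| * g (φ x) :=
    lintegral_image_eq_lintegral_abs_deriv_mul hs (fun x hx => (hφ x hx).hasDerivWithinAt) hinj g
  have h2 : ∫⁻ x in s, ENNReal.ofReal c * g (φ x) ≤ ∫⁻ y, g y := by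
    calc _ ≤ ∫⁻ x in s, ENNReal.ofReal |φ' x| * g (φ x) :=
          setLIntegral_mono' hs (fun x hx => by gcongr; exact hc' x hx)
      _ = _ := h1.symm
      _ ≤ _ := setLIntegral_le_lintegral _ _
  have hc0 : ENNReal.ofReal c ≠ 0 := by simpa using hc
  rw [lintegral_const_mul' _ _ ENNReal.ofReal_ne_top] at h2
  rw [ENNReal.ofReal_inv_of_pos hc]
  calc _ = (ENNReal.ofReal c)⁻¹ * (ENNReal.ofReal c * ∫⁻ x in s, g (φ x)) := by
        rw [← mul_assoc, ENNReal.inv_mul_cancel hc0 ENNReal.ofReal_ne_top, one_mul]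
    _ ≤ _ := by gcongr

/-- Plancherel is available for the abstract L² transform, so the point is that the latter agrees
a.e. with the Fourier integral. Both have the same pairing with test functions, because the
transform can be moved onto the test function on either side. -/
theorem lintegral_fourier_sq {f : ℝ → ℂ} (h1 : Integrable f) (h2 : MemLp f 2 volume) :
    ∫⁻ ξ, ‖FourierTransform.fourier f ξ‖ₑ ^ 2 = ∫⁻ x, ‖f x‖ₑ ^ 2 := by
  set F₂ : Lp ℂ 2 (volume : Measure ℝ) := h2.toLp f
  have hF₂ : (F₂ : ℝ → ℂ) =ᵐ[volume] f := h2.coeFn_toLp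
  have hae : ∀ᵐ ξ, (FourierTransform.fourier F₂ : Lp ℂ 2 (volume : Measure ℝ)) ξ =
      FourierTransform.fourier f ξ := by
    apply ae_eq_of_integral_contDiff_smul_eq
    · exact (Lp.memLp _).locallyIntegrable (by norm_num)
    · exact (VectorFourier.fourierIntegral_continuous Real.continuous_fourierChar
        (by fun_prop) h1).locallyIntegrable
    · intro g hg hgc
      have hgc' : HasCompactSupport (fun x => (g x : ℂ)) := hgc.comp_left (g := fun y : ℝ => (y : ℂ)) rfl
      have hg' : ContDiff ℝ ∞ (fun x => (g x : ℂ)) := Complex.ofRealCLM.contDiff.comp hg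
      have key := congrArg (fun T => T (hgc'.toSchwartzMap hg'))
        (Lp.fourier_toTemperedDistribution_eq F₂)
      simp only [TemperedDistribution.fourier_apply, Lp.toTemperedDistribution_apply] at key
      have e1 : ∫ x, g x • (FourierTransform.fourier F₂ : Lp ℂ 2 (volume : Measure ℝ)) x =
          ∫ x, (hgc'.toSchwartzMap hg') x •
            (FourierTransform.fourier F₂ : Lp ℂ 2 (volume : Measure ℝ)) x := by
        simp
      rw [e1, ← key]
      have e2 : ∫ x, (FourierTransform.fourier (hgc'.toSchwartzMap hg')) x • F₂ x =
          ∫ x, (FourierTransform.fourier (fun x => (g x : ℂ))) x • f x := by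
        apply integral_congr_ae
        filter_upwards [hF₂] with x hx
        rw [hx, SchwartzMap.fourier_coe]
        rfl
      rw [e2]
      have e3 := VectorFourier.integral_fourierIntegral_smul_eq_flip (μ := (volume : Measure ℝ))
        (ν := (volume : Measure ℝ)) (L := innerₗ ℝ) (f := fun x => (g x : ℂ)) (g := f)
        Real.continuous_fourierChar (by fun_prop)
        (hg'.continuous.integrable_of_hasCompactSupport hgc') h1
      simp only [flip_innerₗ] at e3
      convert! e3 using 1
  calc _ = ∫⁻ ξ, ‖(FourierTransform.fourier F₂ : Lp ℂ 2 (volume : Measure ℝ)) ξ‖ₑ ^ 2 := by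
        apply lintegral_congr_ae
        filter_upwards [hae] with x hx
        rw [hx]
    _ = ∫⁻ ξ, ‖F₂ ξ‖ₑ ^ 2 := by
        rw [← eLpNorm_two_sq, ← eLpNorm_two_sq]
        have := Lp.norm_fourier_eq F₂
        rw [Lp.norm_def, Lp.norm_def, ENNReal.toReal_eq_toReal_iff' (Lp.eLpNorm_ne_top _)
          (Lp.eLpNorm_ne_top _)] at this
        rw [this]
    _ = _ := by
        apply lintegral_congr_ae
        filter_upwards [hF₂] with x hx
        rw [hx]

/-! ### Oscillatory integrals with phase `p` -/

/-- The Fourier-type integral `∫ e^{2iθp(x)} h(x) dx`. -/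
noncomputable def osc (p : ℝ → ℝ) (h : ℝ → ℂ) (θ : ℝ) : ℂ :=
  ∫ x, Complex.exp (2 * Complex.I * θ * p x) * h x

theorem norm_exp_phase (θ t : ℝ) : ‖Complex.exp (2 * Complex.I * θ * t)‖ = 1 := by
  have : (2 * Complex.I * θ * t) = ((2 * θ * t : ℝ) : ℂ) * Complex.I := by push_cast; ring
  rw [this, Complex.norm_exp_ofReal_mul_I]

theorem norm_osc_le (p : ℝ → ℝ) (h : ℝ → ℂ) (θ : ℝ) : ‖osc p h θ‖ ≤ ∫ x, ‖h x‖ := by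
  refine (norm_integral_le_integral_norm _).trans (le_of_eq ?_)
  congr 1 with x
  rw [norm_mul, norm_exp_phase, one_mul]

theorem continuous_osc {p : ℝ → ℝ} (hc : Continuous p) {h : ℝ → ℂ} (h1 : Integrable h) : Continuous (osc p h) := by
  unfold osc
  apply continuous_of_dominated (bound := fun x => ‖h x‖)
  · intro θ
    exact (by fun_prop : Continuous fun x => Complex.exp (2 * Complex.I * θ * p x)).aestronglyMeasurable.mul h1.1
  · intro θ
    exact ae_of_all _ fun x => by rw [norm_mul, norm_exp_phase, one_mul]
  · exact h1.norm
  · exact ae_of_all _ fun x => by fun_prop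

theorem phase_continuous {p q : ℝ → ℝ} (hp : ∀ x, HasDerivAt p (q x) x) : Continuous p :=
  continuous_iff_continuousAt.2 (fun x => (hp x).continuousAt)

section Phase

variable {p q : ℝ → ℝ} (hp : ∀ x, HasDerivAt p (q x) x) (hq : ∀ x, 1 ≤ q x)
include hp hq

theorem phase_strictMono : StrictMono p :=
  strictMono_of_hasDerivAt_pos hp (fun x => lt_of_lt_of_le one_pos (hq x))

theorem phase_sub_ge {x y : ℝ} (h : x ≤ y) : y - x ≤ p y - p x := by
  have : Monotone (fun x => p x - x) := by
    apply monotone_of_hasDerivAt_nonneg (f' := fun x => q x - 1)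
    · intro x
      exact (hp x).sub (hasDerivAt_id x)
    · intro x
      have := hq x
      simp only [Pi.zero_apply]; linarith
  have := this h
  simp only at this
  linarith

theorem phase_surjective : Function.Surjective p := by
  have hc := phase_continuous hp
  apply hc.surjective
  · refine tendsto_atTop_mono' _ ?_ (tendsto_atTop_add_const_right _ (p 0) tendsto_id)
    filter_upwards [eventually_ge_atTop 0] with x hx
    have := phase_sub_ge hp hq hx
    simp only [id]; linarith
  · refine tendsto_atBot_mono' _ ?_ (tendsto_atBot_add_const_right _ (p 0) tendsto_id)
    filter_upwards [eventually_le_atBot 0] with x hx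
    have := phase_sub_ge hp hq hx
    simp only [id]; linarith

/-- With y = p(x) the integral becomes the Fourier transform of H = (h/q) ∘ p⁻¹ at −θ/π, so
Plancherel applies and rescaling θ costs the factor π. Since q ≥ 1, the Jacobian makes the L² norm
of H at most that of h. -/
theorem lintegral_osc_sq_le {h : ℝ → ℂ} (h1 : Integrable h) (h2 : MemLp h 2 volume) :
    ∫⁻ θ, ‖osc p h θ‖ₑ ^ 2 ≤ ENNReal.ofReal Real.pi * ∫⁻ x, ‖h x‖ₑ ^ 2 := by
  have hmono := phase_strictMono hp hq
  have hsurj := phase_surjective hp hq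
  have himg : p '' Set.univ = Set.univ := by rw [Set.image_univ]; exact hsurj.range_eq
  set g : ℝ → ℝ := Function.surjInv hsurj
  have hg : ∀ x, g (p x) = x := fun x => hmono.injective (Function.surjInv_eq hsurj _)
  set H : ℝ → ℂ := fun y => (q (g y))⁻¹ • h (g y)
  have hq0 : ∀ x, q x ≠ 0 := fun x => by have := hq x; positivity
  have hqa : ∀ x, |q x| = q x := fun x => abs_of_pos (lt_of_lt_of_le one_pos (hq x))
  have hd : ∀ x ∈ Set.univ, HasDerivWithinAt p (q x) Set.univ x :=
    fun x _ => (hp x).hasDerivWithinAt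
  have HI : Integrable H := by
    rw [← integrableOn_univ, ← himg, integrableOn_image_iff_integrableOn_abs_deriv_smul
      MeasurableSet.univ hd hmono.injective.injOn, integrableOn_univ]
    refine h1.congr (ae_of_all _ fun x => ?_)
    simp only [H, hg, hqa, smul_smul]
    rw [mul_inv_cancel₀ (hq0 x), one_smul]
  have HL : ∫⁻ y, ‖H y‖ₑ ^ 2 ≤ ∫⁻ x, ‖h x‖ₑ ^ 2 := by
    have := lintegral_image_eq_lintegral_abs_deriv_mul MeasurableSet.univ hd hmono.injective.injOn
      (fun y => ‖H y‖ₑ ^ 2)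
    rw [himg] at this
    simp only [Measure.restrict_univ] at this
    rw [this]
    apply lintegral_mono
    intro x
    simp only [H, hg, hqa, enorm_smul]
    rw [mul_pow, ← mul_assoc]
    apply mul_le_of_le_one_left (by positivity)
    have : ‖(q x)⁻¹‖ₑ = ENNReal.ofReal (q x)⁻¹ := by
      rw [Real.enorm_eq_ofReal]
      exact inv_nonneg.2 (zero_le_one.trans (hq x))
    rw [this, ← ENNReal.ofReal_pow (by have := hq x; positivity), ← ENNReal.ofReal_mul
      (by have := hq x; positivity), ENNReal.ofReal_le_one]
    have := hq x
    field_simp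
    exact this
  have H2 : MemLp H 2 volume :=
    (memLp_two_iff_lintegral HI.1).2 (HL.trans_lt h2.lintegral_two_lt_top)
  have hosc : ∀ θ, osc p h θ = FourierTransform.fourier H (-Real.pi⁻¹ * θ) := by
    intro θ
    rw [Real.fourier_real_eq_integral_exp_smul, ← setIntegral_univ (μ := volume), ← himg,
      integral_image_eq_integral_abs_deriv_smul MeasurableSet.univ hd hmono.injective.injOn,
      setIntegral_univ, osc]
    congr 1 with x
    simp only [H, hg, hqa]
    rw [smul_comm (q x), smul_smul (q x), mul_inv_cancel₀ (hq0 x), one_smul, smul_eq_mul]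
    congr 2
    push_cast
    have : (Real.pi : ℂ) ≠ 0 := by exact_mod_cast Real.pi_ne_zero
    field_simp
  simp_rw [hosc]
  have := lintegral_comp_le (s := Set.univ) MeasurableSet.univ (φ := fun θ => -Real.pi⁻¹ * θ)
    (φ' := fun _ => -Real.pi⁻¹) (fun x _ => by simpa using (hasDerivAt_id x).const_mul (-Real.pi⁻¹))
    (fun x _ y _ hxy => by simpa [Real.pi_ne_zero] using hxy) (c := Real.pi⁻¹)
    (by positivity) (fun x _ => by rw [abs_neg, abs_of_pos (by positivity)])
    (fun ξ => ‖FourierTransform.fourier H ξ‖ₑ ^ 2)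
  rw [Measure.restrict_univ, inv_inv] at this
  refine this.trans ?_
  rw [lintegral_fourier_sq HI H2]
  gcongr

theorem memLp_osc {h : ℝ → ℂ} (h1 : Integrable h) (h2 : MemLp h 2 volume) :
    MemLp (osc p h) 2 volume := by
  rw [memLp_two_iff_lintegral (continuous_osc (phase_continuous hp) h1).aestronglyMeasurable]
  exact (lintegral_osc_sq_le hp hq h1 h2).trans_lt
    (ENNReal.mul_lt_top ENNReal.ofReal_lt_top h2.lintegral_two_lt_top)

end Phase

section PhaseDerivative

variable {p q : ℝ → ℝ} (hp : ∀ x, HasDerivAt p (q x) x)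
include hp

/-- If `h = q L` with `L` continuously differentiable, then `2iθ ∫ e^{2iθp} h = -∫ e^{2iθp} L'`. -/
theorem osc_by_parts {h L L1 : ℝ → ℂ} (hh : ∀ x, h x = q x * L x) (hI : Integrable h)
    (hL : ∀ x, HasDerivAt L (L1 x) x) (hL1 : Integrable L1)
    (hbot : Tendsto L atBot (𝓝 0)) (htop : Tendsto L atTop (𝓝 0)) (θ : ℝ) :
    2 * Complex.I * θ * osc p h θ = -osc p L1 θ := by
  have hc := phase_continuous hp
  have hec : Continuous fun x => Complex.exp (2 * Complex.I * θ * p x) := by fun_prop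
  have hd : ∀ x, HasDerivAt (fun x => Complex.exp (2 * Complex.I * θ * p x) * L x)
      (2 * Complex.I * θ * (Complex.exp (2 * Complex.I * θ * p x) * h x) +
        Complex.exp (2 * Complex.I * θ * p x) * L1 x) x := by
    intro x
    have h1 := (((hp x).ofReal_comp.const_mul (2 * Complex.I * θ)).cexp).mul (hL x)
    refine h1.congr_deriv ?_
    rw [hh]; ring
  have i1 : Integrable fun x => Complex.exp (2 * Complex.I * θ * p x) * h x :=
    hI.bdd_mul (c := 1) hec.aestronglyMeasurable (ae_of_all _ fun x => (norm_exp_phase _ _).le)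
  have i2 : Integrable fun x => Complex.exp (2 * Complex.I * θ * p x) * L1 x :=
    hL1.bdd_mul (c := 1) hec.aestronglyMeasurable (ae_of_all _ fun x => (norm_exp_phase _ _).le)
  have lim : ∀ l : Filter ℝ, Tendsto L l (𝓝 0) →
      Tendsto (fun x => Complex.exp (2 * Complex.I * θ * p x) * L x) l (𝓝 0) := by
    intro l hl
    rw [tendsto_zero_iff_norm_tendsto_zero] at hl ⊢
    simpa only [norm_mul, norm_exp_phase, one_mul] using hl
  have key := integral_of_hasDerivAt_of_tendsto hd ((i1.const_mul _).add i2) (lim _ hbot)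
    (lim _ htop)
  rw [integral_add (i1.const_mul _) i2, integral_const_mul, sub_zero] at key
  exact eq_neg_of_add_eq_zero_left key

theorem hasDerivAt_osc {h : ℝ → ℂ} (hI : Integrable h) (hpI : Integrable fun x => p x * h x)
    (θ : ℝ) : HasDerivAt (osc p h) (2 * Complex.I * osc p (fun x => p x * h x) θ) θ := by
  have hc := phase_continuous hp
  have := (hasDerivAt_integral_of_dominated_loc_of_deriv_le (μ := volume) (x₀ := θ) (s := Set.univ)
    (F := fun θ x => Complex.exp (2 * Complex.I * (θ : ℝ) * p x) * h x)
    (F' := fun θ x => 2 * Complex.I * (Complex.exp (2 * Complex.I * (θ : ℝ) * p x) * (p x * h x)))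
    (bound := fun x => 2 * ‖p x * h x‖) univ_mem ?_ ?_ ?_ ?_ ?_ ?_).2
  · rw [integral_const_mul] at this
    exact this
  · exact Eventually.of_forall fun θ => (by fun_prop :
      Continuous fun x => Complex.exp (2 * Complex.I * θ * p x)).aestronglyMeasurable.mul hI.1
  · exact hI.bdd_mul (c := 1) (by fun_prop : Continuous fun x =>
      Complex.exp (2 * Complex.I * θ * p x)).aestronglyMeasurable
      (ae_of_all _ fun x => (norm_exp_phase _ _).le)
  · exact ((by fun_prop : Continuous fun x =>
      Complex.exp (2 * Complex.I * θ * p x)).aestronglyMeasurable.mul hpI.1).const_mul _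
  · refine ae_of_all _ fun x θ _ => ?_
    rw [norm_mul, norm_mul (Complex.exp _), norm_exp_phase]
    simp
  · exact hpI.norm.const_mul 2
  · refine ae_of_all _ fun x θ _ => ?_
    have h1 : HasDerivAt (fun θ : ℝ => 2 * Complex.I * (θ : ℂ) * p x) (2 * Complex.I * p x) θ := by
      simpa using ((hasDerivAt_id θ).ofReal_comp.const_mul (2 * Complex.I)).mul_const (p x : ℂ)
    exact (h1.cexp.mul_const (h x)).congr_deriv (by ring)

/-- Here p h need not be integrable, so differentiation under the integral sign is not available for
h. Integrating by parts first moves the problem to L', for which p L' is integrable; the price is a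
division by θ, hence the exclusion of θ = 0. -/
theorem differentiableAt_osc_of_by_parts {h L L1 : ℝ → ℂ} (hh : ∀ x, h x = q x * L x)
    (hI : Integrable h) (hL : ∀ x, HasDerivAt L (L1 x) x) (hL1 : Integrable L1)
    (hpL1 : Integrable fun x => p x * L1 x)
    (hbot : Tendsto L atBot (𝓝 0)) (htop : Tendsto L atTop (𝓝 0)) {θ : ℝ} (hθ : θ ≠ 0) :
    DifferentiableAt ℝ (osc p h) θ := by
  have h1 : (osc p h) =ᶠ[𝓝 θ] fun θ => -osc p L1 θ / (2 * Complex.I * θ) := by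
    filter_upwards [isOpen_ne.mem_nhds hθ] with t ht
    have ht' : (t : ℂ) ≠ 0 := by exact_mod_cast ht
    rw [← osc_by_parts hp hh hI hL hL1 hbot htop t]
    field_simp
  rw [h1.differentiableAt_iff]
  have hθ' : (θ : ℂ) ≠ 0 := by exact_mod_cast hθ
  refine ((hasDerivAt_osc hp hL1 hpL1 θ).differentiableAt.neg).div
    (DifferentiableAt.const_mul Complex.ofRealCLM.differentiableAt _) ?_
  simp [hθ]

/-- A difference quotient in θ is again an oscillatory integral, with a density dominated by 2|p h|.
The Plancherel bound is then uniform in the step, and Fatou passes it to the derivative, which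
exists off a null set. -/
theorem memLp_deriv_osc {h : ℝ → ℂ} (hI : Integrable h)
    (hp2 : MemLp (fun x => p x * h x) 2 volume) (hdiff : ∀ θ ≠ 0, DifferentiableAt ℝ (osc p h) θ)
    (hq : ∀ x, 1 ≤ q x) :
    MemLp (deriv (osc p h)) 2 volume := by
  have hc := phase_continuous hp
  rw [memLp_two_iff_lintegral (measurable_deriv _).aestronglyMeasurable]
  set t : ℕ → ℝ := fun n => 1 / ((n : ℝ) + 1)
  have ht0 : ∀ n, 0 < t n := fun n => by positivity
  have htl : Tendsto t atTop (𝓝 0) := tendsto_one_div_add_atTop_nhds_zero_nat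
  -- The density whose oscillatory integral is the difference quotient with step `t n`; |e^{iy} − 1|
  -- ≤ |y| bounds it uniformly in n.
  set g : ℕ → ℝ → ℂ := fun n x =>
    (t n : ℂ)⁻¹ * (Complex.exp (2 * Complex.I * (t n : ℝ) * p x) - 1) * h x
  have hgb : ∀ n x, ‖g n x‖ ≤ 2 * ‖p x * h x‖ := by
    intro n x
    simp only [g]
    have h1 : ‖Complex.exp (2 * Complex.I * (t n : ℝ) * p x) - 1‖ ≤ 2 * t n * |p x| := by
      have := Real.norm_exp_I_mul_ofReal_sub_one_le (x := 2 * t n * p x)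
      rw [Real.norm_eq_abs, abs_mul, abs_mul, abs_of_pos (ht0 n), abs_two] at this
      convert this using 4
      push_cast; ring
    rw [norm_mul, norm_mul, norm_inv, Complex.norm_real, Real.norm_of_nonneg (ht0 n).le, norm_mul,
      Complex.norm_real, Real.norm_eq_abs]
    calc _ ≤ (t n)⁻¹ * (2 * t n * |p x|) * ‖h x‖ := by
          gcongr
      _ = _ := by
          have := (ht0 n).ne'
          field_simp
  have hgm : ∀ n, AEStronglyMeasurable (g n) volume := fun n =>
    ((by fun_prop : Continuous fun x => (t n : ℂ)⁻¹ * (Complex.exp (2 * Complex.I * (t n : ℝ) * p x) - 1))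
      ).aestronglyMeasurable.mul hI.1
  have hgI : ∀ n, Integrable (g n) := fun n => by
    refine hI.bdd_mul (c := |(t n)⁻¹| * 2) (by fun_prop : Continuous fun x => (t n : ℂ)⁻¹ *
      (Complex.exp (2 * Complex.I * (t n : ℝ) * p x) - 1)).aestronglyMeasurable
      (ae_of_all _ fun x => ?_)
    rw [norm_mul, norm_inv, Complex.norm_real, Real.norm_eq_abs, abs_inv]
    gcongr
    refine (norm_sub_le _ _).trans ?_
    rw [norm_exp_phase]
    norm_num
  have hg2 : ∀ n, MemLp (g n) 2 volume := fun n =>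
    (hp2.norm.const_mul 2).mono (hgm n) (ae_of_all _ fun x => by
      refine (hgb n x).trans (le_abs_self _))
  have hquot : ∀ n θ, osc p (g n) θ = (t n)⁻¹ • (osc p h (θ + t n) - osc p h θ) := by
    intro n θ
    have i : ∀ θ : ℝ, Integrable fun x => Complex.exp (2 * Complex.I * θ * p x) * h x := fun θ =>
      hI.bdd_mul (c := 1) (by fun_prop : Continuous fun x =>
        Complex.exp (2 * Complex.I * θ * p x)).aestronglyMeasurable
        (ae_of_all _ fun x => (norm_exp_phase _ _).le)
    unfold osc
    rw [← integral_sub (i _) (i _), ← integral_smul]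
    congr 1 with x
    simp only [g, Complex.real_smul]
    have : Complex.exp (2 * Complex.I * ((θ + t n : ℝ) : ℂ) * p x) =
        Complex.exp (2 * Complex.I * θ * p x) * Complex.exp (2 * Complex.I * (t n : ℝ) * p x) := by
      rw [← Complex.exp_add]
      congr 1
      push_cast; ring
    rw [this]
    push_cast
    ring
  have hlim : ∀ θ ≠ 0, Tendsto (fun n => osc p (g n) θ) atTop (𝓝 (deriv (osc p h) θ)) := by
    intro θ hθ
    simp_rw [hquot]
    have h1 := (hasDerivAt_iff_tendsto_slope_zero.1 (hdiff θ hθ).hasDerivAt)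
    refine h1.comp (tendsto_nhdsWithin_iff.2 ⟨htl, Eventually.of_forall fun n => (ht0 n).ne'⟩)
  have hfat : ∫⁻ θ, ‖deriv (osc p h) θ‖ₑ ^ 2 ≤
      liminf (fun n => ∫⁻ θ, ‖osc p (g n) θ‖ₑ ^ 2) atTop := by
    refine le_trans (le_of_eq ?_) (lintegral_liminf_le fun n =>
      ((continuous_osc hc (hgI n)).measurable.enorm.pow_const 2))
    apply lintegral_congr_ae
    filter_upwards [compl_mem_ae_iff.2 (measure_singleton (0 : ℝ))] with θ hθ
    exact (((ENNReal.continuous_pow 2).tendsto _).comp (hlim θ hθ).enorm).liminf_eq.symm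
  refine hfat.trans_lt ?_
  have hb : ∀ n, ∫⁻ θ, ‖osc p (g n) θ‖ₑ ^ 2 ≤
      ENNReal.ofReal Real.pi * ∫⁻ x, ‖2 * ‖(p x : ℂ) * h x‖‖ₑ ^ 2 := by
    intro n
    refine (lintegral_osc_sq_le hp hq (hgI n) (hg2 n)).trans ?_
    gcongr with x
    rw [enorm_le_iff_norm_le, Real.norm_of_nonneg (by positivity)]
    exact hgb n x
  refine (liminf_le_of_le (h := ?_) (a := ENNReal.ofReal Real.pi *
    ∫⁻ x, ‖2 * ‖(p x : ℂ) * h x‖‖ₑ ^ 2)).trans_lt ?_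
  · intro b hb'
    obtain ⟨n, hn⟩ := hb'.exists
    exact hn.trans (hb n)
  · exact ENNReal.mul_lt_top ENNReal.ofReal_lt_top (hp2.norm.const_mul 2).lintegral_two_lt_top

end PhaseDerivative

/-! ### Primitives of locally integrable functions -/

/-- `f` is a primitive of the locally integrable function `g`. -/
def IsPrimitive {E : Type*} [NormedAddCommGroup E] [NormedSpace ℝ E] (f g : ℝ → E) : Prop :=
  LocallyIntegrable g ∧ ∀ a b, f b - f a = ∫ x in a..b, g x

theorem _root_.MeasureTheory.LocallyIntegrable.intervalIntegrable' {E : Type*} [NormedAddCommGroup E] {g : ℝ → E}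
    (hg : LocallyIntegrable g) (a b : ℝ) : IntervalIntegrable g volume a b :=
  intervalIntegrable_iff.mpr <|
    (hg.integrableOn_isCompact isCompact_uIcc).mono_set Set.uIoc_subset_uIcc

theorem _root_.MeasureTheory.LocallyIntegrable.of_intervalIntegrable {E : Type*} [NormedAddCommGroup E] {g : ℝ → E}
    (hg : ∀ a b, IntervalIntegrable g volume a b) : LocallyIntegrable g := by
  intro x
  refine ⟨Set.Icc (x - 1) (x + 1), Icc_mem_nhds (by linarith) (by linarith), ?_⟩
  exact (intervalIntegrable_iff_integrableOn_Icc_of_le (by linarith)).1 (hg (x - 1) (x + 1))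

section Primitive

variable {E : Type*} [NormedAddCommGroup E] [NormedSpace ℝ E]

namespace IsPrimitive

variable {f g : ℝ → E}

theorem intervalIntegrable (h : IsPrimitive f g) (a b : ℝ) : IntervalIntegrable g volume a b :=
  h.1.intervalIntegrable' a b

theorem eq_add (h : IsPrimitive f g) (a b : ℝ) : f b = f a + ∫ x in a..b, g x := by
  rw [← h.2]; abel

theorem continuous (h : IsPrimitive f g) : Continuous f := by
  have : f = fun x => f 0 + ∫ t in (0 : ℝ)..x, g t := funext fun x => h.eq_add 0 x
  rw [this]
  exact continuous_const.add (intervalIntegral.continuous_primitive h.intervalIntegrable 0)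

theorem of_hasDerivAt [CompleteSpace E] (hf : ∀ x, HasDerivAt f (g x) x) (hg : Continuous g) :
    IsPrimitive f g :=
  ⟨hg.locallyIntegrable, fun _ _ => (intervalIntegral.integral_eq_sub_of_hasDerivAt
    (fun x _ => hf x) (hg.intervalIntegrable _ _)).symm⟩

theorem hasDerivAt [CompleteSpace E] (h : IsPrimitive f g) (hg : Continuous g) (x : ℝ) :
    HasDerivAt f (g x) x := by
  have : f = fun x => f 0 + ∫ t in (0 : ℝ)..x, g t := funext fun x => h.eq_add 0 x
  rw [this]
  exact (intervalIntegral.integral_hasDerivAt_right (hg.intervalIntegrable _ _)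
    hg.aestronglyMeasurable.stronglyMeasurableAtFilter hg.continuousAt).const_add _

theorem congr (h : IsPrimitive f g) {g' : ℝ → E} (hg : g =ᵐ[volume] g') : IsPrimitive f g' :=
  ⟨(locallyIntegrable_congr hg).1 h.1, fun a b => by
    rw [h.2]; exact intervalIntegral.integral_congr_ae (hg.mono fun x hx _ => hx)⟩

theorem add {f' g' : ℝ → E} (h : IsPrimitive f g) (h' : IsPrimitive f' g') :
    IsPrimitive (fun x => f x + f' x) (fun x => g x + g' x) :=
  ⟨h.1.add h'.1, fun a b => by
    rw [intervalIntegral.integral_add (h.intervalIntegrable a b) (h'.intervalIntegrable a b),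
      ← h.2, ← h'.2]; module⟩

theorem neg (h : IsPrimitive f g) : IsPrimitive (fun x => -f x) (fun x => -g x) :=
  ⟨h.1.neg, fun a b => by rw [intervalIntegral.integral_neg, ← h.2]; module⟩

theorem sub {f' g' : ℝ → E} (h : IsPrimitive f g) (h' : IsPrimitive f' g') :
    IsPrimitive (fun x => f x - f' x) (fun x => g x - g' x) := by
  simpa only [sub_eq_add_neg] using h.add h'.neg

theorem ofReal {f g : ℝ → ℝ} (h : IsPrimitive f g) :
    IsPrimitive (fun x => (f x : ℂ)) (fun x => (g x : ℂ)) := by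
  refine ⟨LocallyIntegrable.of_intervalIntegrable fun a b =>
    ⟨(h.intervalIntegrable a b).1.ofReal, (h.intervalIntegrable a b).2.ofReal⟩,
    fun a b => ?_⟩
  rw [intervalIntegral.integral_ofReal, ← h.2]
  push_cast; rfl

theorem re {f g : ℝ → ℂ} (h : IsPrimitive f g) :
    IsPrimitive (fun x => (f x).re) (fun x => (g x).re) := by
  refine ⟨LocallyIntegrable.of_intervalIntegrable fun a b =>
    ⟨(h.intervalIntegrable a b).1.re, (h.intervalIntegrable a b).2.re⟩, fun a b => ?_⟩
  rw [← Complex.sub_re, h.2]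
  exact (Complex.reCLM.intervalIntegral_comp_comm (h.intervalIntegrable a b)).symm

theorem im {f g : ℝ → ℂ} (h : IsPrimitive f g) :
    IsPrimitive (fun x => (f x).im) (fun x => (g x).im) := by
  refine ⟨LocallyIntegrable.of_intervalIntegrable fun a b =>
    ⟨(h.intervalIntegrable a b).1.im, (h.intervalIntegrable a b).2.im⟩, fun a b => ?_⟩
  rw [← Complex.sub_im, h.2]
  exact (Complex.imCLM.intervalIntegral_comp_comm (h.intervalIntegrable a b)).symm

theorem absolutelyContinuous_real {f g : ℝ → ℝ} (h : IsPrimitive f g) (a b : ℝ) :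
    AbsolutelyContinuousOnInterval f a b := by
  have : f = fun x => (f a + 0 * x) + ∫ t in a..x, g t := funext fun x => by
    rw [zero_mul, add_zero]; exact h.eq_add a x
  rw [this]
  exact (ContDiffOn.absolutelyContinuousOnInterval (by fun_prop)).fun_add
    ((h.intervalIntegrable a b).absolutelyContinuousOnInterval_intervalIntegral (by simp))

theorem absolutelyContinuous {f g : ℝ → ℂ} (h : IsPrimitive f g) (a b : ℝ) :
    AbsolutelyContinuousOnInterval f a b := by
  have cast : ∀ {k : ℝ → ℝ}, AbsolutelyContinuousOnInterval k a b →
      AbsolutelyContinuousOnInterval (fun x => (k x : ℂ)) a b := by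
    intro k hk
    simpa only [AbsolutelyContinuousOnInterval, Complex.isometry_ofReal.dist_eq] using hk
  have h1 := (cast (h.re.absolutelyContinuous_real a b)).fun_add
    ((cast (h.im.absolutelyContinuous_real a b)).const_smul Complex.I)
  convert! h1 using 2 with x
  rw [smul_eq_mul, mul_comm, Complex.re_add_im]

theorem ae_hasDerivAt [CompleteSpace E] (h : IsPrimitive f g) : ∀ᵐ x, HasDerivAt f (g x) x := by
  filter_upwards [LocallyIntegrable.ae_hasDerivAt_integral h.1] with x hx
  have : f = fun x => f 0 + ∫ t in (0 : ℝ)..x, g t := funext fun x => h.eq_add 0 x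
  rw [this]
  exact (hx 0).const_add _

/-- The product minus the integral of the expected derivative is absolutely continuous with
derivative zero a.e., hence constant. This allows factors whose derivative is merely locally
integrable, as for m_x. -/
theorem mul {f g f' g' : ℝ → ℂ} (h : IsPrimitive f g) (h' : IsPrimitive f' g') :
    IsPrimitive (fun x => f x * f' x) (fun x => g x * f' x + f x * g' x) := by
  have hint : ∀ a b, IntervalIntegrable (fun x => g x * f' x + f x * g' x) volume a b :=
    fun a b => ((h.intervalIntegrable a b).mul_continuousOn h'.continuous.continuousOn).add
      ((h'.intervalIntegrable a b).continuousOn_mul h.continuous.continuousOn)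
  have hloc := LocallyIntegrable.of_intervalIntegrable hint
  refine ⟨hloc, fun a b => ?_⟩
  set F : ℝ → ℂ := fun x => ∫ t in a..x, (g t * f' t + f t * g' t)
  have hF : IsPrimitive F (fun x => g x * f' x + f x * g' x) :=
    ⟨hloc, fun c d => intervalIntegral.integral_interval_sub_left (hint _ _) (hint _ _)⟩
  have hac : AbsolutelyContinuousOnInterval (fun x => f x * f' x - F x) a b :=
    ((h.absolutelyContinuous a b).fun_smul (h'.absolutelyContinuous a b)).fun_sub
      (hF.absolutelyContinuous a b)
  obtain ⟨C, hC⟩ := hac.const_of_ae_hasDerivAt_zero (by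
    filter_upwards [h.ae_hasDerivAt, h'.ae_hasDerivAt, hF.ae_hasDerivAt] with x h1 h2 h3 _
    exact ((h1.mul h2).sub h3).congr_deriv (sub_self _))
  have ha := hC a Set.left_mem_uIcc
  have hb := hC b Set.right_mem_uIcc
  have hFa : F a = 0 := intervalIntegral.integral_same
  rw [hFa, sub_zero] at ha
  show f b * f' b - f a * f' a = F b
  rw [ha, ← hb]; abel

theorem mul_real {f g f' g' : ℝ → ℝ} (h : IsPrimitive f g) (h' : IsPrimitive f' g') :
    IsPrimitive (fun x => f x * f' x) (fun x => g x * f' x + f x * g' x) := by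
  have := (h.ofReal.mul h'.ofReal).re
  simpa [← Complex.ofReal_mul, ← Complex.ofReal_add] using this

theorem const_mul {f g : ℝ → ℂ} (c : ℂ) (h : IsPrimitive f g) :
    IsPrimitive (fun x => c * f x) (fun x => c * g x) :=
  ⟨LocallyIntegrable.of_intervalIntegrable fun a b => (h.intervalIntegrable a b).const_mul c,
    fun a b => by rw [intervalIntegral.integral_const_mul, ← h.2]; ring⟩

theorem integral_eq [CompleteSpace E] (h : IsPrimitive f g) (hg : Integrable g) {l r : E}
    (hl : Tendsto f atBot (𝓝 l)) (hr : Tendsto f atTop (𝓝 r)) : ∫ x, g x = r - l := by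
  have h1 : Tendsto (fun n : ℝ => ∫ x in -n..n, g x) atTop (𝓝 (∫ x, g x)) :=
    intervalIntegral_tendsto_integral hg tendsto_neg_atTop_atBot tendsto_id
  refine tendsto_nhds_unique h1 ?_
  simp_rw [← h.2]
  exact hr.sub (hl.comp tendsto_neg_atTop_atBot)

theorem sub_eq_integral_Iic [CompleteSpace E] (h : IsPrimitive f g) (hg : Integrable g) {l : E}
    (hl : Tendsto f atBot (𝓝 l)) (x : ℝ) : f x - l = ∫ y in Set.Iic x, g y := by
  have h1 := intervalIntegral_tendsto_integral_Iic x hg.integrableOn tendsto_id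
  refine tendsto_nhds_unique ?_ h1
  simp_rw [← h.2]
  exact hl.const_sub _

theorem sub_eq_integral_Ioi [CompleteSpace E] (h : IsPrimitive f g) (hg : Integrable g) {r : E}
    (hr : Tendsto f atTop (𝓝 r)) (x : ℝ) : r - f x = ∫ y in Set.Ioi x, g y := by
  have h1 := intervalIntegral_tendsto_integral_Ioi x hg.integrableOn tendsto_id
  refine tendsto_nhds_unique ?_ h1
  simp_rw [← h.2]
  exact hr.sub_const _

theorem exists_tendsto_atTop [CompleteSpace E] (h : IsPrimitive f g) (hg : Integrable g) :
    ∃ r, Tendsto f atTop (𝓝 r) := by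
  refine ⟨f 0 + ∫ y in Set.Ioi 0, g y, ?_⟩
  have : f = fun x => f 0 + ∫ t in (0 : ℝ)..x, g t := funext fun x => h.eq_add 0 x
  rw [this]
  simp only [intervalIntegral.integral_same, add_zero]
  exact (intervalIntegral_tendsto_integral_Ioi 0 hg.integrableOn tendsto_id).const_add _

theorem exists_tendsto_atBot [CompleteSpace E] (h : IsPrimitive f g) (hg : Integrable g) :
    ∃ r, Tendsto f atBot (𝓝 r) := by
  refine ⟨f 0 - ∫ y in Set.Iic 0, g y, ?_⟩
  have : f = fun x => f 0 - ∫ t in x..(0 : ℝ), g t := funext fun x => by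
    rw [← h.2]; abel
  rw [this]
  simp only [intervalIntegral.integral_same, sub_zero]
  exact (intervalIntegral_tendsto_integral_Iic 0 hg.integrableOn tendsto_id).const_sub _

theorem norm_sub_le [CompleteSpace E] (h : IsPrimitive f g) (hg : Integrable g) {l : E}
    (hl : Tendsto f atBot (𝓝 l)) (x : ℝ) : ‖f x - l‖ ≤ ∫ y, ‖g y‖ := by
  rw [h.sub_eq_integral_Iic hg hl]
  exact (norm_integral_le_integral_norm _).trans
    (setIntegral_le_integral hg.norm (ae_of_all _ fun x => norm_nonneg _))

end IsPrimitive

end Primitive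

/-! ### Weak derivatives -/

/-- A locally integrable function with vanishing weak derivative is a.e. constant. -/
theorem ae_eq_const_of_integral_deriv_smul_eq_zero {f : ℝ → ℝ} (hf : LocallyIntegrable f)
    (h : ∀ φ : ℝ → ℝ, ContDiff ℝ ∞ φ → HasCompactSupport φ → ∫ x, deriv φ x • f x = 0) :
    ∃ c : ℝ, ∀ᵐ x, f x = c := by
  obtain ⟨η, hη, hηc, hη1⟩ : ∃ η : ℝ → ℝ, ContDiff ℝ ∞ η ∧ HasCompactSupport η ∧ ∫ x, η x = 1 := by
    let b : ContDiffBump (0 : ℝ) := ⟨1, 2, by norm_num, by norm_num⟩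
    exact ⟨b.normed volume, b.contDiff_normed, b.hasCompactSupport_normed, b.integral_normed⟩
  refine ⟨∫ x, η x • f x, ?_⟩
  apply ae_eq_of_integral_contDiff_smul_eq hf (continuous_const.locallyIntegrable)
  intro ψ hψ hψc
  set c := ∫ x, ψ x
  -- Subtracting c η makes the mean zero, so χ is the derivative of a test function and the
  -- hypothesis applies to its primitive.
  set χ : ℝ → ℝ := fun x => ψ x - c * η x
  have hχ : ContDiff ℝ ∞ χ := hψ.sub (contDiff_const.mul hη)
  have hχc : HasCompactSupport χ := hψc.sub (hηc.mul_left (f := fun _ => c))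
  have iψ := hψ.continuous.integrable_of_hasCompactSupport (μ := volume) hψc
  have iη := hη.continuous.integrable_of_hasCompactSupport (μ := volume) hηc
  have hχ0 : ∫ x, χ x = 0 := by
    simp only [χ]
    rw [integral_sub iψ (iη.const_mul c), integral_const_mul, hη1, mul_one, sub_self]
  have iχ := hχ.continuous.integrable_of_hasCompactSupport (μ := volume) hχc
  set φ : ℝ → ℝ := fun x => ∫ t in Set.Iic x, χ t
  have hφ0 : ∀ x, φ x = (∫ t in Set.Iic (0 : ℝ), χ t) + ∫ t in (0 : ℝ)..x, χ t := fun x => by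
    have := intervalIntegral.integral_Iic_sub_Iic (a := 0) (b := x) iχ.integrableOn iχ.integrableOn
    rw [← this]; simp only [φ]; ring
  have hφd : ∀ x, HasDerivAt φ (χ x) x := fun x => by
    rw [funext hφ0]
    exact (intervalIntegral.integral_hasDerivAt_right (hχ.continuous.intervalIntegrable _ _)
      hχ.continuous.aestronglyMeasurable.stronglyMeasurableAtFilter
      hχ.continuous.continuousAt).const_add _
  have hφs : ContDiff ℝ ∞ φ := by
    refine contDiff_infty_iff_deriv.2 ⟨fun x => (hφd x).differentiableAt, ?_⟩
    rw [funext fun x => (hφd x).deriv]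
    exact hχ
  -- To the left of the support of χ the primitive is trivially 0; to the right it equals the total
  -- integral of χ, which vanishes.
  have hφc : HasCompactSupport φ := by
    obtain ⟨R, hR⟩ := hχc.isCompact.isBounded.subset_closedBall 0
    refine HasCompactSupport.intro (isCompact_closedBall (0 : ℝ) R) fun x hx => ?_
    have hz : ∀ t, t ∉ Metric.closedBall (0 : ℝ) R → χ t = 0 := fun t ht =>
      image_eq_zero_of_notMem_tsupport fun h' => ht (hR h')
    rw [Metric.mem_closedBall, dist_zero_right, Real.norm_eq_abs, not_le, lt_abs] at hx
    rcases hx with hx | hx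
    · have h1 : φ x = (∫ t, χ t) - ∫ t in Set.Ioi x, χ t := by
        rw [← intervalIntegral.integral_Iic_add_Ioi (b := x) iχ.integrableOn iχ.integrableOn]
        simp only [φ]; ring
      rw [h1, hχ0, setIntegral_eq_zero_of_forall_eq_zero, sub_zero]
      intro t ht
      apply hz
      rw [Metric.mem_closedBall, dist_zero_right, Real.norm_eq_abs, not_le]
      exact (hx.trans ht).trans_le (le_abs_self _)
    · apply setIntegral_eq_zero_of_forall_eq_zero
      intro t ht
      apply hz
      rw [Metric.mem_closedBall, dist_zero_right, Real.norm_eq_abs, not_le]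
      have : t ≤ x := ht
      exact lt_of_lt_of_le (by linarith) (neg_le_abs t)
  have key := h φ hφs hφc
  simp_rw [fun x => (hφd x).deriv, χ, sub_smul] at key
  have i1 : Integrable fun x => ψ x • f x :=
    hf.integrable_smul_left_of_hasCompactSupport hψ.continuous hψc
  have i2 : Integrable fun x => η x • f x :=
    hf.integrable_smul_left_of_hasCompactSupport hη.continuous hηc
  simp_rw [mul_smul] at key
  have i3 : Integrable fun x => c • η x • f x := i2.smul c
  rw [integral_sub i1 i3, integral_smul, sub_eq_zero] at key
  rw [key, integral_smul_const]

theorem IsPrimitive.isWeakDeriv_real {f g : ℝ → ℝ} (h : IsPrimitive f g) : IsWeakDeriv f g := by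
  refine ⟨h.continuous.locallyIntegrable, h.1, fun φ hφ hφc => ?_⟩
  have hφp : IsPrimitive φ (deriv φ) := IsPrimitive.of_hasDerivAt
    (fun x => (hφ.differentiable (by simp) x).hasDerivAt) (hφ.continuous_deriv (by simp))
  have hm := hφp.mul_real h
  have hφ0 : ∀ l : Filter ℝ, l ≤ cocompact ℝ → Tendsto (fun x => φ x * f x) l (𝓝 0) := by
    intro l hl
    refine tendsto_nhds_of_eventually_eq (hl ?_)
    filter_upwards [hφc.compl_mem_cocompact] with x hx
    rw [image_eq_zero_of_notMem_tsupport hx, zero_mul]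
  have i1 : Integrable fun x => deriv φ x * f x :=
    h.continuous.locallyIntegrable.integrable_smul_left_of_hasCompactSupport
      (hφ.continuous_deriv (by simp)) hφc.deriv
  have i2 : Integrable fun x => φ x * g x :=
    h.1.integrable_smul_left_of_hasCompactSupport hφ.continuous hφc
  have key := hm.integral_eq (i1.add i2) (hφ0 _ atBot_le_cocompact) (hφ0 _ atTop_le_cocompact)
  rw [integral_add i1 i2, sub_zero] at key
  exact eq_neg_of_add_eq_zero_left key

/-- A function with a weak derivative coincides a.e. with a primitive of that derivative. -/
theorem IsWeakDeriv.exists_isPrimitive {f g : ℝ → ℝ} (h : IsWeakDeriv f g) :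
    ∃ f₀ : ℝ → ℝ, IsPrimitive f₀ g ∧ f =ᵐ[volume] f₀ := by
  obtain ⟨hf, hg, hfg⟩ := h
  set F : ℝ → ℝ := fun x => ∫ t in (0 : ℝ)..x, g t
  have hF : IsPrimitive F g := ⟨hg, fun c d => intervalIntegral.integral_interval_sub_left
    (hg.intervalIntegrable' _ _) (hg.intervalIntegrable' _ _)⟩
  obtain ⟨c, hc⟩ := ae_eq_const_of_integral_deriv_smul_eq_zero
    (hf.sub hF.continuous.locallyIntegrable) (fun φ hφ hφc => by
      have i1 : Integrable fun x => deriv φ x • f x :=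
        hf.integrable_smul_left_of_hasCompactSupport (hφ.continuous_deriv (by simp)) hφc.deriv
      have i2 : Integrable fun x => deriv φ x • F x :=
        hF.continuous.locallyIntegrable.integrable_smul_left_of_hasCompactSupport
          (hφ.continuous_deriv (by simp)) hφc.deriv
      simp only [Pi.sub_apply, smul_sub]
      rw [integral_sub i1 i2, hfg φ hφ hφc, hF.isWeakDeriv_real.2.2 φ hφ hφc, sub_self])
  refine ⟨fun x => F x + c, ⟨hg, fun a b => ?_⟩, ?_⟩
  · rw [← hF.2]; ring
  · filter_upwards [hc] with x hx
    rw [← hx]; simp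

/-! ### Hardy's inequality -/

/-- This controls the boundary term in Hardy's inequality. Write f(N) as minus the integral of f'
over (N, ∞) and split |f'| by the arithmetic-geometric inequality against x^{k+1}. The parameter T =
N^{k+1/2} balances the two parts, because the integral of x^{−(2k+2)} over (N, ∞) is at most T⁻². -/
theorem sq_mul_le_of_tendsto_zero (k : ℕ) {f f1 : ℝ → ℝ} (hf : ∀ x, HasDerivAt f (f1 x) x)
    (hf1 : Continuous f1) (hlim : Tendsto f atTop (𝓝 0))
    (h2 : IntegrableOn (fun x => (x ^ (k + 1) * f1 x) ^ 2) (Set.Ioi 0)) {N : ℝ} (hN : 0 < N) :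
    N ^ (2 * k + 1) * f N ^ 2 ≤ ((∫ x in Set.Ioi 0, (x ^ (k + 1) * f1 x) ^ 2) + 1) ^ 2 := by
  set M := ∫ x in Set.Ioi 0, (x ^ (k + 1) * f1 x) ^ 2
  have hM : 0 ≤ M := setIntegral_nonneg measurableSet_Ioi fun x _ => sq_nonneg _
  set T := Real.sqrt N ^ (2 * k + 1)
  have hT : 0 < T := by positivity
  have hT2 : T ^ 2 = N ^ (2 * k + 1) := by
    simp only [T]
    rw [← pow_mul, mul_comm, pow_mul, Real.sq_sqrt hN.le]
  have hr : (-(2 * k + 2 : ℝ)) < -1 := by have : (0 : ℝ) ≤ k := Nat.cast_nonneg k; linarith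
  have i0 := integrableOn_Ioi_rpow_of_lt hr hN
  have e0 := integral_Ioi_rpow_of_lt hr hN
  have i2 : IntegrableOn (fun x => (x ^ (k + 1) * f1 x) ^ 2) (Set.Ioi N) :=
    h2.mono_set (Set.Ioi_subset_Ioi hN.le)
  have hb : ∀ x ∈ Set.Ioi N, ‖f1 x‖ ≤ T⁻¹ / 2 * (x ^ (k + 1) * f1 x) ^ 2 +
      T / 2 * x ^ (-(2 * k + 2 : ℝ)) := by
    intro x hx
    have hx0 : 0 < x := hN.trans hx
    have e : x ^ (-(2 * k + 2 : ℝ)) = ((x ^ (k + 1))⁻¹) ^ 2 := by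
      rw [Real.rpow_neg hx0.le, inv_pow, ← pow_mul]
      congr 1
      rw [← Real.rpow_natCast]
      congr 1
      push_cast; ring
    rw [e, Real.norm_eq_abs]
    have hy : 0 < x ^ (k + 1) := by positivity
    set y := x ^ (k + 1)
    have : 0 ≤ T / 2 * (T⁻¹ * (y * |f1 x|) - y⁻¹) ^ 2 := by positivity
    have e2 : T / 2 * (T⁻¹ * (y * |f1 x|) - y⁻¹) ^ 2 =
        T⁻¹ / 2 * (y * f1 x) ^ 2 + T / 2 * y⁻¹ ^ 2 - |f1 x| := by
      rw [mul_pow y (f1 x), ← sq_abs (f1 x)]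
      field_simp
      ring
    linarith
  have ib : IntegrableOn (fun x => T⁻¹ / 2 * (x ^ (k + 1) * f1 x) ^ 2 +
      T / 2 * x ^ (-(2 * k + 2 : ℝ))) (Set.Ioi N) := (i2.const_mul _).add (i0.const_mul _)
  have if1 : IntegrableOn f1 (Set.Ioi N) := Integrable.mono' ib hf1.aestronglyMeasurable
    ((ae_restrict_iff' measurableSet_Ioi).2 (ae_of_all _ hb))
  have hfN : |f N| ≤ T⁻¹ * (M + 1) := by
    have e1 : ∫ x in Set.Ioi N, f1 x = 0 - f N :=
      integral_Ioi_of_hasDerivAt_of_tendsto' (fun x _ => hf x) if1 hlim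
    have : |f N| = ‖∫ x in Set.Ioi N, f1 x‖ := by rw [e1]; simp
    rw [this]
    calc _ ≤ ∫ x in Set.Ioi N, (T⁻¹ / 2 * (x ^ (k + 1) * f1 x) ^ 2 +
          T / 2 * x ^ (-(2 * k + 2 : ℝ))) :=
          norm_integral_le_of_norm_le ib ((ae_restrict_iff' measurableSet_Ioi).2 (ae_of_all _ hb))
      _ = T⁻¹ / 2 * (∫ x in Set.Ioi N, (x ^ (k + 1) * f1 x) ^ 2) +
          T / 2 * (∫ x in Set.Ioi N, x ^ (-(2 * k + 2 : ℝ))) := by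
          rw [integral_add (i2.const_mul _) (i0.const_mul _), integral_const_mul,
            integral_const_mul]
      _ ≤ T⁻¹ / 2 * M + T / 2 * (T ^ 2)⁻¹ := by
          gcongr
          · exact setIntegral_mono_set h2 (ae_of_all _ fun x => sq_nonneg _)
              (Set.Ioi_subset_Ioi hN.le).eventuallyLE
          · rw [e0, hT2, ← Real.rpow_natCast, ← Real.rpow_neg hN.le]
            have e3 : -(2 * k + 2 : ℝ) + 1 = -((2 * k + 1 : ℕ) : ℝ) := by push_cast; ring
            rw [e3, neg_div_neg_eq]
            apply div_le_self (by positivity)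
            push_cast
            have : (0 : ℝ) ≤ k := Nat.cast_nonneg k
            linarith
      _ ≤ _ := by
          have : T / 2 * (T ^ 2)⁻¹ = T⁻¹ / 2 := by field_simp
          rw [this]
          have : 0 < T⁻¹ := by positivity
          nlinarith
  rw [← hT2, ← sq_abs (f N), ← mul_pow]
  gcongr
  calc T * |f N| ≤ T * (T⁻¹ * (M + 1)) := by gcongr
    _ = _ := by field_simp

/-- Integrate the derivative of x^{2k+1} f² over [0, N] and absorb the cross term by completing a
square; the boundary term at N is bounded independently of N. -/
theorem hardy_Ioi (k : ℕ) {f f1 : ℝ → ℝ} (hf : ∀ x, HasDerivAt f (f1 x) x)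
    (hf1 : Continuous f1) (hlim : Tendsto f atTop (𝓝 0))
    (h2 : IntegrableOn (fun x => (x ^ (k + 1) * f1 x) ^ 2) (Set.Ioi 0)) :
    IntegrableOn (fun x => (x ^ k * f x) ^ 2) (Set.Ioi 0) := by
  have hfc : Continuous f := continuous_iff_continuousAt.2 fun x => (hf x).continuousAt
  set M := ∫ x in Set.Ioi 0, (x ^ (k + 1) * f1 x) ^ 2
  have hM : 0 ≤ M := setIntegral_nonneg measurableSet_Ioi fun x _ => sq_nonneg _
  apply integrableOn_Ioi_of_intervalIntegral_norm_bounded (2 * ((M + 1) ^ 2 + 2 * M)) 0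
    (b := fun N : ℝ => N) (l := atTop) (fun N => (by fun_prop : Continuous
      fun x => (x ^ k * f x) ^ 2).integrableOn_Ioc) tendsto_id
  filter_upwards [eventually_gt_atTop 0] with N hN
  simp_rw [Real.norm_of_nonneg (sq_nonneg _)]
  have ii : ∀ {g : ℝ → ℝ}, Continuous g → IntervalIntegrable g volume 0 N :=
    fun hg => hg.intervalIntegrable _ _
  have e1 : ∫ x in (0 : ℝ)..N, ((2 * k + 1) * (x ^ k * f x) ^ 2 +
      2 * (x ^ (k + 1) * f1 x) * (x ^ k * f x)) = N ^ (2 * k + 1) * f N ^ 2 := by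
    have := intervalIntegral.integral_eq_sub_of_hasDerivAt (a := 0) (b := N)
      (f := fun x => x ^ (2 * k + 1) * f x ^ 2)
      (f' := fun x => (2 * k + 1) * (x ^ k * f x) ^ 2 + 2 * (x ^ (k + 1) * f1 x) * (x ^ k * f x))
      (fun x _ => by
        refine ((hasDerivAt_pow (2 * k + 1) x).mul ((hf x).pow 2)).congr_deriv ?_
        simp only [Nat.add_sub_cancel, Pi.pow_apply]
        push_cast
        ring) (ii (by fun_prop))
    rw [this]
    simp
  have e2 : ∫ x in (0 : ℝ)..N, (x ^ (k + 1) * f1 x) ^ 2 ≤ M := by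
    rw [intervalIntegral.integral_of_le hN.le]
    exact setIntegral_mono_set h2 (ae_of_all _ fun x => sq_nonneg _)
      (Set.Ioc_subset_Ioi_self).eventuallyLE
  have e3 : ∫ x in (0 : ℝ)..N, (1 / 2 * (x ^ k * f x) ^ 2 - 2 * (x ^ (k + 1) * f1 x) ^ 2) ≤
      ∫ x in (0 : ℝ)..N, ((2 * k + 1) * (x ^ k * f x) ^ 2 +
      2 * (x ^ (k + 1) * f1 x) * (x ^ k * f x)) := by
    apply intervalIntegral.integral_mono_on hN.le (ii (by fun_prop)) (ii (by fun_prop))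
    intro x _
    have : (0 : ℝ) ≤ k * (x ^ k * f x) ^ 2 := by positivity
    nlinarith [sq_nonneg (x ^ k * f x + 2 * (x ^ (k + 1) * f1 x))]
  rw [intervalIntegral.integral_sub (ii (by fun_prop)) (ii (by fun_prop)),
    intervalIntegral.integral_const_mul, intervalIntegral.integral_const_mul, e1] at e3
  have e4 := sq_mul_le_of_tendsto_zero k hf hf1 hlim h2 hN
  linarith

theorem hardy_Iio (k : ℕ) {f f1 : ℝ → ℝ} (hf : ∀ x, HasDerivAt f (f1 x) x)
    (hf1 : Continuous f1) (hlim : Tendsto f atBot (𝓝 0))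
    (h2 : IntegrableOn (fun x => (x ^ (k + 1) * f1 x) ^ 2) (Set.Iio 0)) :
    IntegrableOn (fun x => (x ^ k * f x) ^ 2) (Set.Iio 0) := by
  have refl : ∀ g : ℝ → ℝ, IntegrableOn (fun x => g (-x)) (Set.Ioi 0) ↔
      IntegrableOn g (Set.Iio 0) := by
    intro g
    have := (Measure.measurePreserving_neg (volume : Measure ℝ)).integrableOn_comp_preimage
      (Homeomorph.neg ℝ).measurableEmbedding (f := g) (s := Set.Iio 0)
    rw [← this]
    simp [Function.comp_def]
  have par : ∀ (j : ℕ) (a x : ℝ), ((-x) ^ j * a) ^ 2 = (x ^ j * a) ^ 2 := by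
    intro j a x
    rw [mul_pow, mul_pow, ← pow_mul, mul_comm j 2, pow_mul, neg_sq, ← pow_mul, mul_comm 2 j,
      pow_mul]
  rw [← refl] at h2 ⊢
  have := hardy_Ioi k (f := fun x => f (-x)) (f1 := fun x => -f1 (-x))
    (fun x => ((hf (-x)).comp x (hasDerivAt_neg x)).congr_deriv (by ring)) (by fun_prop)
    (hlim.comp tendsto_neg_atTop_atBot)
    (h2.congr_fun (fun x _ => by
      simp only
      rw [par, mul_neg, neg_sq]) measurableSet_Ioi)
  exact this.congr_fun (fun x _ => (par _ _ _).symm) measurableSet_Ioi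

theorem memLp_pow_mul_of_deriv (k : ℕ) {f f1 : ℝ → ℝ} (hf : ∀ x, HasDerivAt f (f1 x) x)
    (hf1 : Continuous f1) (hbot : Tendsto f atBot (𝓝 0)) (htop : Tendsto f atTop (𝓝 0))
    (h2 : MemLp (fun x => x ^ (k + 1) * f1 x) 2 volume) :
    MemLp (fun x => x ^ k * f x) 2 volume := by
  have hfc : Continuous f := continuous_iff_continuousAt.2 fun x => (hf x).continuousAt
  rw [memLp_two_iff_integrable_sq (by fun_prop)] at h2 ⊢
  rw [← integrableOn_univ, ← Set.Iio_union_Ici (a := (0 : ℝ)), integrableOn_union,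
    integrableOn_Ici_iff_integrableOn_Ioi]
  exact ⟨hardy_Iio k hf hf1 hbot h2.integrableOn, hardy_Ioi k hf hf1 htop h2.integrableOn⟩

/-! ### Regularity of the momentum -/

/-- Pointwise 2|f| ≤ (1 + x²) f² + (1 + x²)⁻¹, and both terms on the right are integrable. -/
theorem integrable_of_memLp_weight {f : ℝ → ℝ} (hf : AEStronglyMeasurable f)
    (h : MemLp f 2 volume) (h' : MemLp (fun x => x * f x) 2 volume) : Integrable f := by
  have h1 := (memLp_two_iff_integrable_sq h.1).1 h
  have h2 := (memLp_two_iff_integrable_sq h'.1).1 h'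
  refine Integrable.mono' ((h1.add h2).add integrable_inv_one_add_sq) hf (ae_of_all _ fun x => ?_)
  simp only [Pi.add_apply, Real.norm_eq_abs]
  have hx : 0 < 1 + x ^ 2 := by positivity
  have e : f x ^ 2 + (x * f x) ^ 2 = (1 + x ^ 2) * |f x| ^ 2 := by rw [sq_abs]; ring
  rw [e]
  have e2 : (1 + x ^ 2) * |f x| ^ 2 + (1 + x ^ 2)⁻¹ - 2 * |f x| =
      (1 + x ^ 2) * (|f x| - (1 + x ^ 2)⁻¹) ^ 2 := by field_simp; ring
  have : 0 ≤ (1 + x ^ 2) * (|f x| - (1 + x ^ 2)⁻¹) ^ 2 := by positivity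
  have := abs_nonneg (f x)
  linarith

theorem tendsto_zero_of_memLp_two {f : ℝ → ℝ} {l : Filter ℝ} (hl : l = atTop ∨ l = atBot)
    (h : MemLp f 2 volume) {c : ℝ} (hc : Tendsto f l (𝓝 c)) : c = 0 := by
  by_contra hne
  have h1 := (memLp_two_iff_integrable_sq h.1).1 h
  have h2 : Tendsto (fun x => f x ^ 2) l (𝓝 (c ^ 2)) := hc.pow 2
  have hpos : 0 < c ^ 2 := by positivity
  have h3 : ∀ᶠ x in l, c ^ 2 / 2 ≤ f x ^ 2 := h2.eventually (eventually_ge_nhds (by linarith))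
  have : ∃ s : Set ℝ, MeasurableSet s ∧ volume s = ⊤ ∧ ∀ x ∈ s, c ^ 2 / 2 ≤ f x ^ 2 := by
    rcases hl with rfl | rfl
    · obtain ⟨N, hN⟩ := eventually_atTop.1 h3
      exact ⟨Set.Ici N, measurableSet_Ici, Real.volume_Ici, hN⟩
    · obtain ⟨N, hN⟩ := eventually_atBot.1 h3
      exact ⟨Set.Iic N, measurableSet_Iic, Real.volume_Iic, hN⟩
  obtain ⟨s, hs, hs', hs''⟩ := this
  have h4 : IntegrableOn (fun _ : ℝ => c ^ 2 / 2) s := by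
    refine Integrable.mono' h1.integrableOn (by fun_prop)
      ((ae_restrict_iff' hs).2 (ae_of_all _ fun x hx => ?_))
    rw [Real.norm_of_nonneg (by positivity)]
    exact hs'' x hx
  rw [integrableOn_const_iff] at h4
  rcases h4 with h4 | h4
  · have : c ^ 2 / 2 = 0 := by simpa using h4
    linarith
  · rw [hs'] at h4
    exact lt_irrefl _ h4

/-- The regularity and decay of the momentum of a function in `H^{4,2}(ℝ)`. -/
theorem exists_momentum_regularity {u : ℝ → ℝ} (hc : Continuous u) (hu : MemH 4 2 u) :
    ∃ mx n : ℝ → ℝ, (∀ x, HasDerivAt (momentum u) (mx x) x) ∧ IsPrimitive mx n ∧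
      MemLp (momentum u) 2 volume ∧
      MemLp (fun x => (1 + x ^ 2) * mx x) 2 volume ∧
      MemLp (fun x => (1 + x ^ 2) * n x) 2 volume := by
  obtain ⟨hu2, D, hD0, hD⟩ := hu
  have hw : ∀ j < 4, MemLp (fun x => (1 + x ^ 2) * D (j + 1) x) 2 volume := by
    intro j hj
    simpa using (hD j hj).2
  -- Each weak derivative gets a continuous representative. Descending the chain, these are
  -- classical derivatives of one another up to order three, so the classical `deriv` in `momentum`
  -- is the correct one. No weight falls on u itself, hence none on m.
  obtain ⟨d3, h3, e3⟩ := (hD 3 (by norm_num)).1.exists_isPrimitive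
  obtain ⟨d2, h2, e2⟩ := (hD 2 (by norm_num)).1.exists_isPrimitive
  obtain ⟨d1, h1, e1⟩ := (hD 1 (by norm_num)).1.exists_isPrimitive
  obtain ⟨d0, h0, e0⟩ := (hD 0 (by norm_num)).1.exists_isPrimitive
  have h2' := (h2.congr e3).hasDerivAt h3.continuous
  have h1' := (h1.congr e2).hasDerivAt h2.continuous
  have h0' := (h0.congr e1).hasDerivAt h1.continuous
  rw [hD0] at e0
  have hu0 : u = d0 := (hc.ae_eq_iff_eq volume h0.continuous).1 e0
  have hdu : deriv u = d1 := by rw [hu0]; exact funext fun x => (h0' x).deriv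
  have hddu : deriv (deriv u) = d2 := by rw [hdu]; exact funext fun x => (h1' x).deriv
  have hm : momentum u = fun x => u x - d2 x := by
    ext x; rw [momentum, hddu]
  have hweight : ∀ {f g : ℝ → ℝ}, f =ᵐ[volume] g → MemLp (fun x => (1 + x ^ 2) * f x) 2 volume →
      MemLp (fun x => (1 + x ^ 2) * g x) 2 volume := by
    intro f g hfg hf
    exact (memLp_congr_ae (hfg.mono fun x hx => by simp only [hx])).1 hf
  have hl : ∀ {f : ℝ → ℝ}, Continuous f → MemLp (fun x => (1 + x ^ 2) * f x) 2 volume →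
      MemLp f 2 volume := by
    intro f hf h
    refine h.mono hf.aestronglyMeasurable (ae_of_all _ fun x => ?_)
    rw [norm_mul]
    apply le_mul_of_one_le_left (norm_nonneg _)
    rw [Real.norm_of_nonneg (by positivity)]
    nlinarith [sq_nonneg x]
  have w1 := hweight e1 (hw 0 (by norm_num))
  have w2 := hweight e2 (hw 1 (by norm_num))
  have w3 := hweight e3 (hw 2 (by norm_num))
  have w4 := hw 3 (by norm_num)
  refine ⟨fun x => d1 x - d3 x, fun x => d2 x - D 4 x, ?_, (h1.congr e2).sub h3, ?_, ?_, ?_⟩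
  · intro x
    rw [hm]
    refine HasDerivAt.sub ?_ (h2' x)
    rw [hu0]
    exact h0' x
  · rw [hm]
    exact hu2.sub (hl h2.continuous w2)
  · simp only [mul_sub]
    exact w1.sub w3
  · simp only [mul_sub]
    exact w2.sub w4

/-! ### Linear differential equations with integrable coefficients -/

section LinearODE

variable {E : Type*} [NormedAddCommGroup E] [NormedSpace ℝ E] [CompleteSpace E]

theorem hasDerivAt_integral_Iic {f : ℝ → E} (hf : Continuous f) (hI : Integrable f) (x : ℝ) :
    HasDerivAt (fun x => ∫ t in Set.Iic x, f t) (f x) x := by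
  have h0 : (fun x => ∫ t in Set.Iic x, f t) =
      fun x => (∫ t in Set.Iic (0 : ℝ), f t) + ∫ t in (0 : ℝ)..x, f t := by
    ext x
    rw [← intervalIntegral.integral_Iic_sub_Iic hI.integrableOn hI.integrableOn]
    abel
  rw [h0]
  exact (intervalIntegral.integral_hasDerivAt_right (hf.intervalIntegrable _ _)
    hf.aestronglyMeasurable.stronglyMeasurableAtFilter hf.continuousAt).const_add _

/-- A linear differential equation with integrable coefficient has a solution with prescribed
limit at `-∞`. -/
theorem exists_linearODE_tendsto_atBot {A : ℝ → E →L[ℝ] E} (hA : Continuous A) {ρ : ℝ → ℝ}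
    (hρ : Continuous ρ) (hρI : Integrable ρ) (hb : ∀ x, ‖A x‖ ≤ ρ x) (v : E) :
    ∃ w : ℝ → E, (∀ x, HasDerivAt w (A x (w x)) x) ∧ Tendsto w atBot (𝓝 v) := by
  have hρ0 : ∀ x, 0 ≤ ρ x := fun x => (norm_nonneg _).trans (hb x)
  -- The exponential weight e^{−2R} makes the Volterra map a contraction with ratio 1/2 on the whole
  -- line, whatever the size of the integral of ρ. The unknown g in the fixed-point argument is
  -- e^{−2R} w.
  set R : ℝ → ℝ := fun x => ∫ t in Set.Iic x, ρ t
  have hRd : ∀ x, HasDerivAt R (ρ x) x := hasDerivAt_integral_Iic hρ hρI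
  have hRc : Continuous R := continuous_iff_continuousAt.2 fun x => (hRd x).continuousAt
  have hR0 : ∀ x, 0 ≤ R x := fun x => integral_nonneg fun t => hρ0 t
  set M := ∫ t, ρ t
  have hRM : ∀ x, R x ≤ M := fun x => setIntegral_le_integral hρI (ae_of_all _ hρ0)
  have hRbot : Tendsto R atBot (𝓝 0) := tendsto_integral_Iic_zero tendsto_id
  have hee : ∀ x, Real.exp (2 * R x) ≤ Real.exp (2 * M) := fun x =>
    Real.exp_le_exp.2 (by linarith [hRM x])
  have hwI : Integrable fun x => ρ x * Real.exp (2 * R x) := by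
    refine (hρI.mul_const (Real.exp (2 * M))).mono' (by fun_prop) (ae_of_all _ fun x => ?_)
    rw [Real.norm_of_nonneg (mul_nonneg (hρ0 x) (Real.exp_pos _).le)]
    gcongr
    · exact hρ0 x
    · exact hRM x
  have hwint : ∀ x, ∫ t in Set.Iic x, ρ t * Real.exp (2 * R t) = (Real.exp (2 * R x) - 1) / 2 := by
    intro x
    have := integral_Iic_of_hasDerivAt_of_tendsto' (a := x) (f := fun t => Real.exp (2 * R t) / 2)
      (f' := fun t => ρ t * Real.exp (2 * R t)) (m := 1 / 2) (fun t _ =>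
        (((hRd t).const_mul 2).exp.div_const 2).congr_deriv (by ring)) hwI.integrableOn (by
        have h1 : Tendsto (fun t => Real.exp (2 * R t) / 2) atBot (𝓝 (Real.exp (2 * 0) / 2)) :=
          (((Real.continuous_exp.tendsto _).comp (hRbot.const_mul 2)).div_const 2)
        simpa using h1)
    rw [this]; ring
  set K : (ℝ → E) → ℝ → E := fun g y => Real.exp (2 * R y) • A y (g y)
  have hKc : ∀ g : BoundedContinuousFunction ℝ E, Continuous (K g) := fun g =>
    (by fun_prop : Continuous fun y => Real.exp (2 * R y)).smul (hA.clm_apply g.continuous)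
  have hKb : ∀ (g : ℝ → E) (C : ℝ) (y : ℝ), ‖g y‖ ≤ C →
      ‖K g y‖ ≤ ρ y * Real.exp (2 * R y) * C := by
    intro g C y h
    simp only [K]
    rw [norm_smul, Real.norm_of_nonneg (Real.exp_pos _).le]
    calc _ ≤ Real.exp (2 * R y) * (ρ y * C) := by
          gcongr
          exact (A y).le_of_opNorm_le_of_le (hb y) h
      _ = _ := by ring
  have hKI : ∀ g : BoundedContinuousFunction ℝ E, Integrable (K g) := fun g =>
    (hwI.mul_const ‖g‖).mono' (hKc g).aestronglyMeasurable
      (ae_of_all _ fun y => hKb _ _ _ (g.norm_coe_le_norm y))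
  have hKint : ∀ (g : ℝ → E) (C x : ℝ), 0 ≤ C → (∀ y, ‖g y‖ ≤ C) →
      Real.exp (-(2 * R x)) * ‖∫ y in Set.Iic x, K g y‖ ≤ C / 2 := by
    intro g C x hC h
    have h1 : ‖∫ y in Set.Iic x, K g y‖ ≤ (Real.exp (2 * R x) - 1) / 2 * C := by
      rw [← hwint, ← integral_mul_const]
      exact norm_integral_le_of_norm_le (hwI.mul_const C).integrableOn
        (ae_of_all _ fun y => hKb _ _ _ (h y))
    calc _ ≤ Real.exp (-(2 * R x)) * ((Real.exp (2 * R x) - 1) / 2 * C) := by gcongr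
      _ = (1 - Real.exp (-(2 * R x))) * (C / 2) := by
          have : Real.exp (-(2 * R x)) * Real.exp (2 * R x) = 1 := by
            rw [← Real.exp_add]; simp
          linear_combination (C / 2) * this
      _ ≤ 1 * (C / 2) := by
          gcongr
          linarith [Real.exp_pos (-(2 * R x))]
      _ = _ := one_mul _
  let T : BoundedContinuousFunction ℝ E → BoundedContinuousFunction ℝ E := fun g =>
    BoundedContinuousFunction.ofNormedAddCommGroup
      (fun x => Real.exp (-(2 * R x)) • (v + ∫ y in Set.Iic x, K g y))
      ((by fun_prop : Continuous fun x => Real.exp (-(2 * R x))).smul (continuous_const.add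
        (continuous_iff_continuousAt.2 fun x =>
          (hasDerivAt_integral_Iic (hKc g) (hKI g) x).continuousAt)))
      (‖v‖ + ‖g‖ / 2) (fun x => by
        rw [smul_add]
        refine (norm_add_le _ _).trans (add_le_add ?_ ?_)
        · rw [norm_smul, Real.norm_of_nonneg (Real.exp_pos _).le]
          apply mul_le_of_le_one_left (norm_nonneg _)
          rw [Real.exp_le_one_iff]
          linarith [hR0 x]
        · rw [norm_smul, Real.norm_of_nonneg (Real.exp_pos _).le]
          exact hKint g ‖g‖ x (norm_nonneg _) g.norm_coe_le_norm)
  have hT : ContractingWith (1 / 2) T := by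
    refine ⟨by norm_num, LipschitzWith.of_dist_le_mul fun g g' => ?_⟩
    rw [BoundedContinuousFunction.dist_le (by positivity)]
    intro x
    have e : T g x - T g' x = Real.exp (-(2 * R x)) • ∫ y in Set.Iic x, K (⇑g - ⇑g') y := by
      have h1 : ∫ y in Set.Iic x, K (⇑g - ⇑g') y =
          (∫ y in Set.Iic x, K g y) - ∫ y in Set.Iic x, K g' y := by
        rw [← integral_sub (hKI g).integrableOn (hKI g').integrableOn]
        congr 1 with y
        simp [K, smul_sub]
      rw [h1]
      simp only [T, BoundedContinuousFunction.coe_ofNormedAddCommGroup]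
      module
    rw [dist_eq_norm, e, norm_smul, Real.norm_of_nonneg (Real.exp_pos _).le]
    refine (hKint _ (dist g g') x dist_nonneg fun y => ?_).trans (le_of_eq ?_)
    · rw [Pi.sub_apply, ← dist_eq_norm]
      exact BoundedContinuousFunction.dist_coe_le_dist y
    · push_cast; ring
  set g := hT.fixedPoint T
  have hg : T g = g := hT.fixedPoint_isFixedPt
  set w : ℝ → E := fun x => Real.exp (2 * R x) • g x
  have hw : ∀ x, w x = v + ∫ y in Set.Iic x, K g y := by
    intro x
    have : g x = Real.exp (-(2 * R x)) • (v + ∫ y in Set.Iic x, K g y) := by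
      conv_lhs => rw [← hg]
      rfl
    simp only [w]
    conv_lhs => rw [this]
    rw [smul_smul, ← Real.exp_add, add_neg_cancel, Real.exp_zero, one_smul]
  refine ⟨w, fun x => ?_, ?_⟩
  · have h1 := (hasDerivAt_integral_Iic (hKc g) (hKI g) x).const_add v
    rw [← funext hw] at h1
    refine h1.congr_deriv ?_
    simp only [K, w, map_smul]
  · rw [funext hw]
    simpa using (tendsto_integral_Iic_zero (f := K g) (μ := volume) tendsto_id).const_add v

end LinearODE

/-! ### The scattering problem for a pair of scalar functions -/

/-- The phase `p`, its derivative `q` and the coefficients of the scalar scattering problem. -/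
structure Coeffs where
  p : ℝ → ℝ
  q : ℝ → ℝ
  A : ℝ → ℝ
  B : ℝ → ℝ
  G : ℝ → ℝ
  hp : ∀ x, HasDerivAt p (q x) x
  hq : ∀ x, 1 ≤ q x
  hA : Continuous A
  hB : Continuous B
  hG : Continuous G
  iA : Integrable A
  iB : Integrable B
  iG : Integrable G

/-- The frequency `θ = (z - 1/z) / 4`. -/
noncomputable def freq (z : ℝ) : ℝ := (z - 1 / z) / 4

namespace Coeffs

variable (D : Coeffs)

theorem continuous_p : Continuous D.p := phase_continuous D.hp

/-- The oscillating factor `e^{2iθp}`. -/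
noncomputable def e (θ x : ℝ) : ℂ := Complex.exp (2 * Complex.I * θ * D.p x)

theorem norm_e (θ x : ℝ) : ‖D.e θ x‖ = 1 := norm_exp_phase _ _

theorem conj_e (θ x : ℝ) : star (D.e θ x) = D.e (-θ) x := by
  simp only [e, Complex.star_def]
  rw [← Complex.exp_conj]
  congr 1
  simp [Complex.conj_ofNat]

theorem e_mul_e_neg (θ x : ℝ) : D.e θ x * D.e (-θ) x = 1 := by
  rw [e, e, ← Complex.exp_add]
  simp

theorem continuous_e (θ : ℝ) : Continuous (D.e θ) := by
  have := D.continuous_p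
  unfold e
  fun_prop

theorem hasDerivAt_e (θ x : ℝ) :
    HasDerivAt (D.e θ) (2 * Complex.I * θ * D.q x * D.e θ x) x :=
  (((D.hp x).ofReal_comp.const_mul (2 * Complex.I * θ)).cexp).congr_deriv (by rw [e]; ring)

/-- The total size of the coefficients. -/
noncomputable def ρ (x : ℝ) : ℝ := |D.A x| + |D.B x| + |D.G x|

theorem continuous_ρ : Continuous D.ρ := by
  have := D.hA; have := D.hB; have := D.hG
  unfold ρ; fun_prop

theorem integrable_ρ : Integrable D.ρ := (D.iA.abs.add D.iB.abs).add D.iG.abs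

theorem ρ_nonneg (x : ℝ) : 0 ≤ D.ρ x := by unfold ρ; positivity

/-- The coefficients of the scalar system. -/
noncomputable def c11 (z x : ℝ) : ℂ := -Complex.I * D.A x / z

noncomputable def c12 (z x : ℝ) : ℂ := D.e (freq z) x * (Complex.I * D.G x + D.B x / z)

noncomputable def c21 (z x : ℝ) : ℂ := D.e (-freq z) x * (Complex.I * D.G x - D.B x / z)

theorem continuous_c11 (z : ℝ) : Continuous (D.c11 z) := by
  have := D.hA
  unfold c11; fun_prop

theorem continuous_c12 (z : ℝ) : Continuous (D.c12 z) := by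
  have := D.hB; have := D.hG; have := D.continuous_e (freq z)
  unfold c12; fun_prop

theorem continuous_c21 (z : ℝ) : Continuous (D.c21 z) := by
  have := D.hB; have := D.hG; have := D.continuous_e (-freq z)
  unfold c21; fun_prop

theorem conj_c11 (z x : ℝ) : star (D.c11 z x) = -D.c11 z x := by
  simp [c11]; ring

theorem conj_c12 (z x : ℝ) : star (D.c12 z x) = -D.c21 z x := by
  rw [c12, star_mul', conj_e, c21]
  simp
  ring

theorem conj_c21 (z x : ℝ) : star (D.c21 z x) = -D.c12 z x := by
  rw [← neg_eq_iff_eq_neg.2 (D.conj_c12 z x), star_neg, star_star]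

theorem norm_c11 (z x : ℝ) : ‖D.c11 z x‖ = |D.A x| * |z|⁻¹ := by
  simp [c11, div_eq_mul_inv]

theorem norm_IG_add_le {z x : ℝ} : ‖Complex.I * D.G x + D.B x / z‖ ≤ |D.G x| + |D.B x| * |z|⁻¹ := by
  refine (norm_add_le _ _).trans (le_of_eq ?_)
  simp [div_eq_mul_inv]

theorem norm_IG_sub_le {z x : ℝ} : ‖Complex.I * D.G x - D.B x / z‖ ≤ |D.G x| + |D.B x| * |z|⁻¹ := by
  refine (norm_sub_le _ _).trans (le_of_eq ?_)
  simp [div_eq_mul_inv]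

theorem norm_c12_le (z x : ℝ) : ‖D.c12 z x‖ ≤ |D.G x| + |D.B x| * |z|⁻¹ := by
  rw [c12, norm_mul, norm_e, one_mul]; exact D.norm_IG_add_le

theorem norm_c21_le (z x : ℝ) : ‖D.c21 z x‖ ≤ |D.G x| + |D.B x| * |z|⁻¹ := by
  rw [c21, norm_mul, norm_e, one_mul]; exact D.norm_IG_sub_le

/-- A common bound of the coefficients. -/
theorem norm_coeff_le {z κ : ℝ} (hκ : 1 ≤ κ) (hz : |z|⁻¹ ≤ κ) (x : ℝ) :
    ‖D.c11 z x‖ ≤ κ * D.ρ x ∧ ‖D.c12 z x‖ ≤ κ * D.ρ x ∧ ‖D.c21 z x‖ ≤ κ * D.ρ x := by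
  have h1 := D.norm_c11 z x
  have h2 := D.norm_c12_le z x
  have h3 := D.norm_c21_le z x
  have a1 := abs_nonneg (D.A x)
  have a2 := abs_nonneg (D.B x)
  have a3 := abs_nonneg (D.G x)
  have e1 : |D.A x| * |z|⁻¹ ≤ κ * |D.A x| := by rw [mul_comm]; gcongr
  have e2 : |D.B x| * |z|⁻¹ ≤ κ * |D.B x| := by rw [mul_comm]; gcongr
  have e3 : |D.G x| ≤ κ * |D.G x| := le_mul_of_one_le_left a3 hκ
  have k0 : 0 ≤ κ := by linarith
  have p1 := mul_nonneg k0 a1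
  have p2 := mul_nonneg k0 a2
  have p3 := mul_nonneg k0 a3
  have : κ * D.ρ x = κ * |D.A x| + κ * |D.B x| + κ * |D.G x| := by unfold ρ; ring
  rw [this]
  refine ⟨?_, ?_, ?_⟩ <;> linarith

theorem integrable_c11 (z : ℝ) : Integrable (D.c11 z) :=
  (D.integrable_ρ.const_mul (max 1 |z|⁻¹)).mono' (D.continuous_c11 z).aestronglyMeasurable
    (ae_of_all _ fun x => (D.norm_coeff_le (le_max_left _ _) (le_max_right _ _) x).1)

theorem integrable_c12 (z : ℝ) : Integrable (D.c12 z) :=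
  (D.integrable_ρ.const_mul (max 1 |z|⁻¹)).mono' (D.continuous_c12 z).aestronglyMeasurable
    (ae_of_all _ fun x => (D.norm_coeff_le (le_max_left _ _) (le_max_right _ _) x).2.1)

theorem integrable_c21 (z : ℝ) : Integrable (D.c21 z) :=
  (D.integrable_ρ.const_mul (max 1 |z|⁻¹)).mono' (D.continuous_c21 z).aestronglyMeasurable
    (ae_of_all _ fun x => (D.norm_coeff_le (le_max_left _ _) (le_max_right _ _) x).2.2)

/-- Solutions of the scalar system. -/
def IsSol (z : ℝ) (w1 w2 : ℝ → ℂ) : Prop :=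
  ∀ x, HasDerivAt w1 (D.c11 z x * w1 x + D.c12 z x * w2 x) x ∧
    HasDerivAt w2 (D.c21 z x * w1 x - D.c11 z x * w2 x) x

namespace IsSol

variable {D} {z z' : ℝ} {w1 w2 v1 v2 : ℝ → ℂ}

theorem continuous_left (h : D.IsSol z w1 w2) : Continuous w1 :=
  continuous_iff_continuousAt.2 fun x => (h x).1.continuousAt

theorem continuous_right (h : D.IsSol z w1 w2) : Continuous w2 :=
  continuous_iff_continuousAt.2 fun x => (h x).2.continuousAt

theorem sub (h : D.IsSol z w1 w2) (h' : D.IsSol z v1 v2) :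
    D.IsSol z (fun x => w1 x - v1 x) (fun x => w2 x - v2 x) := fun x =>
  ⟨((h x).1.sub (h' x).1).congr_deriv (by ring), ((h x).2.sub (h' x).2).congr_deriv (by ring)⟩

theorem comb (h : D.IsSol z w1 w2) (h' : D.IsSol z v1 v2) (s t : ℂ) :
    D.IsSol z (fun x => w1 x * s + v1 x * t) (fun x => w2 x * s + v2 x * t) := fun x =>
  ⟨(((h x).1.mul_const s).add ((h' x).1.mul_const t)).congr_deriv (by ring),
    (((h x).2.mul_const s).add ((h' x).2.mul_const t)).congr_deriv (by ring)⟩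

/-- This is the SU(2) symmetry of a trace-free skew-Hermitian system: one column of a fundamental
matrix determines the other. -/
theorem conj (h : D.IsSol z w1 w2) :
    D.IsSol z (fun x => -star (w2 x)) (fun x => star (w1 x)) := fun x =>
  ⟨((h x).2.star.neg).congr_deriv (by
    rw [star_sub, star_mul', star_mul', conj_c21, conj_c11]; ring),
    ((h x).1.star).congr_deriv (by
    rw [star_add, star_mul', star_mul', conj_c12, conj_c11]; ring)⟩

/-- The Wronskian of solutions at two spectral parameters. -/
theorem hasDerivAt_wronskian (h : D.IsSol z w1 w2) (h' : D.IsSol z' v1 v2) (x : ℝ) :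
    HasDerivAt (fun x => w1 x * v2 x - w2 x * v1 x)
      ((D.c21 z' x - D.c21 z x) * (w1 x * v1 x) - (D.c12 z' x - D.c12 z x) * (w2 x * v2 x) -
        (D.c11 z' x - D.c11 z x) * (w1 x * v2 x + w2 x * v1 x)) x :=
  (((h x).1.mul (h' x).2).sub ((h x).2.mul (h' x).1)).congr_deriv (by ring)

/-- Skew-Hermitian coefficients cancel in the Hermitian product, leaving only differences of
coefficients at z and z'. Together with the Wronskian this gives the coordinates of one solution in
the orthonormal frame spanned by the other and its conjugate. -/
theorem hasDerivAt_pairing (h : D.IsSol z w1 w2) (h' : D.IsSol z' v1 v2) (x : ℝ) :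
    HasDerivAt (fun x => star (w1 x) * v1 x + star (w2 x) * v2 x)
      ((D.c11 z' x - D.c11 z x) * (star (w1 x) * v1 x - star (w2 x) * v2 x) +
        (D.c12 z' x - D.c12 z x) * (star (w1 x) * v2 x) +
        (D.c21 z' x - D.c21 z x) * (star (w2 x) * v1 x)) x :=
  (((h x).1.star.mul (h' x).1).add ((h x).2.star.mul (h' x).2)).congr_deriv (by
    rw [star_sub, star_add, star_mul', star_mul', star_mul', star_mul', conj_c21, conj_c11,
      conj_c12]
    ring)

theorem normSq_const (h : D.IsSol z w1 w2) (x y : ℝ) :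
    ‖w1 x‖ ^ 2 + ‖w2 x‖ ^ 2 = ‖w1 y‖ ^ 2 + ‖w2 y‖ ^ 2 := by
  have hd : ∀ x, HasDerivAt (fun x => star (w1 x) * w1 x + star (w2 x) * w2 x) 0 x := fun x =>
    (hasDerivAt_pairing h h x).congr_deriv (by ring)
  have := is_const_of_deriv_eq_zero (fun x => (hd x).differentiableAt) (fun x => (hd x).deriv) x y
  have e : ∀ c : ℂ, star c * c = ((‖c‖ ^ 2 : ℝ) : ℂ) := fun c => by
    rw [Complex.star_def, Complex.conj_mul']; push_cast; rfl
  simp only [e] at this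
  exact_mod_cast this

theorem normSq_eq (h : D.IsSol z w1 w2) {l : Filter ℝ} [l.NeBot] {a b : ℂ}
    (h1 : Tendsto w1 l (𝓝 a)) (h2 : Tendsto w2 l (𝓝 b)) (x : ℝ) :
    ‖w1 x‖ ^ 2 + ‖w2 x‖ ^ 2 = ‖a‖ ^ 2 + ‖b‖ ^ 2 := by
  have : Tendsto (fun y => ‖w1 y‖ ^ 2 + ‖w2 y‖ ^ 2) l (𝓝 (‖a‖ ^ 2 + ‖b‖ ^ 2)) :=
    (h1.norm.pow 2).add (h2.norm.pow 2)
  refine tendsto_nhds_unique ?_ this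
  simp_rw [fun y => h.normSq_const y x]
  exact tendsto_const_nhds

/-- The difference is a solution with conserved norm, and that norm tends to 0 along `l`. -/
theorem eq_of_tendsto (h : D.IsSol z w1 w2) (h' : D.IsSol z v1 v2) {l : Filter ℝ} [l.NeBot]
    {a b : ℂ} (h1 : Tendsto w1 l (𝓝 a)) (h2 : Tendsto w2 l (𝓝 b))
    (h1' : Tendsto v1 l (𝓝 a)) (h2' : Tendsto v2 l (𝓝 b)) : w1 = v1 ∧ w2 = v2 := by
  have key := fun x => (h.sub h').normSq_eq (h1.sub h1') (h2.sub h2') x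
  simp only [sub_self, norm_zero, ne_eq, OfNat.ofNat_ne_zero, not_false_eq_true, zero_pow,
    add_zero] at key
  constructor <;> ext x <;> have := key x <;> rw [← sub_eq_zero, ← norm_eq_zero, ← sq_eq_zero_iff]
  · nlinarith [sq_nonneg ‖w1 x - v1 x‖, sq_nonneg ‖w2 x - v2 x‖]
  · nlinarith [sq_nonneg ‖w1 x - v1 x‖, sq_nonneg ‖w2 x - v2 x‖]

end IsSol

/-- The solution normalized by `(1, 0)` at `-∞`, with limit `(a, b)` at `+∞`. -/
structure IsJostPair (z : ℝ) (w1 w2 : ℝ → ℂ) (a b : ℂ) : Prop where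
  sol : D.IsSol z w1 w2
  bot1 : Tendsto w1 atBot (𝓝 1)
  bot2 : Tendsto w2 atBot (𝓝 0)
  top1 : Tendsto w1 atTop (𝓝 a)
  top2 : Tendsto w2 atTop (𝓝 b)

theorem exists_isSol (z : ℝ) : ∃ w1 w2 : ℝ → ℂ, D.IsSol z w1 w2 ∧
    Tendsto w1 atBot (𝓝 1) ∧ Tendsto w2 atBot (𝓝 0) := by
  set κ := max 1 |z|⁻¹
  have hκ0 : 0 ≤ κ := zero_le_one.trans (le_max_left _ _)
  let fst' : ℂ × ℂ →L[ℝ] ℂ := ContinuousLinearMap.fst ℝ ℂ ℂ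
  let snd' : ℂ × ℂ →L[ℝ] ℂ := ContinuousLinearMap.snd ℝ ℂ ℂ
  let A : ℝ → (ℂ × ℂ →L[ℝ] ℂ × ℂ) := fun x =>
    ((D.c11 z x • fst' + D.c12 z x • snd').prod (D.c21 z x • fst' - D.c11 z x • snd'))
  have hAc : Continuous A := by
    have h1 := D.continuous_c11 z
    have h2 := D.continuous_c12 z
    have h3 := D.continuous_c21 z
    have f1 : Continuous fun x => D.c11 z x • fst' + D.c12 z x • snd' := by fun_prop
    have f2 : Continuous fun x => D.c21 z x • fst' - D.c11 z x • snd' := by fun_prop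
    exact (ContinuousLinearMap.prodₗᵢ ℝ : _ ≃ₗᵢ[ℝ] (ℂ × ℂ →L[ℝ] ℂ × ℂ)).continuous.comp
      (f1.prodMk f2)
  obtain ⟨w, hw, hw0⟩ := exists_linearODE_tendsto_atBot hAc
    (ρ := fun x => 2 * κ * D.ρ x) (by have := D.continuous_ρ; fun_prop)
    (D.integrable_ρ.const_mul _) (fun x => by
      apply ContinuousLinearMap.opNorm_le_bound _
        (mul_nonneg (by positivity) (D.ρ_nonneg x))
      intro v
      obtain ⟨h1, h2, h3⟩ := D.norm_coeff_le (le_max_left 1 |z|⁻¹) (le_max_right _ _) x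
      have hv1 : ‖v.1‖ ≤ ‖v‖ := norm_fst_le v
      have hv2 : ‖v.2‖ ≤ ‖v‖ := norm_snd_le v
      have hk : 0 ≤ κ * D.ρ x := mul_nonneg hκ0 (D.ρ_nonneg x)
      rw [norm_prod_le_iff]
      constructor
      · calc ‖D.c11 z x * v.1 + D.c12 z x * v.2‖ ≤ ‖D.c11 z x‖ * ‖v.1‖ + ‖D.c12 z x‖ * ‖v.2‖ := by
              refine (norm_add_le _ _).trans ?_
              rw [norm_mul, norm_mul]
          _ ≤ κ * D.ρ x * ‖v‖ + κ * D.ρ x * ‖v‖ := by gcongr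
          _ = _ := by ring
      · calc ‖D.c21 z x * v.1 - D.c11 z x * v.2‖ ≤ ‖D.c21 z x‖ * ‖v.1‖ + ‖D.c11 z x‖ * ‖v.2‖ := by
              refine (norm_sub_le _ _).trans ?_
              rw [norm_mul, norm_mul]
          _ ≤ κ * D.ρ x * ‖v‖ + κ * D.ρ x * ‖v‖ := by gcongr
          _ = _ := by ring) ((1, 0) : ℂ × ℂ)
  refine ⟨fun x => (w x).1, fun x => (w x).2, fun x => ⟨?_, ?_⟩, ?_, ?_⟩
  · exact fst'.hasFDerivAt.comp_hasDerivAt x (hw x)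
  · exact snd'.hasFDerivAt.comp_hasDerivAt x (hw x)
  · exact (continuous_fst.tendsto _).comp hw0
  · exact (continuous_snd.tendsto _).comp hw0

/-- Conservation of the norm bounds the solution by 1, so its derivative is integrable and the
limits at +∞ exist. -/
theorem exists_isJostPair (z : ℝ) : ∃ w1 w2 a b, D.IsJostPair z w1 w2 a b := by
  obtain ⟨w1, w2, h, h1, h2⟩ := D.exists_isSol z
  have hn := h.normSq_eq h1 h2
  simp only [norm_one, norm_zero, one_pow, ne_eq, OfNat.ofNat_ne_zero, not_false_eq_true,
    zero_pow, add_zero] at hn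
  have b1 : ∀ x, ‖w1 x‖ ≤ 1 := fun x => by
    nlinarith [hn x, sq_nonneg ‖w2 x‖, norm_nonneg (w1 x)]
  have b2 : ∀ x, ‖w2 x‖ ≤ 1 := fun x => by
    nlinarith [hn x, sq_nonneg ‖w1 x‖, norm_nonneg (w2 x)]
  have c1 := h.continuous_left
  have c2 := h.continuous_right
  have k1 := D.continuous_c11 z
  have k2 := D.continuous_c12 z
  have k3 := D.continuous_c21 z
  obtain ⟨a, ha⟩ := (IsPrimitive.of_hasDerivAt (fun x => (h x).1) (by fun_prop)
    ).exists_tendsto_atTop (((D.integrable_c11 z).mul_bdd (c := 1) c1.aestronglyMeasurable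
      (ae_of_all _ b1)).add ((D.integrable_c12 z).mul_bdd (c := 1) c2.aestronglyMeasurable
      (ae_of_all _ b2)))
  obtain ⟨b, hb⟩ := (IsPrimitive.of_hasDerivAt (fun x => (h x).2) (by fun_prop)
    ).exists_tendsto_atTop (((D.integrable_c21 z).mul_bdd (c := 1) c1.aestronglyMeasurable
      (ae_of_all _ b1)).sub ((D.integrable_c11 z).mul_bdd (c := 1) c2.aestronglyMeasurable
      (ae_of_all _ b2)))
  exact ⟨w1, w2, a, b, h, h1, h2, ha, hb⟩

namespace IsJostPair

variable {D} {z z' : ℝ} {w1 w2 v1 v2 : ℝ → ℂ} {a b a' b' : ℂ}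

theorem normSq (h : D.IsJostPair z w1 w2 a b) (x : ℝ) : ‖w1 x‖ ^ 2 + ‖w2 x‖ ^ 2 = 1 := by
  simpa using h.sol.normSq_eq h.bot1 h.bot2 x

theorem normSq_top (h : D.IsJostPair z w1 w2 a b) : ‖a‖ ^ 2 + ‖b‖ ^ 2 = 1 := by
  rw [← h.sol.normSq_eq h.top1 h.top2 0, h.normSq]

theorem norm_left_le (h : D.IsJostPair z w1 w2 a b) (x : ℝ) : ‖w1 x‖ ≤ 1 := by
  nlinarith [h.normSq x, sq_nonneg ‖w2 x‖, norm_nonneg (w1 x)]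

theorem norm_right_le (h : D.IsJostPair z w1 w2 a b) (x : ℝ) : ‖w2 x‖ ≤ 1 := by
  nlinarith [h.normSq x, sq_nonneg ‖w1 x‖, norm_nonneg (w2 x)]

theorem norm_a_le (h : D.IsJostPair z w1 w2 a b) : ‖a‖ ≤ 1 := by
  nlinarith [h.normSq_top, sq_nonneg ‖b‖, norm_nonneg a]

theorem norm_b_le (h : D.IsJostPair z w1 w2 a b) : ‖b‖ ≤ 1 := by
  nlinarith [h.normSq_top, sq_nonneg ‖a‖, norm_nonneg b]

end IsJostPair

end Coeffs

namespace Coeffs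

variable (D : Coeffs)

/-! ### Continuous dependence on the spectral parameter -/

/-- The `L¹` distance of the coefficients at two spectral parameters. -/
noncomputable def coeffDist (z z' : ℝ) : ℝ :=
  ∫ x, (2 * ‖D.c11 z' x - D.c11 z x‖ + ‖D.c12 z' x - D.c12 z x‖ + ‖D.c21 z' x - D.c21 z x‖)

theorem integrable_coeffDist (z z' : ℝ) : Integrable fun x =>
    (2 * ‖D.c11 z' x - D.c11 z x‖ + ‖D.c12 z' x - D.c12 z x‖ + ‖D.c21 z' x - D.c21 z x‖) :=
  ((((D.integrable_c11 z').sub (D.integrable_c11 z)).norm.const_mul 2).add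
    ((D.integrable_c12 z').sub (D.integrable_c12 z)).norm).add
    ((D.integrable_c21 z').sub (D.integrable_c21 z)).norm

theorem coeffDist_nonneg (z z' : ℝ) : 0 ≤ D.coeffDist z z' :=
  integral_nonneg fun x => by positivity

theorem continuousAt_freq {z : ℝ} (hz : z ≠ 0) : ContinuousAt freq z := by
  unfold freq; fun_prop (disch := exact hz)

theorem continuousAt_e (x : ℝ) (θ : ℝ) : ContinuousAt (fun θ => D.e θ x) θ := by
  unfold e; fun_prop

theorem tendsto_coeffDist {z : ℝ} (hz : z ≠ 0) :
    Tendsto (D.coeffDist z) (𝓝 z) (𝓝 0) := by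
  have hzc : (z : ℂ) ≠ 0 := by exact_mod_cast hz
  have hz0 : 0 < |z| := abs_pos.2 hz
  -- This bounds 1/|z'| for every z' with |z'| > |z|/2, so κρ dominates all coefficients at spectral
  -- parameters near z.
  set κ := max 1 (2 / |z|)
  have hκ : 1 ≤ κ := le_max_left _ _
  have hzκ : |z|⁻¹ ≤ κ := by
    refine le_trans ?_ (le_max_right _ _)
    rw [div_eq_mul_inv]
    have : 0 < |z|⁻¹ := by positivity
    linarith
  have key : Tendsto (D.coeffDist z) (𝓝 z) (𝓝 (∫ _ : ℝ, (0 : ℝ))) := by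
    apply tendsto_integral_filter_of_dominated_convergence (fun x => 8 * (κ * D.ρ x))
    · exact Eventually.of_forall fun z' => (D.integrable_coeffDist z z').1
    · have : ∀ᶠ z' in 𝓝 z, |z| / 2 < |z'| :=
        continuous_abs.continuousAt.eventually (lt_mem_nhds (by linarith))
      filter_upwards [this] with z' hz'
      refine ae_of_all _ fun x => ?_
      have hz'κ : |z'|⁻¹ ≤ κ := by
        refine le_trans ?_ (le_max_right _ _)
        rw [show 2 / |z| = (|z| / 2)⁻¹ by rw [inv_div]]
        exact inv_anti₀ (by positivity) hz'.le
      obtain ⟨h1, h2, h3⟩ := D.norm_coeff_le hκ hzκ x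
      obtain ⟨h1', h2', h3'⟩ := D.norm_coeff_le hκ hz'κ x
      rw [Real.norm_of_nonneg (by positivity)]
      have t1 := norm_sub_le (D.c11 z' x) (D.c11 z x)
      have t2 := norm_sub_le (D.c12 z' x) (D.c12 z x)
      have t3 := norm_sub_le (D.c21 z' x) (D.c21 z x)
      linarith
    · exact (D.integrable_ρ.const_mul κ).const_mul 8
    · refine ae_of_all _ fun x => ?_
      have h1 : ContinuousAt (fun z => D.c11 z x) z := by
        unfold c11
        exact continuousAt_const.div Complex.continuous_ofReal.continuousAt hzc
      have hB : ContinuousAt (fun z : ℝ => (D.B x : ℂ) / z) z :=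
        continuousAt_const.div Complex.continuous_ofReal.continuousAt hzc
      have h2 : ContinuousAt (fun z => D.c12 z x) z := by
        unfold c12
        exact (ContinuousAt.comp (D.continuousAt_e x _) (continuousAt_freq hz)).mul
          (continuousAt_const.add hB)
      have h3 : ContinuousAt (fun z => D.c21 z x) z := by
        unfold c21
        exact (ContinuousAt.comp (D.continuousAt_e x _) (continuousAt_freq hz).neg).mul
          (continuousAt_const.sub hB)
      have h4 : ContinuousAt (fun z' => 2 * ‖D.c11 z' x - D.c11 z x‖ + ‖D.c12 z' x - D.c12 z x‖ +
          ‖D.c21 z' x - D.c21 z x‖) z := by fun_prop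
      simpa using h4.tendsto
  simpa using key

namespace IsJostPair

variable {D} {z z' : ℝ} {w1 w2 v1 v2 : ℝ → ℂ} {a b a' b' : ℂ}

theorem integrable_wronskian (h : D.IsJostPair z w1 w2 a b) (h' : D.IsJostPair z' v1 v2 a' b') :
    Integrable fun x => (D.c21 z' x - D.c21 z x) * (w1 x * v1 x) -
      (D.c12 z' x - D.c12 z x) * (w2 x * v2 x) -
      (D.c11 z' x - D.c11 z x) * (w1 x * v2 x + w2 x * v1 x) := by
  have c1 := h.sol.continuous_left
  have c2 := h.sol.continuous_right
  have c1' := h'.sol.continuous_left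
  have c2' := h'.sol.continuous_right
  have m : ∀ {c d : ℂ}, ‖c‖ ≤ 1 → ‖d‖ ≤ 1 → ‖c * d‖ ≤ 1 := fun h1 h2 => by
    rw [norm_mul]; exact mul_le_one₀ h1 (norm_nonneg _) h2
  refine ((((D.integrable_c21 z').sub (D.integrable_c21 z)).mul_bdd (c := 1) ?_ ?_).sub
    (((D.integrable_c12 z').sub (D.integrable_c12 z)).mul_bdd (c := 1) ?_ ?_)).sub
    (((D.integrable_c11 z').sub (D.integrable_c11 z)).mul_bdd (c := 2) ?_ ?_)
  · exact (c1.mul c1').aestronglyMeasurable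
  · exact ae_of_all _ fun x => m (h.norm_left_le x) (h'.norm_left_le x)
  · exact (c2.mul c2').aestronglyMeasurable
  · exact ae_of_all _ fun x => m (h.norm_right_le x) (h'.norm_right_le x)
  · exact ((c1.mul c2').add (c2.mul c1')).aestronglyMeasurable
  · refine ae_of_all _ fun x => (norm_add_le _ _).trans ?_
    have := m (h.norm_left_le x) (h'.norm_right_le x)
    have := m (h.norm_right_le x) (h'.norm_left_le x)
    linarith

/-- The difference of the scattering data at two spectral parameters. -/
theorem wronskian_top (h : D.IsJostPair z w1 w2 a b) (h' : D.IsJostPair z' v1 v2 a' b') :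
    a * b' - b * a' = ∫ x, ((D.c21 z' x - D.c21 z x) * (w1 x * v1 x) -
      (D.c12 z' x - D.c12 z x) * (w2 x * v2 x) -
      (D.c11 z' x - D.c11 z x) * (w1 x * v2 x + w2 x * v1 x)) := by
  have := integral_of_hasDerivAt_of_tendsto (h.sol.hasDerivAt_wronskian h'.sol)
    (h.integrable_wronskian h') (m := 0) (by
      simpa using (h.bot1.mul h'.bot2).sub (h.bot2.mul h'.bot1))
    ((h.top1.mul h'.top2).sub (h.top2.mul h'.top1))
  rw [this, sub_zero]

/-- In the orthonormal frame w, (−w̄₂, w̄₁) the solution v has coordinates the pairing and the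
Wronskian. At −∞ they equal 1 and 0, and each moves by at most the L¹ distance of the coefficients.
No Gronwall factor appears, and the bound is uniform in x. -/
theorem norm_sub_le (h : D.IsJostPair z w1 w2 a b) (h' : D.IsJostPair z' v1 v2 a' b') (x : ℝ) :
    ‖v1 x - w1 x‖ ≤ 2 * D.coeffDist z z' ∧ ‖v2 x - w2 x‖ ≤ 2 * D.coeffDist z z' := by
  have n1 := h.norm_left_le
  have n2 := h.norm_right_le
  have n1' := h'.norm_left_le
  have n2' := h'.norm_right_le
  have c1 := h.sol.continuous_left
  have c2 := h.sol.continuous_right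
  have c1' := h'.sol.continuous_left
  have c2' := h'.sol.continuous_right
  have k1 := D.continuous_c11 z
  have k2 := D.continuous_c12 z
  have k3 := D.continuous_c21 z
  have k1' := D.continuous_c11 z'
  have k2' := D.continuous_c12 z'
  have k3' := D.continuous_c21 z'
  have m : ∀ {c d : ℂ}, ‖c‖ ≤ 1 → ‖d‖ ≤ 1 → ‖c * d‖ ≤ 1 := fun h1 h2 => by
    rw [norm_mul]; exact mul_le_one₀ h1 (norm_nonneg _) h2
  have ms : ∀ {c d : ℂ}, ‖c‖ ≤ 1 → ‖d‖ ≤ 1 → ‖star c * d‖ ≤ 1 := fun h1 h2 =>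
    m (by rwa [norm_star]) h2
  have lip : ∀ {f g : ℝ → ℂ} {l : ℂ}, (∀ x, HasDerivAt f (g x) x) → Continuous g →
      (∀ x, ‖g x‖ ≤ 2 * ‖D.c11 z' x - D.c11 z x‖ + ‖D.c12 z' x - D.c12 z x‖ +
        ‖D.c21 z' x - D.c21 z x‖) → Tendsto f atBot (𝓝 l) → ‖f x - l‖ ≤ D.coeffDist z z' := by
    intro f g l hf hg hb hl
    have hgI : Integrable g := (D.integrable_coeffDist z z').mono' hg.aestronglyMeasurable
      (ae_of_all _ hb)
    refine ((IsPrimitive.of_hasDerivAt hf hg).norm_sub_le hgI hl x).trans ?_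
    exact integral_mono hgI.norm (D.integrable_coeffDist z z') hb
  have t2 : ∀ {c d : ℂ}, ‖c‖ ≤ 1 → ‖d‖ ≤ 1 → ‖c + d‖ ≤ 2 := fun h1 h2 =>
    (norm_add_le _ _).trans (by linarith)
  have t2' : ∀ {c d : ℂ}, ‖c‖ ≤ 1 → ‖d‖ ≤ 1 → ‖c - d‖ ≤ 2 := fun h1 h2 =>
    (_root_.norm_sub_le _ _).trans (by linarith)
  have e1 := lip (h.sol.hasDerivAt_wronskian h'.sol) (by fun_prop) (fun x => by
      refine (_root_.norm_sub_le _ _).trans ((add_le_add (_root_.norm_sub_le _ _) le_rfl).trans ?_)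
      rw [norm_mul, norm_mul (_ - _) (_ * _), norm_mul (_ - _) (_ + _)]
      have i1 := mul_le_mul_of_nonneg_left (m (n1 x) (n1' x)) (norm_nonneg (D.c21 z' x - D.c21 z x))
      have i2 := mul_le_mul_of_nonneg_left (m (n2 x) (n2' x)) (norm_nonneg (D.c12 z' x - D.c12 z x))
      have i3 := mul_le_mul_of_nonneg_left (t2 (m (n1 x) (n2' x)) (m (n2 x) (n1' x)))
        (norm_nonneg (D.c11 z' x - D.c11 z x))
      linarith)
    (l := 0) (by simpa using (h.bot1.mul h'.bot2).sub (h.bot2.mul h'.bot1))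
  have e2 := lip (h.sol.hasDerivAt_pairing h'.sol) (by fun_prop) (fun x => by
      refine (norm_add_le _ _).trans ((add_le_add (norm_add_le _ _) le_rfl).trans ?_)
      rw [norm_mul, norm_mul (_ - _) (_ * _), norm_mul (_ - _) (_ * _)]
      have i1 := mul_le_mul_of_nonneg_left (ms (n2 x) (n1' x)) (norm_nonneg (D.c21 z' x - D.c21 z x))
      have i2 := mul_le_mul_of_nonneg_left (ms (n1 x) (n2' x)) (norm_nonneg (D.c12 z' x - D.c12 z x))
      have i3 := mul_le_mul_of_nonneg_left (t2' (ms (n1 x) (n1' x)) (ms (n2 x) (n2' x)))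
        (norm_nonneg (D.c11 z' x - D.c11 z x))
      linarith)
    (l := 1) (by simpa using (h.bot1.star.mul h'.bot1).add (h.bot2.star.mul h'.bot2))
  rw [sub_zero] at e1
  set Wr := w1 x * v2 x - w2 x * v1 x
  set Pa := star (w1 x) * v1 x + star (w2 x) * v2 x
  have hu : w1 x * star (w1 x) + w2 x * star (w2 x) = 1 := by
    rw [Complex.star_def, Complex.mul_conj', Complex.mul_conj']
    exact_mod_cast h.normSq x
  have r1 : v1 x - w1 x = (Pa - 1) * w1 x - Wr * star (w2 x) := by
    simp only [Pa, Wr]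
    linear_combination -(v1 x) * hu
  have r2 : v2 x - w2 x = (Pa - 1) * w2 x + Wr * star (w1 x) := by
    simp only [Pa, Wr]
    linear_combination -(v2 x) * hu
  have d0 := D.coeffDist_nonneg z z'
  constructor
  · rw [r1]
    refine (_root_.norm_sub_le _ _).trans ?_
    rw [norm_mul, norm_mul, norm_star]
    nlinarith [mul_le_mul e2 (n1 x) (norm_nonneg _) d0, mul_le_mul e1 (n2 x) (norm_nonneg _) d0]
  · rw [r2]
    refine (norm_add_le _ _).trans ?_
    rw [norm_mul, norm_mul, norm_star]
    nlinarith [mul_le_mul e2 (n2 x) (norm_nonneg _) d0, mul_le_mul e1 (n1 x) (norm_nonneg _) d0]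

theorem norm_sub_le_top (h : D.IsJostPair z w1 w2 a b) (h' : D.IsJostPair z' v1 v2 a' b') :
    ‖a' - a‖ ≤ 2 * D.coeffDist z z' ∧ ‖b' - b‖ ≤ 2 * D.coeffDist z z' :=
  ⟨le_of_tendsto (h'.top1.sub h.top1).norm (Eventually.of_forall fun x => (h.norm_sub_le h' x).1),
    le_of_tendsto (h'.top2.sub h.top2).norm (Eventually.of_forall fun x => (h.norm_sub_le h' x).2)⟩

end IsJostPair

/-- A family of normalized solutions for all nonzero spectral parameters. -/
structure JostFamily where
  w1 : ℝ → ℝ → ℂ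
  w2 : ℝ → ℝ → ℂ
  a : ℝ → ℂ
  b : ℝ → ℂ
  jost : ∀ z ≠ 0, D.IsJostPair z (w1 z) (w2 z) (a z) (b z)

theorem exists_jostFamily : Nonempty D.JostFamily := by
  choose w1 w2 a b h using D.exists_isJostPair
  exact ⟨⟨w1, w2, a, b, fun z _ => h z⟩⟩

namespace JostFamily

variable {D} (W : D.JostFamily) {z : ℝ} (hz : z ≠ 0)
include hz

theorem continuousAt_aux {f : ℝ → ℂ} (hf : ∀ z' ≠ 0, ‖f z' - f z‖ ≤ 2 * D.coeffDist z z') :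
    ContinuousAt f z := by
  rw [ContinuousAt, tendsto_iff_norm_sub_tendsto_zero]
  have h2 : Tendsto (fun z' => 2 * D.coeffDist z z') (𝓝 z) (𝓝 0) := by
    simpa using (D.tendsto_coeffDist hz).const_mul 2
  refine squeeze_zero' (Eventually.of_forall fun _ => norm_nonneg _) ?_ h2
  filter_upwards [isOpen_ne.mem_nhds hz] with z' hz'
  exact hf z' hz'

theorem continuousAt_w1 (x : ℝ) : ContinuousAt (fun z => W.w1 z x) z :=
  continuousAt_aux hz fun z' hz' => ((W.jost z hz).norm_sub_le (W.jost z' hz') x).1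

theorem continuousAt_w2 (x : ℝ) : ContinuousAt (fun z => W.w2 z x) z :=
  continuousAt_aux hz fun z' hz' => ((W.jost z hz).norm_sub_le (W.jost z' hz') x).2

theorem continuousAt_a : ContinuousAt W.a z :=
  continuousAt_aux hz fun z' hz' => ((W.jost z hz).norm_sub_le_top (W.jost z' hz')).1

theorem continuousAt_b : ContinuousAt W.b z :=
  continuousAt_aux hz fun z' hz' => ((W.jost z hz).norm_sub_le_top (W.jost z' hz')).2

end JostFamily

end Coeffs

/-- Coefficients with the regularity and decay used for the reflection coefficient. The function
`K = G / q` is absolutely continuous and `L = B / q` is continuously differentiable. -/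
structure RegularCoeffs extends Coeffs where
  K : ℝ → ℝ
  K1 : ℝ → ℝ
  K2 : ℝ → ℝ
  L : ℝ → ℝ
  L1 : ℝ → ℝ
  hK : ∀ x, G x = q x * K x
  primK : IsPrimitive K K1
  iK1 : Integrable K1
  K1_two : MemLp K1 2 volume
  K_bot : Tendsto K atBot (𝓝 0)
  K_top : Tendsto K atTop (𝓝 0)
  ipG : Integrable fun x => p x * G x
  primpK : IsPrimitive (fun x => p x * K x) K2
  iK2 : Integrable K2
  K2_two : MemLp K2 2 volume
  pK_bot : Tendsto (fun x => p x * K x) atBot (𝓝 0)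
  pK_top : Tendsto (fun x => p x * K x) atTop (𝓝 0)
  hL : ∀ x, B x = q x * L x
  derivL : ∀ x, HasDerivAt L (L1 x) x
  iL1 : Integrable L1
  ipL1 : Integrable fun x => p x * L1 x
  L_bot : Tendsto L atBot (𝓝 0)
  L_top : Tendsto L atTop (𝓝 0)
  B_two : MemLp B 2 volume
  pB_two : MemLp (fun x => p x * B x) 2 volume
  tail_neg : IntegrableOn (fun x => p x * B x * ∫ t in Set.Iic x, toCoeffs.ρ t) (Set.Iic 0)
  tail_pos : IntegrableOn (fun x => p x * B x * ∫ t in Set.Ioi x, toCoeffs.ρ t) (Set.Ioi 0)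

/-! ### Solutions for large spectral parameter: uniform O(1/z) bounds -/

theorem abs_freq_ge {z : ℝ} (hz : 2 ≤ |z|) : 3 / 16 * |z| ≤ |freq z| := by
  have hz0 : 0 < |z| := by linarith
  have h1 : |z| - |1 / z| ≤ |z - 1 / z| := abs_sub_abs_le_abs_sub _ _
  have h2 : |1 / z| ≤ 1 / 2 := by
    rw [abs_div, abs_one]
    exact one_div_le_one_div_of_le (by norm_num) hz
  rw [freq, abs_div, abs_of_pos (by norm_num : (0 : ℝ) < 4)]
  linarith

theorem norm_inv_two_freq_le {z : ℝ} (hz : 2 ≤ |z|) :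
    ‖(2 * (freq z : ℂ))⁻¹‖ ≤ 3 / |z| := by
  have := abs_freq_ge hz
  have hz0 : 0 < |z| := by linarith
  rw [norm_inv, norm_mul, Complex.norm_real, Real.norm_eq_abs, Complex.norm_ofNat]
  rw [inv_le_comm₀ (by nlinarith) (by positivity), inv_div]
  linarith

theorem freq_ne_zero {z : ℝ} (hz : 1 < |z|) : freq z ≠ 0 := by
  have hz0 : 0 < |z| := by linarith
  have h1 : |z| - |1 / z| ≤ |z - 1 / z| := abs_sub_abs_le_abs_sub _ _
  have h2 : |1 / z| < 1 := by
    rw [abs_div, abs_one, div_lt_one hz0]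
    exact hz
  have h3 : 0 < |z - 1 / z| := by linarith
  rw [freq]
  exact div_ne_zero (abs_pos.1 h3) (by norm_num)

namespace Coeffs

variable {D : Coeffs}

/-- The derivative of `e^{2iθp} K V` for an absolutely continuous `K`. -/
theorem isPrimitive_e_mul {K K1 : ℝ → ℝ} (hK : IsPrimitive K K1) {V V1 : ℝ → ℂ}
    (hV : ∀ x, HasDerivAt V (V1 x) x) (hV1 : Continuous V1) (θ : ℝ) :
    IsPrimitive (fun x => D.e θ x * K x * V x) (fun x =>
      2 * Complex.I * θ * (D.e θ x * (D.q x * K x : ℝ) * V x) + D.e θ x * K1 x * V x +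
        D.e θ x * K x * V1 x) := by
  have hVc : Continuous V := continuous_iff_continuousAt.2 fun x => (hV x).continuousAt
  have he := D.continuous_e θ
  have hpr : IsPrimitive (fun x => (K x : ℂ)) (fun x => (K1 x : ℂ)) := hK.ofReal
  have heK : IsPrimitive (D.e θ) (fun x => deriv (D.e θ) x) := by
    refine ⟨?_, fun a b => ?_⟩
    all_goals
      have hd : ∀ x, deriv (D.e θ) x = 2 * Complex.I * θ * D.q x * D.e θ x :=
        fun x => (D.hasDerivAt_e θ x).deriv
    all_goals
      -- `Coeffs` does not require q to be continuous; its local integrability comes from q being a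
      -- nonnegative derivative.
      have hqm : Measurable D.q := by
        have : D.q = deriv D.p := funext fun x => (D.hp x).deriv.symm
        rw [this]; exact measurable_deriv _
      have hq0 : ∀ x, 0 ≤ D.q x := fun x => zero_le_one.trans (D.hq x)
      have hqi : ∀ a b, IntervalIntegrable D.q volume a b := fun a b =>
        intervalIntegral.intervalIntegrable_deriv_of_nonneg D.continuous_p.continuousOn
          (fun x _ => D.hp x) (fun x _ => hq0 x)
      have hi : ∀ a b, IntervalIntegrable (fun x => deriv (D.e θ) x) volume a b := fun a b => by
        have h1 : IntervalIntegrable (fun x => (D.q x : ℂ)) volume a b :=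
          ⟨(hqi a b).1.ofReal, (hqi a b).2.ofReal⟩
        have h2 := (h1.const_mul (2 * Complex.I * θ)).mul_continuousOn he.continuousOn
        exact h2.congr (fun x _ => by rw [hd])
    · exact LocallyIntegrable.of_intervalIntegrable hi
    · exact (intervalIntegral.integral_eq_sub_of_hasDerivAt
        (fun x _ => (D.hasDerivAt_e θ x).differentiableAt.hasDerivAt) (hi a b)).symm
  have := (heK.mul hpr).mul (IsPrimitive.of_hasDerivAt hV hV1)
  refine this.congr (ae_of_all _ fun x => ?_)
  simp only [(D.hasDerivAt_e θ x).deriv]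
  push_cast
  ring

theorem tendsto_e_mul {K : ℝ → ℝ} {V : ℝ → ℂ} {l : Filter ℝ} (hK : Tendsto K l (𝓝 0)) {C : ℝ}
    (hV : ∀ x, ‖V x‖ ≤ C) (θ : ℝ) : Tendsto (fun x => D.e θ x * K x * V x) l (𝓝 0) := by
  have h1 : Tendsto (fun x => ‖K x‖ * C) l (𝓝 0) := by simpa using hK.norm.mul_const C
  refine squeeze_zero_norm (fun x => ?_) h1
  rw [norm_mul, norm_mul, norm_e, one_mul, Complex.norm_real]
  gcongr
  exact hV x

theorem integrable_e_mul {h : ℝ → ℝ} (hh : Integrable h) {V : ℝ → ℂ} (hVc : Continuous V) {C : ℝ}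
    (hV : ∀ x, ‖V x‖ ≤ C) (θ : ℝ) : Integrable fun x => D.e θ x * h x * V x := by
  refine ((hh.ofReal (𝕜 := ℂ)).bdd_mul (c := 1) (D.continuous_e θ).aestronglyMeasurable
    (ae_of_all _ fun x => (D.norm_e θ x).le)).mul_bdd (c := C) hVc.aestronglyMeasurable
    (ae_of_all _ hV)

theorem norm_integral_e_mul_le {h : ℝ → ℝ} (hh : Integrable h) {V : ℝ → ℂ} {C : ℝ}
    (hV : ∀ x, ‖V x‖ ≤ C) (θ : ℝ) : ‖∫ x, D.e θ x * h x * V x‖ ≤ C * ∫ x, |h x| := by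
  rw [← integral_const_mul]
  refine norm_integral_le_of_norm_le (hh.abs.const_mul C) (ae_of_all _ fun x => ?_)
  rw [norm_mul, norm_mul, norm_e, one_mul, Complex.norm_real, mul_comm, Real.norm_eq_abs]
  gcongr
  exact hV x

/-- Replacing a nearly constant amplitude by `1` in an oscillatory integral. -/
theorem norm_integral_e_mul_le_osc {h : ℝ → ℝ} (hh : Integrable h) {V : ℝ → ℂ}
    (hVc : Continuous V) {C : ℝ} (hV : ∀ x, ‖V x - 1‖ ≤ C) (θ : ℝ) :
    ‖∫ x, D.e θ x * h x * V x‖ ≤ ‖osc D.p (fun x => (h x : ℂ)) θ‖ + C * ∫ x, |h x| := by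
  have e1 : ∫ x, D.e θ x * h x * V x = osc D.p (fun x => (h x : ℂ)) θ +
      ∫ x, D.e θ x * h x * (V x - 1) := by
    unfold osc
    rw [← integral_add]
    · congr 1 with x
      rw [e]; ring
    · have := integrable_e_mul (D := D) hh (V := fun _ => 1) continuous_const (C := 1) (by simp) θ
      simpa [e] using this
    · exact integrable_e_mul hh (hVc.sub continuous_const) hV θ
  rw [e1]
  refine (norm_add_le _ _).trans ?_
  gcongr
  exact norm_integral_e_mul_le hh hV θ

end Coeffs

namespace RegularCoeffs

open Coeffs

variable (R : RegularCoeffs)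

/-- The total mass of the coefficients. -/
noncomputable def mass : ℝ := ∫ x, R.ρ x

theorem mass_nonneg : 0 ≤ R.mass := integral_nonneg R.ρ_nonneg

theorem norm_K_le (x : ℝ) : |R.K x| ≤ ∫ x, |R.K1 x| := by
  have := R.primK.norm_sub_le R.iK1 R.K_bot x
  simpa using this

theorem norm_le_ρ {z : ℝ} (hz : 1 ≤ |z|) (x : ℝ) :
    ‖R.c11 z x‖ ≤ R.ρ x ∧ ‖R.c12 z x‖ ≤ R.ρ x ∧ ‖R.c21 z x‖ ≤ R.ρ x := by
  simpa using R.norm_coeff_le le_rfl (inv_le_one_of_one_le₀ hz) x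

section Bounds

variable {R} {z : ℝ} {w1 w2 : ℝ → ℂ} {a b : ℂ} (h : R.IsJostPair z w1 w2 a b)
include h

theorem norm_deriv_le (hz : 1 ≤ |z|) (x : ℝ) :
    ‖R.c11 z x * w1 x + R.c12 z x * w2 x‖ ≤ 2 * R.ρ x ∧
      ‖R.c21 z x * w1 x - R.c11 z x * w2 x‖ ≤ 2 * R.ρ x := by
  obtain ⟨h1, h2, h3⟩ := R.norm_le_ρ hz x
  have n1 := h.norm_left_le x
  have n2 := h.norm_right_le x
  have r0 := R.ρ_nonneg x
  constructor
  · refine (norm_add_le _ _).trans ?_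
    rw [norm_mul, norm_mul]
    nlinarith [mul_le_mul h1 n1 (norm_nonneg _) r0, mul_le_mul h2 n2 (norm_nonneg _) r0]
  · refine (norm_sub_le _ _).trans ?_
    rw [norm_mul, norm_mul]
    nlinarith [mul_le_mul h3 n1 (norm_nonneg _) r0, mul_le_mul h1 n2 (norm_nonneg _) r0]

/-- The second component after removing its leading oscillation. -/
theorem isPrimitive_corrected (hz : 2 ≤ |z|) :
    IsPrimitive (fun x => w2 x + (2 * (freq z : ℂ))⁻¹ * (R.e (-freq z) x * R.K x * w1 x))
      (fun x => -(z : ℂ)⁻¹ * (R.e (-freq z) x * R.B x * w1 x) +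
        Complex.I * (z : ℂ)⁻¹ * (R.A x * w2 x) +
        (2 * (freq z : ℂ))⁻¹ * (R.e (-freq z) x * R.K1 x * w1 x +
          R.e (-freq z) x * R.K x * (R.c11 z x * w1 x + R.c12 z x * w2 x))) := by
  have hθ : (freq z : ℂ) ≠ 0 := by exact_mod_cast freq_ne_zero (by linarith : 1 < |z|)
  have c1 := h.sol.continuous_left
  have c2 := h.sol.continuous_right
  have k1 := R.continuous_c11 z
  have k2 := R.continuous_c12 z
  have k3 := R.continuous_c21 z
  have p1 := IsPrimitive.of_hasDerivAt (fun x => (h.sol x).2) (by fun_prop)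
  have p2 := isPrimitive_e_mul (D := R.toCoeffs) R.primK (fun x => (h.sol x).1) (by fun_prop)
    (-freq z)
  refine (p1.add (p2.const_mul (2 * (freq z : ℂ))⁻¹)).congr (ae_of_all _ fun x => ?_)
  simp only [← R.hK]
  -- Differentiating the phase in the correction term gives −i e^{−2iθp} qK w₁, which cancels the
  -- only term of w₂' without a factor 1/z, since qK = G.
  have e1 : (2 * (freq z : ℂ))⁻¹ * (2 * freq z) = 1 := inv_mul_cancel₀ (by simp [hθ])
  simp only [c21]
  push_cast
  simp only [c11, div_eq_mul_inv]
  linear_combination (-Complex.I * R.e (-freq z) x * R.G x * w1 x) * e1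

/-- Every term left in the derivative of the corrected component carries 1/z or 1/θ and an
integrable factor, and the correction itself is O(1/θ) because K is bounded. -/
theorem exists_norm_right_le_aux (hz : 2 ≤ |z|) (x : ℝ) :
    ‖w2 x‖ ≤ ((∫ x, (|R.B x| + |R.A x| + 3 * (|R.K1 x| + |R.K x| * (2 * R.ρ x)))) +
      3 * ∫ x, |R.K1 x|) / |z| := by
  have hz0 : 0 < |z| := by linarith
  have hθ := norm_inv_two_freq_le hz
  have n1 := h.norm_left_le
  have n2 := h.norm_right_le
  have hzi : ‖(z : ℂ)⁻¹‖ = 1 / |z| := by simp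
  have hP := isPrimitive_corrected h hz
  have iKρ : Integrable fun x => |R.K x| * (2 * R.ρ x) := by
    refine (R.integrable_ρ.const_mul 2).bdd_mul (c := ∫ x, |R.K1 x|)
      R.primK.continuous.abs.aestronglyMeasurable (ae_of_all _ fun x => ?_)
    simpa using R.norm_K_le x
  have ib : Integrable fun x =>
      (|R.B x| + |R.A x| + 3 * (|R.K1 x| + |R.K x| * (2 * R.ρ x))) / |z| :=
    (((R.iB.abs.add R.iA.abs).add ((R.iK1.abs.add iKρ).const_mul 3)).div_const _)
  have hb : ∀ x, ‖-(z : ℂ)⁻¹ * (R.e (-freq z) x * R.B x * w1 x) +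
        Complex.I * (z : ℂ)⁻¹ * (R.A x * w2 x) +
        (2 * (freq z : ℂ))⁻¹ * (R.e (-freq z) x * R.K1 x * w1 x +
          R.e (-freq z) x * R.K x * (R.c11 z x * w1 x + R.c12 z x * w2 x))‖ ≤
      (|R.B x| + |R.A x| + 3 * (|R.K1 x| + |R.K x| * (2 * R.ρ x))) / |z| := by
    intro x
    have d1 := (norm_deriv_le h (by linarith) x).1
    have t1 : ‖-(z : ℂ)⁻¹ * (R.e (-freq z) x * R.B x * w1 x)‖ ≤ 1 / |z| * |R.B x| := by
      rw [norm_mul, norm_neg, hzi, norm_mul, norm_mul, norm_e, one_mul, Complex.norm_real]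
      gcongr
      exact mul_le_of_le_one_right (norm_nonneg _) (n1 x)
    have t2 : ‖Complex.I * (z : ℂ)⁻¹ * (R.A x * w2 x)‖ ≤ 1 / |z| * |R.A x| := by
      rw [norm_mul, norm_mul, hzi, Complex.norm_I, one_mul, norm_mul, Complex.norm_real]
      gcongr
      exact mul_le_of_le_one_right (norm_nonneg _) (n2 x)
    have t3 : ‖R.e (-freq z) x * R.K1 x * w1 x‖ ≤ |R.K1 x| := by
      rw [norm_mul, norm_mul, norm_e, one_mul, Complex.norm_real]
      exact mul_le_of_le_one_right (norm_nonneg _) (n1 x)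
    have t4 : ‖R.e (-freq z) x * R.K x * (R.c11 z x * w1 x + R.c12 z x * w2 x)‖ ≤
        |R.K x| * (2 * R.ρ x) := by
      rw [norm_mul, norm_mul, norm_e, one_mul, Complex.norm_real, Real.norm_eq_abs]
      gcongr
    refine (norm_add_le _ _).trans ((add_le_add ((norm_add_le _ _).trans (add_le_add t1 t2))
      (le_of_eq (norm_mul _ _))).trans ?_)
    have t5 := mul_le_mul hθ ((norm_add_le _ _).trans (add_le_add t3 t4)) (norm_nonneg _)
      (by positivity)
    refine (add_le_add le_rfl t5).trans (le_of_eq ?_)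
    field_simp
  have hm := hP.1.aestronglyMeasurable
  have hlim : Tendsto (fun x => w2 x + (2 * (freq z : ℂ))⁻¹ * (R.e (-freq z) x * R.K x * w1 x))
      atBot (𝓝 0) := by
    simpa using h.bot2.add ((tendsto_e_mul (D := R.toCoeffs) R.K_bot n1 (-freq z)).const_mul
      (2 * (freq z : ℂ))⁻¹)
  have y1 := hP.norm_sub_le (ib.mono' hm (ae_of_all _ hb)) hlim x
  have y2 : ∫ x, ‖_‖ ≤ _ := integral_mono (ib.mono' hm (ae_of_all _ hb)).norm ib hb
  have y3 := y1.trans y2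
  rw [integral_div, sub_zero] at y3
  have t6 : ‖(2 * (freq z : ℂ))⁻¹ * (R.e (-freq z) x * R.K x * w1 x)‖ ≤
      3 / |z| * ∫ x, |R.K1 x| := by
    rw [norm_mul, norm_mul, norm_mul, norm_e, one_mul, Complex.norm_real]
    gcongr
    exact (mul_le_of_le_one_right (norm_nonneg _) (n1 x)).trans (R.norm_K_le x)
  have : w2 x = (w2 x + (2 * (freq z : ℂ))⁻¹ * (R.e (-freq z) x * R.K x * w1 x)) -
      (2 * (freq z : ℂ))⁻¹ * (R.e (-freq z) x * R.K x * w1 x) := by ring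
  rw [this]
  refine (norm_sub_le _ _).trans ((add_le_add y3 t6).trans (le_of_eq ?_))
  ring

end Bounds

/-- Uniform `O(1/z)` bounds of the normalized solutions. -/
theorem exists_jost_bound : ∃ C, 1 ≤ C ∧ ∀ {z : ℝ} {w1 w2 : ℝ → ℂ} {a b : ℂ}, 1 ≤ |z| →
    R.IsJostPair z w1 w2 a b → ∀ x, ‖w2 x‖ ≤ C / |z| ∧
      ‖R.c11 z x * w1 x + R.c12 z x * w2 x‖ ≤ C / |z| * R.ρ x := by
  set C0 := (∫ x, (|R.B x| + |R.A x| + 3 * (|R.K1 x| + |R.K x| * (2 * R.ρ x)))) +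
      3 * ∫ x, |R.K1 x|
  -- The value 2 covers 1 ≤ |z| < 2, where |w₂| ≤ 1 ≤ 2/|z|. The extra 1 in the final constant pays
  -- for the A-term of w₁'.
  set C1 := max 2 C0
  have hC1 : 2 ≤ C1 := le_max_left _ _
  refine ⟨C1 + 1, by linarith, fun {z w1 w2 a b} hz h x => ?_⟩
  have hz0 : 0 < |z| := by linarith
  have n1 := h.norm_left_le x
  have hw2 : ‖w2 x‖ ≤ C1 / |z| := by
    rcases le_or_gt 2 |z| with h2 | h2
    · refine (exists_norm_right_le_aux h h2 x).trans ?_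
      gcongr
      exact le_max_right _ _
    · refine (h.norm_right_le x).trans ?_
      rw [le_div_iff₀ hz0]
      linarith
  refine ⟨hw2.trans (by gcongr; linarith), ?_⟩
  refine (norm_add_le _ _).trans ?_
  rw [norm_mul, norm_mul, norm_c11]
  have hA : |R.A x| ≤ R.ρ x := by
    unfold Coeffs.ρ
    have := abs_nonneg (R.B x); have := abs_nonneg (R.G x)
    linarith
  have r0 := R.ρ_nonneg x
  have t1 : |R.A x| * |z|⁻¹ * ‖w1 x‖ ≤ R.ρ x * |z|⁻¹ * 1 := by gcongr
  have t2 : ‖R.c12 z x‖ * ‖w2 x‖ ≤ R.ρ x * (C1 / |z|) := by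
    gcongr
    exact (R.norm_le_ρ hz x).2.1
  refine (add_le_add t1 t2).trans (le_of_eq ?_)
  field_simp
  ring

end RegularCoeffs

/-! ### Tail estimates, decay of b, and the p G integral -/

namespace RegularCoeffs

open Coeffs

variable (R : RegularCoeffs)

/-- The left tail of the coefficients. -/
noncomputable def tailL (x : ℝ) : ℝ := ∫ t in Set.Iic x, R.ρ t

/-- The right tail of the coefficients. -/
noncomputable def tailR (x : ℝ) : ℝ := ∫ t in Set.Ioi x, R.ρ t

theorem tailL_nonneg (x : ℝ) : 0 ≤ R.tailL x := integral_nonneg R.ρ_nonneg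

theorem tailR_nonneg (x : ℝ) : 0 ≤ R.tailR x := integral_nonneg R.ρ_nonneg

theorem tailL_le_mass (x : ℝ) : R.tailL x ≤ R.mass :=
  setIntegral_le_integral R.integrable_ρ (ae_of_all _ R.ρ_nonneg)

theorem tailR_le_mass (x : ℝ) : R.tailR x ≤ R.mass :=
  setIntegral_le_integral R.integrable_ρ (ae_of_all _ R.ρ_nonneg)

variable {R}

theorem norm_sub_le_tail {f g : ℝ → ℂ} (hf : ∀ x, HasDerivAt f (g x) x) (hg : Continuous g) {C : ℝ}
    (hb : ∀ x, ‖g x‖ ≤ C * R.ρ x) {l r : ℂ} (hl : Tendsto f atBot (𝓝 l))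
    (hr : Tendsto f atTop (𝓝 r)) (x : ℝ) :
    ‖f x - l‖ ≤ C * R.tailL x ∧ ‖f x - r‖ ≤ C * R.tailR x ∧ ‖r - l‖ ≤ C * R.mass := by
  have hP := IsPrimitive.of_hasDerivAt hf hg
  have hi : Integrable g := (R.integrable_ρ.const_mul C).mono' hg.aestronglyMeasurable
    (ae_of_all _ hb)
  refine ⟨?_, ?_, ?_⟩
  · rw [hP.sub_eq_integral_Iic hi hl, tailL, ← integral_const_mul]
    exact norm_integral_le_of_norm_le (R.integrable_ρ.const_mul C).integrableOn (ae_of_all _ hb)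
  · rw [norm_sub_rev, hP.sub_eq_integral_Ioi hi hr, tailR, ← integral_const_mul]
    exact norm_integral_le_of_norm_le (R.integrable_ρ.const_mul C).integrableOn (ae_of_all _ hb)
  · rw [← hP.integral_eq hi hl hr, mass, ← integral_const_mul]
    exact norm_integral_le_of_norm_le (R.integrable_ρ.const_mul C) (ae_of_all _ hb)

/-- The quantitative bounds satisfied by a normalized solution for `|z| ≥ 1`. -/
structure JostBounds (R : RegularCoeffs) (C z : ℝ) (w1 w2 : ℝ → ℂ) (a b : ℂ) : Prop where
  right_le : ∀ x, ‖w2 x‖ ≤ C / |z|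
  deriv_le : ∀ x, ‖R.c11 z x * w1 x + R.c12 z x * w2 x‖ ≤ C / |z| * R.ρ x
  b_le : ‖b‖ ≤ C / |z|
  left_tailL : ∀ x, ‖w1 x - 1‖ ≤ C / |z| * R.tailL x
  left_tailR : ∀ x, ‖w1 x - a‖ ≤ C / |z| * R.tailR x
  a_sub_le : ‖a - 1‖ ≤ C / |z| * R.mass
  right_tailL : ∀ x, ‖w2 x‖ ≤ 2 * R.tailL x
  right_tailR : ∀ x, ‖w2 x - b‖ ≤ 2 * R.tailR x

variable (R) in
theorem exists_jostBounds : ∃ C, 1 ≤ C ∧ ∀ {z : ℝ} {w1 w2 : ℝ → ℂ} {a b : ℂ}, 1 ≤ |z| →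
    R.IsJostPair z w1 w2 a b → JostBounds R C z w1 w2 a b := by
  obtain ⟨C, hC, h⟩ := R.exists_jost_bound
  refine ⟨C, hC, fun {z w1 w2 a b} hz hj => ?_⟩
  have c1 := hj.sol.continuous_left
  have c2 := hj.sol.continuous_right
  have k1 := R.continuous_c11 z
  have k2 := R.continuous_c12 z
  have k3 := R.continuous_c21 z
  have t1 := norm_sub_le_tail (fun x => (hj.sol x).1) (by fun_prop) (fun x => (h hz hj x).2)
    hj.bot1 hj.top1
  -- For w₂ the derivative is bounded only by 2ρ, without 1/|z|, so its tail bound has no decay in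
  -- z. The decay in products comes from pairing it with the uniform bound C/|z|.
  have t2 := norm_sub_le_tail (fun x => (hj.sol x).2) (by fun_prop)
    (fun x => (norm_deriv_le hj hz x).2) hj.bot2 hj.top2
  exact ⟨fun x => (h hz hj x).1, fun x => (h hz hj x).2,
    le_of_tendsto hj.top2.norm (Eventually.of_forall fun x => (h hz hj x).1),
    fun x => (t1 x).1, fun x => (t1 x).2.1, (t1 0).2.2,
    fun x => by simpa using (t2 x).1, fun x => (t2 x).2.1⟩

theorem JostBounds.left_sub_one_le {C z : ℝ} {w1 w2 : ℝ → ℂ} {a b : ℂ}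
    (hB : JostBounds R C z w1 w2 a b) (hC : 1 ≤ C) (x : ℝ) : ‖w1 x - 1‖ ≤ C / |z| * R.mass := by
  refine (hB.left_tailL x).trans ?_
  gcongr
  exact R.tailL_le_mass x

/-- Decay of the transition coefficient `b` for large `|z|`. -/
theorem norm_mul_b_le {C z : ℝ} (hC : 1 ≤ C) (hz : 2 ≤ |z|) {w1 w2 : ℝ → ℂ} {a b : ℂ}
    (h : R.IsJostPair z w1 w2 a b) (hB : JostBounds R C z w1 w2 a b) :
    |z| * ‖b‖ ≤ ‖osc R.p (fun x => (R.B x : ℂ)) (-freq z)‖ +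
      3 * ‖osc R.p (fun x => (R.K1 x : ℂ)) (-freq z)‖ +
      C * (R.mass * (∫ x, |R.B x|) + (∫ x, |R.A x|) + 3 * (R.mass * ∫ x, |R.K1 x|) +
        3 * ∫ x, |R.K x| * R.ρ x) / |z| := by
  have hz0 : 0 < |z| := by linarith
  have hzc : (z : ℂ) ≠ 0 := by
    intro h0; rw [Complex.ofReal_eq_zero] at h0; rw [h0, abs_zero] at hz0; exact lt_irrefl _ hz0
  have hθ := norm_inv_two_freq_le hz
  have n1 := h.norm_left_le
  have n2 := h.norm_right_le
  have c1 := h.sol.continuous_left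
  have c2 := h.sol.continuous_right
  have k1 := R.continuous_c11 z
  have k2 := R.continuous_c12 z
  have hP := isPrimitive_corrected h hz
  have iKρ : Integrable fun x => |R.K x| * R.ρ x := by
    refine R.integrable_ρ.bdd_mul (c := ∫ x, |R.K1 x|)
      R.primK.continuous.abs.aestronglyMeasurable (ae_of_all _ fun x => ?_)
    simpa using R.norm_K_le x
  have i1 := integrable_e_mul (D := R.toCoeffs) R.iB c1 n1 (-freq z)
  have i2 : Integrable fun x => (R.A x : ℂ) * w2 x :=
    (R.iA.ofReal (𝕜 := ℂ)).mul_bdd (c := 1) c2.aestronglyMeasurable (ae_of_all _ n2)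
  have i3 := integrable_e_mul (D := R.toCoeffs) R.iK1 c1 n1 (-freq z)
  have b4 : ∀ x, ‖R.e (-freq z) x * R.K x * (R.c11 z x * w1 x + R.c12 z x * w2 x)‖ ≤
      C / |z| * (|R.K x| * R.ρ x) := fun x => by
    rw [norm_mul, norm_mul, norm_e, one_mul, Complex.norm_real, Real.norm_eq_abs]
    calc _ ≤ |R.K x| * (C / |z| * R.ρ x) := by gcongr; exact hB.deriv_le x
      _ = _ := by ring
  have i4 : Integrable fun x =>
      R.e (-freq z) x * R.K x * (R.c11 z x * w1 x + R.c12 z x * w2 x) := by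
    have he := R.continuous_e (-freq z)
    have hK := R.primK.continuous
    exact (iKρ.const_mul (C / |z|)).mono' (by fun_prop) (ae_of_all _ b4)
  have hlb : Tendsto (fun x => w2 x + (2 * (freq z : ℂ))⁻¹ * (R.e (-freq z) x * R.K x * w1 x))
      atBot (𝓝 0) := by
    simpa using h.bot2.add ((tendsto_e_mul (D := R.toCoeffs) R.K_bot n1 (-freq z)).const_mul
      (2 * (freq z : ℂ))⁻¹)
  have hlt : Tendsto (fun x => w2 x + (2 * (freq z : ℂ))⁻¹ * (R.e (-freq z) x * R.K x * w1 x))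
      atTop (𝓝 b) := by
    simpa using h.top2.add ((tendsto_e_mul (D := R.toCoeffs) R.K_top n1 (-freq z)).const_mul
      (2 * (freq z : ℂ))⁻¹)
  have key := hP.integral_eq (((i1.const_mul _).add (i2.const_mul _)).add
    ((i3.add i4).const_mul _)) hlb hlt
  have i34 : Integrable fun x => (2 * (freq z : ℂ))⁻¹ * (R.e (-freq z) x * R.K1 x * w1 x +
      R.e (-freq z) x * R.K x * (R.c11 z x * w1 x + R.c12 z x * w2 x)) :=
    (i3.add i4).const_mul _
  have i1' := i1.const_mul (-(z : ℂ)⁻¹)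
  have i2' := i2.const_mul (Complex.I * (z : ℂ)⁻¹)
  have i12 : Integrable fun x => -(z : ℂ)⁻¹ * (R.e (-freq z) x * R.B x * w1 x) +
      Complex.I * (z : ℂ)⁻¹ * (R.A x * w2 x) := i1'.add i2'
  rw [integral_add i12 i34, integral_add i1' i2', integral_const_mul, integral_const_mul,
    integral_const_mul, integral_add i3 i4, sub_zero] at key
  -- Replacing w₁ by 1 leaves a pure oscillatory integral, square-integrable in θ; the replacement
  -- costs O(1/|z|).
  have e1 : ‖∫ x, R.e (-freq z) x * R.B x * w1 x‖ ≤
      ‖osc R.p (fun x => (R.B x : ℂ)) (-freq z)‖ + C / |z| * R.mass * ∫ x, |R.B x| :=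
    norm_integral_e_mul_le_osc R.iB c1 (hB.left_sub_one_le hC) _
  have e2 : ‖∫ x, (R.A x : ℂ) * w2 x‖ ≤ C / |z| * ∫ x, |R.A x| := by
    rw [← integral_const_mul]
    refine norm_integral_le_of_norm_le (R.iA.abs.const_mul _) (ae_of_all _ fun x => ?_)
    rw [norm_mul, Complex.norm_real, mul_comm, Real.norm_eq_abs]
    gcongr
    exact hB.right_le x
  have e3 : ‖∫ x, R.e (-freq z) x * R.K1 x * w1 x‖ ≤
      ‖osc R.p (fun x => (R.K1 x : ℂ)) (-freq z)‖ + C / |z| * R.mass * ∫ x, |R.K1 x| :=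
    norm_integral_e_mul_le_osc R.iK1 c1 (hB.left_sub_one_le hC) _
  have e4 : ‖∫ x, R.e (-freq z) x * R.K x * (R.c11 z x * w1 x + R.c12 z x * w2 x)‖ ≤
      C / |z| * ∫ x, |R.K x| * R.ρ x := by
    rw [← integral_const_mul]
    exact norm_integral_le_of_norm_le (iKρ.const_mul _) (ae_of_all _ b4)
  have hzb : (z : ℂ) * b = -(∫ x, R.e (-freq z) x * R.B x * w1 x) +
      Complex.I * (∫ x, (R.A x : ℂ) * w2 x) + (z : ℂ) * (2 * (freq z : ℂ))⁻¹ *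
      ((∫ x, R.e (-freq z) x * R.K1 x * w1 x) +
        ∫ x, R.e (-freq z) x * R.K x * (R.c11 z x * w1 x + R.c12 z x * w2 x)) := by
    rw [← key]
    field_simp
  have hz3 : ‖(z : ℂ) * (2 * (freq z : ℂ))⁻¹‖ ≤ 3 := by
    rw [norm_mul, Complex.norm_real, Real.norm_eq_abs]
    calc _ ≤ |z| * (3 / |z|) := by gcongr
      _ = 3 := by field_simp
  calc |z| * ‖b‖ = ‖(z : ℂ) * b‖ := by rw [norm_mul, Complex.norm_real, Real.norm_eq_abs]
    _ ≤ ‖∫ x, R.e (-freq z) x * R.B x * w1 x‖ + ‖∫ x, (R.A x : ℂ) * w2 x‖ +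
        3 * (‖∫ x, R.e (-freq z) x * R.K1 x * w1 x‖ +
        ‖∫ x, R.e (-freq z) x * R.K x * (R.c11 z x * w1 x + R.c12 z x * w2 x)‖) := by
      rw [hzb]
      refine (norm_add_le _ _).trans (add_le_add ((norm_add_le _ _).trans (le_of_eq ?_)) ?_)
      · rw [norm_neg, norm_mul Complex.I, Complex.norm_I, one_mul]
      · rw [norm_mul]
        exact mul_le_mul hz3 (norm_add_le _ _) (norm_nonneg _) (by norm_num)
    _ ≤ (‖osc R.p (fun x => (R.B x : ℂ)) (-freq z)‖ + C / |z| * R.mass * ∫ x, |R.B x|) +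
        C / |z| * (∫ x, |R.A x|) + 3 * ((‖osc R.p (fun x => (R.K1 x : ℂ)) (-freq z)‖ +
          C / |z| * R.mass * ∫ x, |R.K1 x|) + C / |z| * ∫ x, |R.K x| * R.ρ x) := by gcongr
    _ = _ := by ring

/-- The oscillatory integral against `w1²` after an integration by parts. -/
theorem norm_mul_integral_pG_le {C z : ℝ} (hC : 1 ≤ C) (hz : 2 ≤ |z|) {w1 w2 : ℝ → ℂ} {a b : ℂ}
    (h : R.IsJostPair z w1 w2 a b) (hB : JostBounds R C z w1 w2 a b) :
    |z| * ‖∫ x, R.e (-freq z) x * (R.p x * R.G x : ℝ) * (w1 x * w1 x)‖ ≤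
      3 * ‖osc R.p (fun x => (R.K2 x : ℂ)) (-freq z)‖ +
      C * (6 * (R.mass * ∫ x, |R.K2 x|) + 6 * ((∫ x, |R.K2 x|) * R.mass)) / |z| := by
  have hz0 : 0 < |z| := by linarith
  have hθ := norm_inv_two_freq_le hz
  have hθ0 : (freq z : ℂ) ≠ 0 := by exact_mod_cast freq_ne_zero (by linarith : 1 < |z|)
  have n1 := h.norm_left_le
  have c1 := h.sol.continuous_left
  have c2 := h.sol.continuous_right
  have k1 := R.continuous_c11 z
  have k2 := R.continuous_c12 z
  have n11 : ∀ x, ‖w1 x * w1 x‖ ≤ 1 := fun x => by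
    rw [norm_mul]; exact mul_le_one₀ (n1 x) (norm_nonneg _) (n1 x)
  have hd : ∀ x, HasDerivAt (fun x => w1 x * w1 x)
      (2 * w1 x * (R.c11 z x * w1 x + R.c12 z x * w2 x)) x := fun x =>
    ((h.sol x).1.mul (h.sol x).1).congr_deriv (by ring)
  -- The same integration by parts as for b, now with pK in place of K and amplitude w₁², whose
  -- derivative is O(1/z)ρ.
  have hP := isPrimitive_e_mul (D := R.toCoeffs) R.primpK hd (by fun_prop) (-freq z)
  have hpK : ∀ x, |R.p x * R.K x| ≤ ∫ x, |R.K2 x| := fun x => by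
    simpa using R.primpK.norm_sub_le R.iK2 R.pK_bot x
  have b3 : ∀ x, ‖R.e (-freq z) x * (R.p x * R.K x : ℝ) *
      (2 * w1 x * (R.c11 z x * w1 x + R.c12 z x * w2 x))‖ ≤
      2 * C / |z| * (∫ x, |R.K2 x|) * R.ρ x := fun x => by
    rw [norm_mul, norm_mul, norm_e, one_mul, Complex.norm_real, Real.norm_eq_abs, norm_mul,
      norm_mul, Complex.norm_ofNat]
    calc _ ≤ (∫ x, |R.K2 x|) * (2 * 1 * (C / |z| * R.ρ x)) := by
          gcongr
          · exact hpK x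
          · exact n1 x
          · exact hB.deriv_le x
      _ = _ := by ring
  have eG : ∀ x, (R.q x * (R.p x * R.K x) : ℝ) = R.p x * R.G x := fun x => by rw [R.hK]; ring
  simp only [eG] at hP
  have c11 : Continuous fun x => w1 x * w1 x := c1.mul c1
  have i1 := integrable_e_mul (D := R.toCoeffs) R.ipG c11 n11 (-freq z)
  have i2 := integrable_e_mul (D := R.toCoeffs) R.iK2 c11 n11 (-freq z)
  have i3 : Integrable fun x => R.e (-freq z) x * (R.p x * R.K x : ℝ) *
      (2 * w1 x * (R.c11 z x * w1 x + R.c12 z x * w2 x)) := by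
    have he := R.continuous_e (-freq z)
    have hK := R.primK.continuous
    have hp := R.continuous_p
    exact (R.integrable_ρ.const_mul _).mono' (by fun_prop) (ae_of_all _ b3)
  have key := hP.integral_eq (((i1.const_mul _).add i2).add i3)
    (tendsto_e_mul (D := R.toCoeffs) R.pK_bot n11 (-freq z))
    (tendsto_e_mul (D := R.toCoeffs) R.pK_top n11 (-freq z))
  have i1' := i1.const_mul (2 * Complex.I * ((-freq z : ℝ) : ℂ))
  have i12 : Integrable fun x => 2 * Complex.I * ((-freq z : ℝ) : ℂ) *
      (R.e (-freq z) x * (R.p x * R.G x : ℝ) * (w1 x * w1 x)) +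
      R.e (-freq z) x * R.K2 x * (w1 x * w1 x) := i1'.add i2
  rw [integral_add i12 i3, integral_add i1' i2,
    integral_const_mul, sub_zero] at key
  have e2 : ‖∫ x, R.e (-freq z) x * R.K2 x * (w1 x * w1 x)‖ ≤
      ‖osc R.p (fun x => (R.K2 x : ℂ)) (-freq z)‖ + (2 * (C / |z| * R.mass)) * ∫ x, |R.K2 x| := by
    refine norm_integral_e_mul_le_osc R.iK2 c11 (fun x => ?_) _
    have : w1 x * w1 x - 1 = (w1 x + 1) * (w1 x - 1) := by ring
    rw [this, norm_mul]
    gcongr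
    · refine (norm_add_le _ _).trans ?_
      rw [norm_one]
      linarith [n1 x]
    · exact hB.left_sub_one_le hC x
  have e3 : ‖∫ x, R.e (-freq z) x * (R.p x * R.K x : ℝ) *
      (2 * w1 x * (R.c11 z x * w1 x + R.c12 z x * w2 x))‖ ≤
      2 * C / |z| * (∫ x, |R.K2 x|) * R.mass := by
    rw [mass, ← integral_const_mul]
    exact norm_integral_le_of_norm_le (R.integrable_ρ.const_mul _) (ae_of_all _ b3)
  have hz3 : |z| * ‖(Complex.I * (2 * (freq z : ℂ))⁻¹)‖ ≤ 3 := by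
    rw [norm_mul, Complex.norm_I, one_mul]
    calc _ ≤ |z| * (3 / |z|) := by gcongr
      _ = 3 := by field_simp
  have hI : ∫ x, R.e (-freq z) x * (R.p x * R.G x : ℝ) * (w1 x * w1 x) =
      -(Complex.I * (2 * (freq z : ℂ))⁻¹) * ((∫ x, R.e (-freq z) x * R.K2 x * (w1 x * w1 x)) +
        ∫ x, R.e (-freq z) x * (R.p x * R.K x : ℝ) *
      (2 * w1 x * (R.c11 z x * w1 x + R.c12 z x * w2 x))) := by
    have hI2 : Complex.I * Complex.I = -1 := Complex.I_mul_I
    have e5 : (2 * (freq z : ℂ))⁻¹ * (2 * freq z) = 1 := inv_mul_cancel₀ (by simp [hθ0])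
    push_cast at key ⊢
    set X := ∫ x, R.e (-freq z) x * (R.p x * R.G x : ℂ) * (w1 x * w1 x)
    linear_combination (Complex.I * (2 * (freq z : ℂ))⁻¹) * key + Complex.I * Complex.I * X * e5
      + X * hI2
  rw [hI, norm_mul, norm_neg, ← mul_assoc]
  calc _ ≤ 3 * ((‖osc R.p (fun x => (R.K2 x : ℂ)) (-freq z)‖ +
        (2 * (C / |z| * R.mass)) * ∫ x, |R.K2 x|) + 2 * C / |z| * (∫ x, |R.K2 x|) * R.mass) :=
        mul_le_mul hz3 ((norm_add_le _ _).trans (add_le_add e2 e3)) (norm_nonneg _) (by norm_num)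
    _ = _ := by ring

end RegularCoeffs

/-! ### Differentiation with respect to the spectral parameter -/

/-- The derivative of an integral `∫ (g z' - g z) V z'` with a continuous amplitude `V`. -/
theorem tendsto_slope_integral {g V : ℝ → ℝ → ℂ} {g1 : ℝ → ℂ} {z : ℝ}
    (hg : ∀ x, HasDerivAt (fun z => g z x) (g1 x) z)
    (hV : ∀ x, ContinuousAt (fun z => V z x) z) {bd : ℝ → ℝ} (hbd : Integrable bd)
    (hm : ∀ᶠ z' in 𝓝 z, AEStronglyMeasurable fun x => (g z' x - g z x) * V z' x)
    (hb : ∀ᶠ z' in 𝓝 z, ∀ x, ‖(g z' x - g z x) * V z' x‖ ≤ |z' - z| * bd x) :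
    Tendsto (fun z' => (z' - z)⁻¹ • ∫ x, (g z' x - g z x) * V z' x) (𝓝[≠] z)
      (𝓝 (∫ x, g1 x * V z x)) := by
  have h0 : Tendsto (fun z' => ∫ x, (z' - z)⁻¹ • ((g z' x - g z x) * V z' x)) (𝓝[≠] z)
      (𝓝 (∫ x, g1 x * V z x)) := by
    refine tendsto_integral_filter_of_dominated_convergence bd ?_ ?_ hbd (ae_of_all _ fun x => ?_)
    · filter_upwards [nhdsWithin_le_nhds hm] with z' h
      exact h.const_smul (z' - z)⁻¹
    · filter_upwards [nhdsWithin_le_nhds hb, self_mem_nhdsWithin] with z' h hne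
      refine ae_of_all _ fun x => ?_
      have h1 : 0 < |z' - z| := abs_pos.2 (sub_ne_zero.2 hne)
      rw [norm_smul, norm_inv, Real.norm_eq_abs, inv_mul_le_iff₀ h1]
      exact h x
    · have h1 := (hasDerivAt_iff_tendsto_slope.1 (hg x)).mul
        ((hV x).tendsto.mono_left (nhdsWithin_le_nhds (s := {z}ᶜ)))
      refine h1.congr fun z' => ?_
      simp only [slope, vsub_eq_sub, smul_mul_assoc]
  simpa only [integral_smul] using h0

theorem abs_freq_sub_le {z z' : ℝ} (hz : 1 ≤ |z|) (hz' : 1 ≤ |z'|) :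
    |freq z' - freq z| ≤ |z' - z| / 2 := by
  have h0 : z ≠ 0 := by rintro rfl; norm_num at hz
  have h0' : z' ≠ 0 := by rintro rfl; norm_num at hz'
  have h1 : freq z' - freq z = (z' - z) * ((1 + 1 / (z * z')) / 4) := by
    unfold freq; field_simp; ring
  have h2 : |1 / (z * z')| ≤ 1 := by
    rw [abs_div, abs_one, abs_mul]
    exact div_le_one_of_le₀ (one_le_mul_of_one_le_of_one_le hz hz') (by positivity)
  rw [h1, abs_mul, abs_div, abs_of_pos (by norm_num : (0 : ℝ) < 4)]
  have h3 : |1 + 1 / (z * z')| ≤ 2 := by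
    refine (abs_add_le _ _).trans ?_
    rw [abs_one]; linarith
  nlinarith [abs_nonneg (z' - z)]

theorem abs_inv_sub_le {z z' : ℝ} (hz : 1 ≤ |z|) (hz' : 1 ≤ |z'|) :
    |z'⁻¹ - z⁻¹| ≤ |z' - z| := by
  have h0 : z ≠ 0 := by rintro rfl; norm_num at hz
  have h0' : z' ≠ 0 := by rintro rfl; norm_num at hz'
  have h1 : z'⁻¹ - z⁻¹ = (z - z') / (z * z') := by field_simp
  rw [h1, abs_div, abs_sub_comm, abs_mul]
  exact div_le_self (abs_nonneg _) (one_le_mul_of_one_le_of_one_le hz hz')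

theorem hasDerivAt_freq {z : ℝ} (hz : z ≠ 0) : HasDerivAt freq ((1 + 1 / z ^ 2) / 4) z := by
  unfold freq
  simp only [one_div]
  exact (((hasDerivAt_id z).sub (hasDerivAt_inv hz)).div_const 4).congr_deriv (by ring)

/-- A phase function for the spectral parameter: `± freq`. -/
def IsPhase (θ : ℝ → ℝ) : Prop := θ = freq ∨ θ = fun z => -freq z

namespace IsPhase

variable {θ : ℝ → ℝ} {z z' : ℝ}

theorem abs_sub_le (h : IsPhase θ) (hz : 1 ≤ |z|) (hz' : 1 ≤ |z'|) :
    |θ z' - θ z| ≤ |z' - z| / 2 := by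
  rcases h with rfl | rfl
  · exact abs_freq_sub_le hz hz'
  · have := abs_freq_sub_le hz hz'
    rwa [← abs_neg, show -(-freq z' - -freq z) = freq z' - freq z by ring]

theorem exists_hasDerivAt (h : IsPhase θ) (hz : 1 ≤ |z|) :
    ∃ θ1, |θ1| ≤ 1 / 2 ∧ HasDerivAt θ θ1 z := by
  have h0 : z ≠ 0 := by rintro rfl; norm_num at hz
  have h1 : |(1 + 1 / z ^ 2) / 4| ≤ 1 / 2 := by
    have : 1 / z ^ 2 ≤ 1 := by
      rw [← sq_abs]
      exact div_le_one_of_le₀ (one_le_pow₀ hz) (by positivity)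
    rw [abs_of_nonneg (by positivity)]
    linarith
  rcases h with rfl | rfl
  · exact ⟨_, h1, hasDerivAt_freq h0⟩
  · exact ⟨_, by rwa [abs_neg], (hasDerivAt_freq h0).neg⟩

theorem ne_zero (h : IsPhase θ) (hz : 1 < |z|) : θ z ≠ 0 := by
  rcases h with rfl | rfl
  · exact freq_ne_zero hz
  · exact neg_ne_zero.2 (freq_ne_zero hz)

end IsPhase

namespace Coeffs

variable (D : Coeffs) {θ : ℝ → ℝ} {z z' : ℝ}

theorem norm_e_sub_le (s t x : ℝ) : ‖D.e t x - D.e s x‖ ≤ 2 * |t - s| * |D.p x| := by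
  have h1 : D.e t x - D.e s x =
      D.e s x * (Complex.exp (Complex.I * (2 * (t - s) * D.p x : ℝ)) - 1) := by
    rw [mul_sub, mul_one, e, e, ← Complex.exp_add]
    congr 2
    push_cast; ring
  rw [h1, norm_mul, norm_e, one_mul]
  refine Real.norm_exp_I_mul_ofReal_sub_one_le.trans (le_of_eq ?_)
  rw [Real.norm_eq_abs, abs_mul, abs_mul, abs_two]

theorem norm_e_comp_sub_le (hθ : IsPhase θ) (hz : 1 ≤ |z|) (hz' : 1 ≤ |z'|) (x : ℝ) :
    ‖D.e (θ z') x - D.e (θ z) x‖ ≤ |z' - z| * |D.p x| := by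
  refine (D.norm_e_sub_le _ _ x).trans ?_
  have := hθ.abs_sub_le hz hz'
  gcongr
  linarith

theorem norm_e_div_sub_le (hθ : IsPhase θ) (hz : 1 ≤ |z|) (hz' : 1 ≤ |z'|) (x : ℝ) :
    ‖D.e (θ z') x / z' - D.e (θ z) x / z‖ ≤ |z' - z| * (|D.p x| + 1) := by
  have h1 : D.e (θ z') x / z' - D.e (θ z) x / z =
      (D.e (θ z') x - D.e (θ z) x) * (z' : ℂ)⁻¹ + D.e (θ z) x * ((z'⁻¹ - z⁻¹ : ℝ) : ℂ) := by
    push_cast; ring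
  rw [h1]
  refine (norm_add_le _ _).trans ?_
  rw [norm_mul, norm_mul, norm_e, one_mul, Complex.norm_real, norm_inv, Complex.norm_real,
    Real.norm_eq_abs, Real.norm_eq_abs, mul_add, mul_one]
  refine add_le_add ?_ (abs_inv_sub_le hz hz')
  exact (mul_le_of_le_one_right (norm_nonneg _) (inv_le_one_of_one_le₀ hz')).trans
    (D.norm_e_comp_sub_le hθ hz hz' x)

theorem hasDerivAt_e_comp {θ1 : ℝ} (h : HasDerivAt θ θ1 z) (x : ℝ) :
    HasDerivAt (fun z => D.e (θ z) x) (2 * Complex.I * θ1 * (D.p x * D.e (θ z) x)) z :=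
  (((h.ofReal_comp.const_mul (2 * Complex.I)).mul_const (D.p x : ℂ)).cexp).congr_deriv
    (by rw [e]; ring)

theorem hasDerivAt_e_div {θ1 : ℝ} (h : HasDerivAt θ θ1 z) (hz : z ≠ 0) (x : ℝ) :
    HasDerivAt (fun z : ℝ => D.e (θ z) x / z)
      (2 * Complex.I * θ1 * (D.p x * D.e (θ z) x) / z - D.e (θ z) x / z ^ 2) z := by
  have hzc : (z : ℂ) ≠ 0 := by exact_mod_cast hz
  refine ((D.hasDerivAt_e_comp h x).div (hasDerivAt_id z).ofReal_comp hzc).congr_deriv ?_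
  simp only [id, Complex.ofReal_one]
  field_simp

theorem norm_deriv_e_div_le {θ1 : ℝ} (h1 : |θ1| ≤ 1 / 2) (hz : 1 ≤ |z|) (x : ℝ) :
    ‖2 * Complex.I * θ1 * (D.p x * D.e (θ z) x) / z - D.e (θ z) x / z ^ 2‖ ≤
      (|D.p x| + 1) / |z| := by
  have hz0 : 0 < |z| := by linarith
  refine (norm_sub_le _ _).trans ?_
  rw [add_div]
  simp only [norm_div, norm_mul, norm_e, Complex.norm_real, Complex.norm_I, norm_pow, mul_one,
    Real.norm_eq_abs, Complex.norm_ofNat]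
  refine add_le_add ?_ ?_
  · gcongr
    nlinarith [abs_nonneg (D.p x)]
  · exact one_div_le_one_div_of_le hz0 (le_self_pow₀ hz (by norm_num))

end Coeffs

namespace RegularCoeffs

open Coeffs

variable (R : RegularCoeffs)

/-! ### Oscillatory integrals of the coefficient `B` with a cut-off -/

/-- A bounded amplitude whose derivative has compact support. -/
structure IsCutoff (ψ : ℝ → ℝ) : Prop where
  contDiff : ContDiff ℝ 1 ψ
  abs_le : ∀ x, |ψ x| ≤ 1
  compact : HasCompactSupport (deriv ψ)

theorem isCutoff_one : IsCutoff fun _ => 1 :=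
  ⟨contDiff_const, by simp, by simp [HasCompactSupport.zero, Pi.zero_def.symm]⟩

theorem isCutoff_smoothTransition : IsCutoff Real.smoothTransition where
  contDiff := Real.smoothTransition.contDiff
  abs_le x := by
    rw [abs_of_nonneg (Real.smoothTransition.nonneg x)]
    exact Real.smoothTransition.le_one x
  compact := by
    refine HasCompactSupport.intro (isCompact_Icc (a := (0 : ℝ)) (b := 1)) fun x hx => ?_
    rw [Set.mem_Icc, not_and_or, not_le, not_le] at hx
    rcases hx with hx | hx
    · have : Real.smoothTransition =ᶠ[𝓝 x] fun _ => 0 := by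
        filter_upwards [Iio_mem_nhds hx] with y hy
        exact Real.smoothTransition.zero_of_nonpos hy.le
      rw [this.deriv_eq, deriv_const]
    · have : Real.smoothTransition =ᶠ[𝓝 x] fun _ => 1 := by
        filter_upwards [Ioi_mem_nhds hx] with y hy
        exact Real.smoothTransition.one_of_one_le hy.le
      rw [this.deriv_eq, deriv_const]

section Cutoff

variable {ψ : ℝ → ℝ} (hψ : IsCutoff ψ)
include hψ

theorem integrable_mul_cutoff {f : ℝ → ℝ} (hf : Integrable f) :
    Integrable fun x => f x * ψ x :=
  hf.mul_bdd (c := 1) hψ.contDiff.continuous.aestronglyMeasurable (ae_of_all _ hψ.abs_le)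

theorem integrable_B_cutoff : Integrable fun x => ((R.B x * ψ x : ℝ) : ℂ) :=
  (integrable_mul_cutoff hψ R.iB).ofReal

theorem memLp_mul_cutoff {f : ℝ → ℝ} (hf : MemLp f 2 volume) :
    MemLp (fun x => f x * ψ x) 2 volume := by
  refine hf.mono (hf.1.mul hψ.contDiff.continuous.aestronglyMeasurable) (ae_of_all _ fun x => ?_)
  rw [norm_mul]
  exact mul_le_of_le_one_right (norm_nonneg _) (hψ.abs_le x)

/-- Bψ = q(Lψ), and p(Lψ)' is integrable: pL' is integrable with ψ bounded, while Lψ' has compact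
support. -/
theorem differentiableAt_osc_cutoff {θ : ℝ} (hθ : θ ≠ 0) :
    DifferentiableAt ℝ (osc R.p fun x => ((R.B x * ψ x : ℝ) : ℂ)) θ := by
  have hd : ∀ x, HasDerivAt ψ (deriv ψ x) x := fun x =>
    (hψ.contDiff.differentiable (by norm_num) x).hasDerivAt
  have hdc : Continuous (deriv ψ) := hψ.contDiff.continuous_deriv (by norm_num)
  have hLc : Continuous R.L := continuous_iff_continuousAt.2 fun x => (R.derivL x).continuousAt
  have hpc := R.continuous_p
  have i1 : Integrable fun x => R.L x * deriv ψ x :=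
    (hLc.mul hdc).integrable_of_hasCompactSupport hψ.compact.mul_left
  have i2 : Integrable fun x => R.p x * (R.L x * deriv ψ x) :=
    (hpc.mul (hLc.mul hdc)).integrable_of_hasCompactSupport (hψ.compact.mul_left).mul_left
  have i3 : Integrable fun x => R.L1 x * ψ x + R.L x * deriv ψ x :=
    (integrable_mul_cutoff hψ R.iL1).add i1
  have i4 : Integrable fun x => R.p x * (R.L1 x * ψ x + R.L x * deriv ψ x) :=
    ((integrable_mul_cutoff hψ R.ipL1).add i2).congr (ae_of_all _ fun x => by
      simp only [Pi.add_apply]; ring)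
  have lim : ∀ {l : Filter ℝ}, Tendsto R.L l (𝓝 0) →
      Tendsto (fun x => ((R.L x * ψ x : ℝ) : ℂ)) l (𝓝 0) := fun h => by
    have : Tendsto (fun x => R.L x * ψ x) _ (𝓝 0) :=
      squeeze_zero_norm (a := fun x => ‖R.L x‖) (fun x => by
        rw [norm_mul]; exact mul_le_of_le_one_right (norm_nonneg _) (hψ.abs_le x))
        (by simpa using h.norm)
    have h2 := (Complex.continuous_ofReal.tendsto 0).comp this
    rwa [Complex.ofReal_zero] at h2
  refine differentiableAt_osc_of_by_parts R.hp (L := fun x => ((R.L x * ψ x : ℝ) : ℂ))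
    (L1 := fun x => ((R.L1 x * ψ x + R.L x * deriv ψ x : ℝ) : ℂ)) (fun x => ?_)
    (R.integrable_B_cutoff hψ) (fun x => ((R.derivL x).mul (hd x)).ofReal_comp) i3.ofReal ?_
    (lim R.L_bot) (lim R.L_top) hθ
  · rw [R.hL]; push_cast; ring
  · exact (i4.ofReal (𝕜 := ℂ)).congr (ae_of_all _ fun x => by simp)

theorem memLp_deriv_osc_cutoff :
    MemLp (deriv (osc R.p fun x => ((R.B x * ψ x : ℝ) : ℂ))) 2 volume := by
  refine memLp_deriv_osc R.hp (R.integrable_B_cutoff hψ) ?_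
    (fun θ hθ => R.differentiableAt_osc_cutoff hψ hθ) R.hq
  refine ((memLp_mul_cutoff hψ R.pB_two).ofReal (K := ℂ)).ae_eq (ae_of_all _ fun x => ?_)
  simp [mul_assoc]

theorem norm_osc_cutoff_le (θ : ℝ) :
    ‖osc R.p (fun x => ((R.B x * ψ x : ℝ) : ℂ)) θ‖ ≤ ∫ x, |R.B x| := by
  refine (norm_osc_le _ _ _).trans (integral_mono (R.integrable_B_cutoff hψ).norm R.iB.abs
    fun x => ?_)
  simp only [Complex.norm_real, norm_mul]
  exact mul_le_of_le_one_right (norm_nonneg _) (hψ.abs_le x)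

/-- The part of the difference quotient that is linear in the coefficients. -/
theorem exists_tendsto_slope_cutoff {θ : ℝ → ℝ} {z : ℝ} (hθ : IsPhase θ) (hz : 1 < |z|) :
    ∃ l, Tendsto (fun z' : ℝ => (z' - z)⁻¹ •
        ∫ x, ((R.B x : ℂ) * (R.e (θ z') x / z') - R.B x * (R.e (θ z) x / z)) * ψ x)
        (𝓝[≠] z) (𝓝 l) ∧
      |z| * ‖l‖ ≤ ‖deriv (osc R.p fun x => ((R.B x * ψ x : ℝ) : ℂ)) (θ z)‖ +
        (∫ x, |R.B x|) / |z| := by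
  have hz0 : 0 < |z| := by linarith
  have hzn : z ≠ 0 := abs_pos.1 hz0
  have hzc : (z : ℂ) ≠ 0 := by exact_mod_cast hzn
  obtain ⟨θ1, h1, hd⟩ := hθ.exists_hasDerivAt hz.le
  set J := osc R.p fun x => ((R.B x * ψ x : ℝ) : ℂ)
  have hJ : HasDerivAt (fun z => J (θ z)) (θ1 • deriv J (θ z)) z :=
    (R.differentiableAt_osc_cutoff hψ (hθ.ne_zero hz)).hasDerivAt.scomp z hd
  have hJz := hJ.div (hasDerivAt_id z).ofReal_comp hzc
  refine ⟨_, (hasDerivAt_iff_tendsto_slope.1 hJz).congr fun z' => ?_, ?_⟩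
  · have i : ∀ z : ℝ, Integrable fun x => (R.B x : ℂ) * (R.e (θ z) x / z) * ψ x := fun z => by
      have := ((R.integrable_B_cutoff hψ).bdd_mul (c := 1)
        (R.continuous_e (θ z)).aestronglyMeasurable
        (ae_of_all _ fun x => (R.norm_e _ _).le)).div_const (z : ℂ)
      refine this.congr (ae_of_all _ fun x => ?_)
      push_cast; ring
    have e : ∀ z : ℝ, J (θ z) / z = ∫ x, (R.B x : ℂ) * (R.e (θ z) x / z) * ψ x := fun z => by
      simp only [J, osc]
      rw [← integral_div]
      congr 1 with x
      rw [Coeffs.e]; push_cast; ring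
    simp only [slope, vsub_eq_sub, Pi.div_apply, id]
    rw [e, e, ← integral_sub (i z') (i z)]
    congr 2 with x
    ring
  · have n1 : ‖θ1 • deriv J (θ z)‖ ≤ ‖deriv J (θ z)‖ := by
      rw [norm_smul, Real.norm_eq_abs]
      nlinarith [norm_nonneg (deriv J (θ z))]
    have n2 : ‖J (θ z)‖ ≤ ∫ x, |R.B x| := R.norm_osc_cutoff_le hψ _
    simp only [id, Complex.ofReal_one, mul_one]
    rw [norm_div, norm_pow, Complex.norm_real, Real.norm_eq_abs]
    have n3 : ‖θ1 • deriv J (θ z) * z - J (θ z)‖ ≤ ‖deriv J (θ z)‖ * |z| + ∫ x, |R.B x| := by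
      refine (norm_sub_le _ _).trans ?_
      rw [norm_mul, Complex.norm_real, Real.norm_eq_abs]
      gcongr
    calc |z| * (_ / |z| ^ 2) = ‖θ1 • deriv J (θ z) * z - J (θ z)‖ / |z| := by field_simp
      _ ≤ (‖deriv J (θ z)‖ * |z| + ∫ x, |R.B x|) / |z| := by gcongr
      _ = _ := by field_simp

end Cutoff

/-! ### The remainder of the amplitude -/

/-- A weight dominating the amplitudes after subtraction of their limits. -/
noncomputable def tail (x : ℝ) : ℝ :=
  (Set.Iic 0).indicator R.tailL x + (Set.Ioi 0).indicator R.tailR x +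
    -- On (0, 1] the smooth step takes intermediate values, so neither one-sided limit is a good
    -- model and only a crude bound by the total mass is used.
    (Set.Ioc 0 1).indicator (fun _ => 2 * R.mass) x

theorem continuous_tailL : Continuous R.tailL :=
  continuous_iff_continuousAt.2 fun x =>
    (hasDerivAt_integral_Iic R.continuous_ρ R.integrable_ρ x).continuousAt

theorem tailR_eq (x : ℝ) : R.tailR x = R.mass - R.tailL x := by
  have := intervalIntegral.integral_Iic_add_Ioi (b := x) R.integrable_ρ.integrableOn
    R.integrable_ρ.integrableOn
  rw [tailR, mass, tailL, ← this]
  ring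

theorem continuous_tailR : Continuous R.tailR := by
  have : R.tailR = fun x => R.mass - R.tailL x := funext R.tailR_eq
  rw [this]
  exact continuous_const.sub R.continuous_tailL

theorem tail_nonneg (x : ℝ) : 0 ≤ R.tail x := by
  have := R.mass_nonneg
  unfold tail
  refine add_nonneg (add_nonneg ?_ ?_) ?_
  · exact Set.indicator_nonneg (fun x _ => R.tailL_nonneg x) x
  · exact Set.indicator_nonneg (fun x _ => R.tailR_nonneg x) x
  · exact Set.indicator_nonneg (fun x _ => by positivity) x

/-- This is what the tail weight is for: pB alone may fail to be integrable, but becomes so after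
multiplication by the decaying tails. -/
theorem integrable_tail : Integrable fun x => (|R.p x| + 1) * |R.B x| * R.tail x := by
  have hp := R.continuous_p
  have hB := R.hB
  have bl : ∀ x, ‖R.tailL x‖ ≤ R.mass := fun x => by
    rw [Real.norm_of_nonneg (R.tailL_nonneg x)]; exact R.tailL_le_mass x
  have br : ∀ x, ‖R.tailR x‖ ≤ R.mass := fun x => by
    rw [Real.norm_of_nonneg (R.tailR_nonneg x)]; exact R.tailR_le_mass x
  have h1 : IntegrableOn (fun x => (|R.p x| + 1) * |R.B x| * R.tailL x) (Set.Iic 0) := by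
    have := R.tail_neg.abs.add (R.iB.abs.mul_bdd (c := R.mass)
      R.continuous_tailL.aestronglyMeasurable (ae_of_all _ bl)).integrableOn
    refine this.congr (ae_of_all _ fun x => ?_)
    simp only [Pi.add_apply]
    rw [abs_mul, abs_mul, ← tailL, abs_of_nonneg (R.tailL_nonneg x)]
    ring
  have h2 : IntegrableOn (fun x => (|R.p x| + 1) * |R.B x| * R.tailR x) (Set.Ioi 0) := by
    have := R.tail_pos.abs.add (R.iB.abs.mul_bdd (c := R.mass)
      R.continuous_tailR.aestronglyMeasurable (ae_of_all _ br)).integrableOn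
    refine this.congr (ae_of_all _ fun x => ?_)
    simp only [Pi.add_apply]
    rw [abs_mul, abs_mul, ← tailR, abs_of_nonneg (R.tailR_nonneg x)]
    ring
  have h3 : IntegrableOn (fun x => (|R.p x| + 1) * |R.B x| * (2 * R.mass)) (Set.Ioc 0 1) :=
    ((by fun_prop : Continuous fun x => (|R.p x| + 1) * |R.B x| * (2 * R.mass)).integrableOn_Icc
      (a := 0) (b := 1)).mono_set Set.Ioc_subset_Icc_self
  refine (((integrable_indicator_iff measurableSet_Iic).2 h1).add
    ((integrable_indicator_iff measurableSet_Ioi).2 h2)).add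
    ((integrable_indicator_iff measurableSet_Ioc).2 h3) |>.congr (ae_of_all _ fun x => ?_)
  simp only [Pi.add_apply, tail, mul_add, Set.indicator_apply, mul_ite, mul_zero]

section Amplitude

variable {R} {C z z' : ℝ} {w1 w2 v1 v2 : ℝ → ℂ} {a b a' b' : ℂ}

/-- Splitting a product of two functions converging at both ends. -/
theorem norm_amplitude_le {f g : ℝ → ℂ} {l r l' r' : ℂ} {κ κ' M M' : ℝ}
    (hκ : 0 ≤ κ) (hκ' : 0 ≤ κ')
    (hf : ∀ x, ‖f x‖ ≤ M) (hr : ‖r‖ ≤ M) (hr' : ‖r'‖ ≤ M') (hl' : ‖l'‖ ≤ M')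
    (hfl : ∀ x, ‖f x - l‖ ≤ κ * R.tailL x) (hfr : ∀ x, ‖f x - r‖ ≤ κ * R.tailR x)
    (hgl : ∀ x, ‖g x - l'‖ ≤ κ' * R.tailL x) (hgr : ∀ x, ‖g x - r'‖ ≤ κ' * R.tailR x) (x : ℝ) :
    ‖f x * g x - l * l' - (r * r' - l * l') * Real.smoothTransition x‖ ≤
      (M * κ' + κ * M') * R.tail x := by
  have hM : 0 ≤ M := (norm_nonneg _).trans hr
  -- Telescoping pairs each difference with a size bound of the other factor, so decay in z may come
  -- from either: from κ, κ' for w₁ and from M, M' for w₂.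
  have prod : ∀ {c m d m' : ℂ} {t : ℝ}, ‖c‖ ≤ M → ‖m'‖ ≤ M' → ‖c - m‖ ≤ κ * t →
      ‖d - m'‖ ≤ κ' * t → ‖c * d - m * m'‖ ≤ (M * κ' + κ * M') * t := fun {c m d m' t} hc h0 h1 h2 => by
    have : c * d - m * m' = c * (d - m') + (c - m) * m' := by ring
    rw [this]
    refine (norm_add_le _ _).trans ?_
    rw [norm_mul, norm_mul]
    have e1 : ‖c‖ * ‖d - m'‖ ≤ M * (κ' * t) := mul_le_mul hc h2 (norm_nonneg _) hM
    have e2 : ‖c - m‖ * ‖m'‖ ≤ (κ * t) * M' :=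
      mul_le_mul h1 h0 (norm_nonneg _) ((norm_nonneg _).trans h1)
    linarith
  have split : ∀ {f : ℝ → ℂ} {l r : ℂ} {κ : ℝ}, (∀ x, ‖f x - l‖ ≤ κ * R.tailL x) →
      (∀ x, ‖f x - r‖ ≤ κ * R.tailR x) → ‖r - l‖ ≤ κ * R.mass := fun {f l r κ} h1 h2 => by
    have e := norm_sub_le_norm_sub_add_norm_sub r (f 0) l
    have := h1 0
    have := h2 0
    rw [R.tailR_eq] at this
    rw [norm_sub_rev r (f 0)] at e
    linarith
  rcases le_or_gt x 0 with hx | hx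
  · have ht : R.tail x = R.tailL x := by
      simp [tail, hx, hx.not_gt]
    rw [ht, Real.smoothTransition.zero_of_nonpos hx]
    simpa using prod (hf x) hl' (hfl x) (hgl x)
  · rcases le_or_gt x 1 with hx1 | hx1
    · have ht : R.tail x = R.tailR x + 2 * R.mass := by
        simp [tail, hx, hx1, hx.not_ge]
      have hs := Real.smoothTransition.le_one x
      have hs0 := Real.smoothTransition.nonneg x
      have p1 := prod (hf x) hl' (hfl x) (hgl x)
      -- In the transition zone the distance between the two limits is also at most one mass, which
      -- with the mass bounding `tailL` explains the 2 in `tail`.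
      have p2 := prod hr hl' (split hfl hfr) (split hgl hgr)
      have p3 : ‖(r * r' - l * l') * (Real.smoothTransition x : ℂ)‖ ≤ ‖r * r' - l * l'‖ := by
        rw [norm_mul, Complex.norm_real, Real.norm_of_nonneg hs0]
        exact mul_le_of_le_one_right (norm_nonneg _) hs
      have hM' : 0 ≤ M' := (norm_nonneg _).trans hr'
      have hc : 0 ≤ M * κ' + κ * M' := by positivity
      refine (norm_sub_le _ _).trans ?_
      rw [ht]
      have t1 := mul_le_mul_of_nonneg_left (R.tailL_le_mass x) hc
      have t2 := mul_nonneg hc (R.tailR_nonneg x)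
      linarith
    · have ht : R.tail x = R.tailR x := by
        simp [tail, hx, hx1.not_ge, hx.not_ge]
      rw [ht, Real.smoothTransition.one_of_one_le hx1.le]
      have := prod (hf x) hr' (hfr x) (hgr x)
      convert this using 2
      push_cast; ring

end Amplitude

end RegularCoeffs

/-! ### Difference quotients in z for each of the coefficients G, B and A -/

namespace RegularCoeffs

open Coeffs

variable {R : RegularCoeffs} {θ : ℝ → ℝ} {z : ℝ}

theorem eventually_one_le_abs (hz : 1 < |z|) : ∀ᶠ z' in 𝓝 z, 1 ≤ |z'| := by
  filter_upwards [continuous_abs.continuousAt.eventually (lt_mem_nhds hz)] with z' h using le_of_lt h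

/-- The part of the difference quotient with the coefficient `G`. -/
theorem exists_tendsto_slope_G (hθ : IsPhase θ) (hz : 1 < |z|) {V : ℝ → ℝ → ℂ}
    (hVc : ∀ z ≠ 0, Continuous (V z)) (hV : ∀ x, ContinuousAt (fun z => V z x) z)
    (hV1 : ∀ z' ≠ 0, ∀ x, ‖V z' x‖ ≤ 1) :
    ∃ θ1 : ℝ, |θ1| ≤ 1 / 2 ∧ Tendsto (fun z' : ℝ => (z' - z)⁻¹ •
        ∫ x, (R.e (θ z') x * R.G x - R.e (θ z) x * R.G x) * V z' x) (𝓝[≠] z)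
      (𝓝 (2 * Complex.I * θ1 * ∫ x, R.e (θ z) x * (R.p x * R.G x : ℝ) * V z x)) := by
  obtain ⟨θ1, h1, hd⟩ := hθ.exists_hasDerivAt hz.le
  refine ⟨θ1, h1, ?_⟩
  have hG := R.hG
  have key := tendsto_slope_integral (g := fun z x => R.e (θ z) x * R.G x) (V := V)
    (g1 := fun x => 2 * Complex.I * θ1 * (R.p x * R.e (θ z) x) * R.G x) (z := z)
    (fun x => (R.hasDerivAt_e_comp hd x).mul_const _) hV (bd := fun x => |R.p x * R.G x|)
    R.ipG.abs ?_ ?_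
  · convert key using 2
    rw [← integral_const_mul]
    congr 1 with x
    push_cast; ring
  · filter_upwards [eventually_one_le_abs hz] with z' hz'
    have h0 : z' ≠ 0 := abs_pos.1 (by linarith)
    have e1 := R.continuous_e (θ z')
    have e2 := R.continuous_e (θ z)
    have e3 := hVc z' h0
    exact (by fun_prop : Continuous fun x =>
      (R.e (θ z') x * R.G x - R.e (θ z) x * R.G x) * V z' x).aestronglyMeasurable
  · filter_upwards [eventually_one_le_abs hz] with z' hz' x
    have h0 : z' ≠ 0 := abs_pos.1 (by linarith)
    rw [← sub_mul, norm_mul, norm_mul, Complex.norm_real, Real.norm_eq_abs, abs_mul]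
    calc _ ≤ |z' - z| * |R.p x| * |R.G x| * 1 := by
          gcongr
          · exact R.norm_e_comp_sub_le hθ hz.le hz' x
          · exact hV1 z' h0 x
      _ = _ := by ring

/-- The part of the difference quotient with the coefficient `B`. -/
theorem exists_tendsto_slope_B (hθ : IsPhase θ) (hz : 1 < |z|) {V : ℝ → ℝ → ℂ} {c0 : ℂ}
    {c : ℝ → ℂ} (hVc : ∀ z ≠ 0, Continuous (V z)) (hV : ∀ x, ContinuousAt (fun z => V z x) z)
    (hc : ContinuousAt c z) {κ : ℝ} (hκ : 0 ≤ κ)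
    (hrem : ∀ z', 1 ≤ |z'| → ∀ x, ‖V z' x - c0 - c z' * Real.smoothTransition x‖ ≤
      κ * (1 / |z| + 1 / |z'|) * R.tail x) :
    ∃ l, Tendsto (fun z' : ℝ => (z' - z)⁻¹ •
        ∫ x, ((R.B x : ℂ) * (R.e (θ z') x / z') - R.B x * (R.e (θ z) x / z)) * V z' x)
        (𝓝[≠] z) (𝓝 l) ∧
      |z| * ‖l‖ ≤ ‖c0‖ * (‖deriv (osc R.p fun x => ((R.B x * 1 : ℝ) : ℂ)) (θ z)‖ +
          (∫ x, |R.B x|) / |z|) +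
        ‖c z‖ * (‖deriv (osc R.p fun x => ((R.B x * Real.smoothTransition x : ℝ) : ℂ)) (θ z)‖ +
          (∫ x, |R.B x|) / |z|) +
        2 * κ * (∫ x, (|R.p x| + 1) * |R.B x| * R.tail x) / |z| := by
  have hz0 : 0 < |z| := by linarith
  have hzn : z ≠ 0 := abs_pos.1 hz0
  have hB := R.hB
  have hs : Continuous Real.smoothTransition := isCutoff_smoothTransition.contDiff.continuous
  obtain ⟨θ1, h1, hd⟩ := hθ.exists_hasDerivAt hz.le
  obtain ⟨l1, t1, b1⟩ := R.exists_tendsto_slope_cutoff isCutoff_one hθ hz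
  obtain ⟨l2, t2, b2⟩ := R.exists_tendsto_slope_cutoff isCutoff_smoothTransition hθ hz
  set g : ℝ → ℝ → ℂ := fun z x => (R.B x : ℂ) * (R.e (θ z) x / z)
  -- The constant and the step are handled by the L² theory of oscillatory integrals; only this
  -- remainder is treated by dominated convergence. The coefficient c may vary with z' and need only
  -- be continuous.
  set r : ℝ → ℝ → ℂ := fun z' x => V z' x - c0 - c z' * Real.smoothTransition x
  set g1 : ℝ → ℂ := fun x =>
    R.B x * (2 * Complex.I * θ1 * (R.p x * R.e (θ z) x) / z - R.e (θ z) x / z ^ 2)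
  have hgc : ∀ z, Continuous (g z) := fun z => by
    have := R.continuous_e (θ z)
    fun_prop
  have hrc : ∀ z ≠ 0, Continuous (r z) := fun z hz => by
    have := hVc z hz
    fun_prop
  -- A bound independent of z' suffices for domination; the gain 2κ/|z| is recovered at the limit z'
  -- = z in `b3`.
  have hκ2 : ∀ z', 1 ≤ |z'| → κ * (1 / |z| + 1 / |z'|) ≤ 2 * κ := fun z' hz' => by
    have y1 : 1 / |z| ≤ 1 := div_le_one_of_le₀ hz.le (abs_nonneg _)
    have y2 : 1 / |z'| ≤ 1 := div_le_one_of_le₀ hz' (abs_nonneg _)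
    nlinarith
  have hgr : ∀ z', 1 ≤ |z'| → ∀ x, ‖(g z' x - g z x) * r z' x‖ ≤
      |z' - z| * (2 * κ * ((|R.p x| + 1) * |R.B x| * R.tail x)) := fun z' hz' x => by
    simp only [g, r]
    rw [← mul_sub, norm_mul, norm_mul, Complex.norm_real, Real.norm_eq_abs]
    calc _ ≤ |R.B x| * (|z' - z| * (|R.p x| + 1)) * (2 * κ * R.tail x) := by
          refine mul_le_mul ?_ ((hrem z' hz' x).trans ?_) (norm_nonneg _) (by positivity)
          · gcongr
            exact R.norm_e_div_sub_le hθ hz.le hz' x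
          · exact mul_le_mul_of_nonneg_right (hκ2 z' hz') (R.tail_nonneg x)
      _ = _ := by ring
  have t3 := tendsto_slope_integral (g := g) (V := r) (g1 := g1) (z := z)
    (fun x => (R.hasDerivAt_e_div hd hzn x).const_mul _)
    (fun x => ((hV x).sub continuousAt_const).sub (hc.mul continuousAt_const))
    (R.integrable_tail.const_mul (2 * κ)) (by
      filter_upwards [eventually_one_le_abs hz] with z' hz'
      have h0 : z' ≠ 0 := abs_pos.1 (by linarith)
      exact (((hgc z').sub (hgc z)).mul (hrc z' h0)).aestronglyMeasurable) (by
      filter_upwards [eventually_one_le_abs hz] with z' hz' using hgr z' hz')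
  refine ⟨c0 * l1 + c z * l2 + ∫ x, g1 x * r z x, ?_, ?_⟩
  · have ct : Tendsto c (𝓝[≠] z) (𝓝 (c z)) := hc.tendsto.mono_left nhdsWithin_le_nhds
    refine (((t1.const_mul c0).add (ct.mul t2)).add t3).congr' ?_
    filter_upwards [nhdsWithin_le_nhds (eventually_one_le_abs hz)] with z' hz'
    have h0 : z' ≠ 0 := abs_pos.1 (by linarith)
    have i0 : ∀ z, Integrable (g z) := fun z => by
      refine (R.iB.ofReal (𝕜 := ℂ)).mul_bdd (c := 1 / |z|) (by
        have := R.continuous_e (θ z)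
        exact (by fun_prop : Continuous fun x => R.e (θ z) x / z).aestronglyMeasurable)
        (ae_of_all _ fun x => ?_)
      rw [norm_div, norm_e, Complex.norm_real, Real.norm_eq_abs]
    have i1 : Integrable fun x => (g z' x - g z x) * ((1 : ℝ) : ℂ) := by
      simp only [Complex.ofReal_one, mul_one]
      exact (i0 z').sub (i0 z)
    have i2 : Integrable fun x => (g z' x - g z x) * (Real.smoothTransition x : ℂ) := by
      refine ((i0 z').sub (i0 z)).mul_bdd (c := 1) (by fun_prop) (ae_of_all _ fun x => ?_)
      rw [Complex.norm_real]
      exact isCutoff_smoothTransition.abs_le x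
    have i3 : Integrable fun x => (g z' x - g z x) * r z' x :=
      ((R.integrable_tail.const_mul (2 * κ)).const_mul |z' - z|).mono'
        (((hgc z').sub (hgc z)).mul (hrc z' h0)).aestronglyMeasurable (ae_of_all _ (hgr z' hz'))
    have i1' := i1.const_mul c0
    have i2' := i2.const_mul (c z')
    have i12 : Integrable fun x => c0 * ((g z' x - g z x) * ((1 : ℝ) : ℂ)) +
      c z' * ((g z' x - g z x) * (Real.smoothTransition x : ℂ)) := i1'.add i2'
    have e : ∫ x, (g z' x - g z x) * V z' x = c0 * (∫ x, (g z' x - g z x) * ((1 : ℝ) : ℂ)) +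
        c z' * (∫ x, (g z' x - g z x) * (Real.smoothTransition x : ℂ)) +
        ∫ x, (g z' x - g z x) * r z' x := by
      rw [← integral_const_mul, ← integral_const_mul, ← integral_add i1' i2',
        ← integral_add i12 i3]
      congr 1 with x
      simp only [r]; push_cast; ring
    rw [e, smul_add, smul_add, mul_smul_comm, mul_smul_comm]
  · have b3 : |z| * ‖∫ x, g1 x * r z x‖ ≤
        2 * κ * (∫ x, (|R.p x| + 1) * |R.B x| * R.tail x) / |z| := by
      have : ‖∫ x, g1 x * r z x‖ ≤
          ∫ x, 2 * κ / |z| ^ 2 * ((|R.p x| + 1) * |R.B x| * R.tail x) := by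
        refine norm_integral_le_of_norm_le (R.integrable_tail.const_mul _)
          (ae_of_all _ fun x => ?_)
        simp only [g1]
        rw [norm_mul, norm_mul, Complex.norm_real, Real.norm_eq_abs]
        calc _ ≤ |R.B x| * ((|R.p x| + 1) / |z|) * (κ * (1 / |z| + 1 / |z|) * R.tail x) :=
              mul_le_mul (by gcongr; exact R.norm_deriv_e_div_le h1 hz.le x) (hrem z hz.le x)
                (norm_nonneg _) (by positivity)
          _ = _ := by ring
      rw [integral_const_mul] at this
      calc _ ≤ |z| * (2 * κ / |z| ^ 2 * ∫ x, (|R.p x| + 1) * |R.B x| * R.tail x) := by gcongr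
        _ = _ := by field_simp
    calc |z| * ‖c0 * l1 + c z * l2 + ∫ x, g1 x * r z x‖
        ≤ |z| * (‖c0‖ * ‖l1‖ + ‖c z‖ * ‖l2‖ + ‖∫ x, g1 x * r z x‖) := by
          gcongr
          refine (norm_add_le _ _).trans (add_le_add ((norm_add_le _ _).trans ?_) le_rfl)
          rw [norm_mul, norm_mul]
      _ = ‖c0‖ * (|z| * ‖l1‖) + ‖c z‖ * (|z| * ‖l2‖) + |z| * ‖∫ x, g1 x * r z x‖ := by ring
      _ ≤ _ := by gcongr

/-- The part of the difference quotient with the coefficient `A`. -/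
theorem tendsto_slope_A (hz : 1 < |z|) {V : ℝ → ℝ → ℂ}
    (hVc : ∀ z ≠ 0, Continuous (V z)) (hV : ∀ x, ContinuousAt (fun z => V z x) z)
    (hV1 : ∀ z' ≠ 0, ∀ x, ‖V z' x‖ ≤ 2) :
    Tendsto (fun z' : ℝ => (z' - z)⁻¹ • ∫ x, ((R.A x : ℂ) / z' - R.A x / z) * V z' x) (𝓝[≠] z)
      (𝓝 (∫ x, -(R.A x : ℂ) / z ^ 2 * V z x)) := by
  have hzn : z ≠ 0 := abs_pos.1 (by linarith)
  have hzc : (z : ℂ) ≠ 0 := by exact_mod_cast hzn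
  have hA := R.hA
  refine tendsto_slope_integral (g := fun z x => (R.A x : ℂ) / z) (V := V) (z := z)
    (fun x => ?_) hV (bd := fun x => |R.A x| * 2) (R.iA.abs.mul_const 2) ?_ ?_
  · refine ((hasDerivAt_const z (R.A x : ℂ)).div (hasDerivAt_id z).ofReal_comp hzc).congr_deriv ?_
    simp
  · filter_upwards [eventually_one_le_abs hz] with z' hz'
    have h0 : z' ≠ 0 := abs_pos.1 (by linarith)
    have e3 := hVc z' h0
    exact (by fun_prop : Continuous fun x =>
      ((R.A x : ℂ) / z' - R.A x / z) * V z' x).aestronglyMeasurable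
  · filter_upwards [eventually_one_le_abs hz] with z' hz' x
    have h0 : z' ≠ 0 := abs_pos.1 (by linarith)
    have e : (R.A x : ℂ) / z' - R.A x / z = R.A x * ((z'⁻¹ - z⁻¹ : ℝ) : ℂ) := by push_cast; ring
    rw [e, norm_mul, norm_mul, Complex.norm_real, Complex.norm_real, Real.norm_eq_abs,
      Real.norm_eq_abs]
    have t := mul_le_mul (mul_le_mul_of_nonneg_left (abs_inv_sub_le hz.le hz')
      (abs_nonneg (R.A x))) (hV1 z' h0 x) (norm_nonneg _) (by positivity)
    linarith

end RegularCoeffs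

/-! ### The spectral derivative of the scattering data -/

namespace RegularCoeffs

open Coeffs

variable (R : RegularCoeffs)

/-- The square-integrable function of the frequency controlling the scattering data. -/
noncomputable def spectralBound (θ : ℝ) : ℝ :=
  ‖osc R.p (fun x => (R.B x : ℂ)) θ‖ + ‖osc R.p (fun x => (R.K1 x : ℂ)) θ‖ +
    ‖osc R.p (fun x => (R.K2 x : ℂ)) θ‖ +
    ‖deriv (osc R.p fun x => ((R.B x * 1 : ℝ) : ℂ)) θ‖ +
    ‖deriv (osc R.p fun x => ((R.B x * Real.smoothTransition x : ℝ) : ℂ)) θ‖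

theorem spectralBound_nonneg (θ : ℝ) : 0 ≤ R.spectralBound θ := by
  unfold spectralBound; positivity

theorem memLp_spectralBound : MemLp R.spectralBound 2 volume := by
  have h1 := (memLp_osc R.hp R.hq R.iB.ofReal (R.B_two.ofReal (K := ℂ))).norm
  have h2 := (memLp_osc R.hp R.hq R.iK1.ofReal (R.K1_two.ofReal (K := ℂ))).norm
  have h3 := (memLp_osc R.hp R.hq R.iK2.ofReal (R.K2_two.ofReal (K := ℂ))).norm
  exact (((h1.add h2).add h3).add (R.memLp_deriv_osc_cutoff isCutoff_one).norm).add
    (R.memLp_deriv_osc_cutoff isCutoff_smoothTransition).norm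

variable {R}

/-- The integral against `w1²` for all `|z| > 1`. -/
theorem exists_norm_mul_integral_pG_le {C : ℝ} (hC : 1 ≤ C) :
    ∃ C', 0 ≤ C' ∧ ∀ {z : ℝ} {w1 w2 : ℝ → ℂ} {a b : ℂ}, 1 < |z| →
      R.IsJostPair z w1 w2 a b → JostBounds R C z w1 w2 a b →
      |z| * ‖∫ x, R.e (-freq z) x * (R.p x * R.G x : ℝ) * (w1 x * w1 x)‖ ≤
        3 * R.spectralBound (-freq z) + C' / |z| := by
  have hm := R.mass_nonneg
  have hK : 0 ≤ ∫ x, |R.K2 x| := integral_nonneg fun x => abs_nonneg _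
  have hG : 0 ≤ ∫ x, |R.p x * R.G x| := integral_nonneg fun x => abs_nonneg _
  refine ⟨C * (6 * (R.mass * ∫ x, |R.K2 x|) + 6 * ((∫ x, |R.K2 x|) * R.mass)) +
    4 * ∫ x, |R.p x * R.G x|, by positivity, fun {z w1 w2 a b} hz h hB => ?_⟩
  have hz0 : 0 < |z| := by linarith
  have hs : ‖osc R.p (fun x => (R.K2 x : ℂ)) (-freq z)‖ ≤ R.spectralBound (-freq z) := by
    have h1 := norm_nonneg (osc R.p (fun x => (R.B x : ℂ)) (-freq z))
    have h2 := norm_nonneg (osc R.p (fun x => (R.K1 x : ℂ)) (-freq z))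
    have h3 := norm_nonneg (deriv (osc R.p fun x => ((R.B x * 1 : ℝ) : ℂ)) (-freq z))
    have h4 := norm_nonneg (deriv (osc R.p fun x =>
      ((R.B x * Real.smoothTransition x : ℝ) : ℂ)) (-freq z))
    unfold spectralBound
    linarith
  rw [add_div]
  rcases le_or_gt 2 |z| with h2 | h2
  · have := norm_mul_integral_pG_le hC h2 h hB
    have e : 0 ≤ (4 * ∫ x, |R.p x * R.G x|) / |z| := by positivity
    linarith
  · have e : 0 ≤ C * (6 * (R.mass * ∫ x, |R.K2 x|) + 6 * ((∫ x, |R.K2 x|) * R.mass)) / |z| := by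
      positivity
    have e1 := norm_integral_e_mul_le (D := R.toCoeffs) R.ipG (V := fun x => w1 x * w1 x) (C := 1)
      (fun x => by
        rw [norm_mul]
        exact mul_le_one₀ (h.norm_left_le x) (norm_nonneg _) (h.norm_left_le x)) (-freq z)
    -- For 1 < |z| < 2 the frequency may be near 0 and integration by parts gains nothing; here |z|²
    -- ≤ 4 makes the trivial bound good enough.
    have e2 : |z| * ∫ x, |R.p x * R.G x| ≤ (4 * ∫ x, |R.p x * R.G x|) / |z| := by
      rw [le_div_iff₀ hz0]
      have : |z| * |z| ≤ 4 := by nlinarith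
      nlinarith
    have e3 := mul_le_mul_of_nonneg_left e1 hz0.le
    have := R.spectralBound_nonneg (-freq z)
    linarith

section Derivative

variable (W : R.JostFamily) {C : ℝ} {z : ℝ}

/-- The amplitude w₁² does not decay in z, so the factor 1/z must come from integrating by parts in
the limiting integral. -/
theorem exists_slope_G_left (hC : 1 ≤ C)
    (hB : ∀ z, 1 ≤ |z| → JostBounds R C z (W.w1 z) (W.w2 z) (W.a z) (W.b z)) :
    ∃ C', 0 ≤ C' ∧ ∀ z, 1 < |z| → ∃ l, Tendsto (fun z' : ℝ => (z' - z)⁻¹ •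
      ∫ x, (R.e (-freq z') x * R.G x - R.e (-freq z) x * R.G x) * (W.w1 z x * W.w1 z' x))
      (𝓝[≠] z) (𝓝 l) ∧ |z| * ‖l‖ ≤ 3 * R.spectralBound (-freq z) + C' / |z| := by
  obtain ⟨C', hC', h⟩ := exists_norm_mul_integral_pG_le (R := R) hC
  refine ⟨C', hC', fun z hz => ?_⟩
  have hzn : z ≠ 0 := abs_pos.1 (by linarith)
  have hj := W.jost z hzn
  obtain ⟨θ1, h1, ht⟩ := exists_tendsto_slope_G (R := R) (θ := fun z => -freq z) (Or.inr rfl) hz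
    (V := fun z' x => W.w1 z x * W.w1 z' x)
    (fun z' hz' => hj.sol.continuous_left.mul (W.jost z' hz').sol.continuous_left)
    (fun x => continuousAt_const.mul (W.continuousAt_w1 hzn x))
    (fun z' hz' x => by
      rw [norm_mul]
      exact mul_le_one₀ (hj.norm_left_le x) (norm_nonneg _) ((W.jost z' hz').norm_left_le x))
  refine ⟨_, ht, le_trans ?_ (h hz hj (hB z hz.le))⟩
  gcongr
  rw [norm_mul]
  refine mul_le_of_le_one_left (norm_nonneg _) ?_
  rw [norm_mul, norm_mul, Complex.norm_I, Complex.norm_real, Complex.norm_ofNat, Real.norm_eq_abs]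
  linarith

/-- No integration by parts is needed: w₂² is already O(1/z²). -/
theorem exists_slope_G_right
    (hB : ∀ z, 1 ≤ |z| → JostBounds R C z (W.w1 z) (W.w2 z) (W.a z) (W.b z)) (hz : 1 < |z|) :
    ∃ l, Tendsto (fun z' : ℝ => (z' - z)⁻¹ •
      ∫ x, (R.e (freq z') x * R.G x - R.e (freq z) x * R.G x) * (W.w2 z x * W.w2 z' x))
      (𝓝[≠] z) (𝓝 l) ∧ |z| * ‖l‖ ≤ C ^ 2 * (∫ x, |R.p x * R.G x|) / |z| := by
  have hz0 : 0 < |z| := by linarith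
  have hzn : z ≠ 0 := abs_pos.1 hz0
  have hj := W.jost z hzn
  obtain ⟨θ1, h1, ht⟩ := exists_tendsto_slope_G (R := R) (θ := freq) (Or.inl rfl) hz
    (V := fun z' x => W.w2 z x * W.w2 z' x)
    (fun z' hz' => hj.sol.continuous_right.mul (W.jost z' hz').sol.continuous_right)
    (fun x => continuousAt_const.mul (W.continuousAt_w2 hzn x))
    (fun z' hz' x => by
      rw [norm_mul]
      exact mul_le_one₀ (hj.norm_right_le x) (norm_nonneg _) ((W.jost z' hz').norm_right_le x))
  refine ⟨_, ht, ?_⟩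
  have e1 := norm_integral_e_mul_le (D := R.toCoeffs) R.ipG
    (V := fun x => W.w2 z x * W.w2 z x) (C := C / |z| * (C / |z|)) (fun x => by
      have := (hB z hz.le).right_le x
      rw [norm_mul]
      exact mul_le_mul this this (norm_nonneg _) ((norm_nonneg _).trans this)) (freq z)
  have e2 : ‖2 * Complex.I * (θ1 : ℂ)‖ ≤ 1 := by
    rw [norm_mul, norm_mul, Complex.norm_I, Complex.norm_real, Complex.norm_ofNat,
      Real.norm_eq_abs]
    linarith
  rw [norm_mul]
  calc _ ≤ |z| * (1 * (C / |z| * (C / |z|) * ∫ x, |R.p x * R.G x|)) := by gcongr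
    _ = _ := by field_simp

theorem exists_slope_A (hz : 1 < |z|) :
    ∃ l, Tendsto (fun z' : ℝ => (z' - z)⁻¹ •
      ∫ x, ((R.A x : ℂ) / z' - R.A x / z) * (W.w1 z x * W.w2 z' x + W.w2 z x * W.w1 z' x))
      (𝓝[≠] z) (𝓝 l) ∧ |z| * ‖l‖ ≤ 2 * (∫ x, |R.A x|) / |z| := by
  have hz0 : 0 < |z| := by linarith
  have hzn : z ≠ 0 := abs_pos.1 hz0
  have hj := W.jost z hzn
  have m : ∀ {c d c' d' : ℂ}, ‖c‖ ≤ 1 → ‖d‖ ≤ 1 → ‖c'‖ ≤ 1 → ‖d'‖ ≤ 1 →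
      ‖c * d + c' * d'‖ ≤ 2 := fun h1 h2 h3 h4 => by
    refine (norm_add_le _ _).trans ?_
    rw [norm_mul, norm_mul]
    have := mul_le_one₀ h1 (norm_nonneg _) h2
    have := mul_le_one₀ h3 (norm_nonneg _) h4
    linarith
  have hV : ∀ z' ≠ 0, ∀ x, ‖W.w1 z x * W.w2 z' x + W.w2 z x * W.w1 z' x‖ ≤ 2 := fun z' hz' x =>
    m (hj.norm_left_le x) ((W.jost z' hz').norm_right_le x) (hj.norm_right_le x)
      ((W.jost z' hz').norm_left_le x)
  have ht := tendsto_slope_A (R := R) hz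
    (V := fun z' x => W.w1 z x * W.w2 z' x + W.w2 z x * W.w1 z' x)
    (fun z' hz' => (hj.sol.continuous_left.mul (W.jost z' hz').sol.continuous_right).add
      (hj.sol.continuous_right.mul (W.jost z' hz').sol.continuous_left))
    (fun x => (continuousAt_const.mul (W.continuousAt_w2 hzn x)).add
      (continuousAt_const.mul (W.continuousAt_w1 hzn x))) hV
  refine ⟨_, ht, ?_⟩
  have e1 : ‖∫ x, -(R.A x : ℂ) / z ^ 2 * (W.w1 z x * W.w2 z x + W.w2 z x * W.w1 z x)‖ ≤
      ∫ x, |R.A x| * (2 / |z| ^ 2) := by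
    refine norm_integral_le_of_norm_le (R.iA.abs.mul_const _) (ae_of_all _ fun x => ?_)
    rw [norm_mul, norm_div, norm_neg, Complex.norm_real, norm_pow, Complex.norm_real,
      Real.norm_eq_abs, Real.norm_eq_abs]
    calc _ ≤ |R.A x| / |z| ^ 2 * 2 := by gcongr; exact hV z hzn x
      _ = _ := by ring
  rw [integral_mul_const] at e1
  calc _ ≤ |z| * ((∫ x, |R.A x|) * (2 / |z| ^ 2)) := by gcongr
    _ = _ := by field_simp

/-- The amplitude w₁(z)w₁(z') goes from 1 to a(z)a(z'), which fixes `c0` and `c`; the tail bounds of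
w₁ − 1 and w₁ − a supply the decay of the remainder. -/
theorem exists_slope_B_left (hC : 1 ≤ C)
    (hB : ∀ z, 1 ≤ |z| → JostBounds R C z (W.w1 z) (W.w2 z) (W.a z) (W.b z)) (hz : 1 < |z|) :
    ∃ l, Tendsto (fun z' : ℝ => (z' - z)⁻¹ •
      ∫ x, ((R.B x : ℂ) * (R.e (-freq z') x / z') - R.B x * (R.e (-freq z) x / z)) *
        (W.w1 z x * W.w1 z' x)) (𝓝[≠] z) (𝓝 l) ∧
      |z| * ‖l‖ ≤ 3 * R.spectralBound (-freq z) + (3 * (∫ x, |R.B x|) +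
        2 * C * (∫ x, (|R.p x| + 1) * |R.B x| * R.tail x)) / |z| := by
  have hz0 : 0 < |z| := by linarith
  have hzn : z ≠ 0 := abs_pos.1 hz0
  have hj := W.jost z hzn
  obtain ⟨l, ht, hl⟩ := exists_tendsto_slope_B (R := R) (θ := fun z => -freq z) (Or.inr rfl) hz
    (V := fun z' x => W.w1 z x * W.w1 z' x) (c0 := 1) (c := fun z' => W.a z * W.a z' - 1)
    (fun z' hz' => hj.sol.continuous_left.mul (W.jost z' hz').sol.continuous_left)
    (fun x => continuousAt_const.mul (W.continuousAt_w1 hzn x))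
    ((continuousAt_const.mul (W.continuousAt_a hzn)).sub continuousAt_const)
    (κ := C) (by linarith) (fun z' hz' x => by
      have h0 : z' ≠ 0 := abs_pos.1 (by linarith)
      have hj' := W.jost z' h0
      have := norm_amplitude_le (R := R) (κ := C / |z|) (κ' := C / |z'|) (M := 1) (M' := 1)
        (by positivity) (by positivity) hj.norm_left_le hj.norm_a_le hj'.norm_a_le
        norm_one.le (hB z hz.le).left_tailL (hB z hz.le).left_tailR (hB z' hz').left_tailL
        (hB z' hz').left_tailR x
      rw [mul_one] at this
      refine this.trans (le_of_eq ?_)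
      ring)
  refine ⟨l, ht, hl.trans ?_⟩
  have hc : ‖W.a z * W.a z - 1‖ ≤ 2 := by
    refine (norm_sub_le _ _).trans ?_
    rw [norm_mul, norm_one]
    have := mul_le_one₀ hj.norm_a_le (norm_nonneg _) hj.norm_a_le
    linarith
  have h1 := norm_nonneg (osc R.p (fun x => (R.B x : ℂ)) (-freq z))
  have h2 := norm_nonneg (osc R.p (fun x => (R.K1 x : ℂ)) (-freq z))
  have h3 := norm_nonneg (osc R.p (fun x => (R.K2 x : ℂ)) (-freq z))
  have hI : 0 ≤ (∫ x, |R.B x|) / |z| := div_nonneg (integral_nonneg fun x => abs_nonneg _) hz0.le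
  set d1 := ‖deriv (osc R.p fun x => ((R.B x * 1 : ℝ) : ℂ)) (-freq z)‖ with hd1
  set d2 := ‖deriv (osc R.p fun x =>
    ((R.B x * Real.smoothTransition x : ℝ) : ℂ)) (-freq z)‖ with hd2
  have hd1' : 0 ≤ d1 := norm_nonneg _
  have hd2' : 0 ≤ d2 := norm_nonneg _
  have e := mul_le_mul_of_nonneg_right hc (add_nonneg hd2' hI)
  have hs : d1 + d2 ≤ R.spectralBound (-freq z) := by
    unfold spectralBound
    linarith
  rw [norm_one, one_mul, add_div, mul_div_assoc 3]
  linarith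

/-- The amplitude w₂(z)w₂(z') goes from 0 to b(z)b(z'). In the remainder one factor contributes a
tail and the other its O(1/z) bound, which is the source of κ = 2C. -/
theorem exists_slope_B_right (hC : 1 ≤ C)
    (hB : ∀ z, 1 ≤ |z| → JostBounds R C z (W.w1 z) (W.w2 z) (W.a z) (W.b z)) (hz : 1 < |z|) :
    ∃ l, Tendsto (fun z' : ℝ => (z' - z)⁻¹ •
      ∫ x, ((R.B x : ℂ) * (R.e (freq z') x / z') - R.B x * (R.e (freq z) x / z)) *
        (W.w2 z x * W.w2 z' x)) (𝓝[≠] z) (𝓝 l) ∧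
      |z| * ‖l‖ ≤ R.spectralBound (freq z) + ((∫ x, |R.B x|) +
        4 * C * (∫ x, (|R.p x| + 1) * |R.B x| * R.tail x)) / |z| := by
  have hz0 : 0 < |z| := by linarith
  have hzn : z ≠ 0 := abs_pos.1 hz0
  have hj := W.jost z hzn
  obtain ⟨l, ht, hl⟩ := exists_tendsto_slope_B (R := R) (θ := freq) (Or.inl rfl) hz
    (V := fun z' x => W.w2 z x * W.w2 z' x) (c0 := 0) (c := fun z' => W.b z * W.b z')
    (fun z' hz' => hj.sol.continuous_right.mul (W.jost z' hz').sol.continuous_right)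
    (fun x => continuousAt_const.mul (W.continuousAt_w2 hzn x))
    (continuousAt_const.mul (W.continuousAt_b hzn))
    (κ := 2 * C) (by linarith) (fun z' hz' x => by
      have h0 : z' ≠ 0 := abs_pos.1 (by linarith)
      have := norm_amplitude_le (R := R) (f := W.w2 z) (g := W.w2 z') (l := 0) (l' := 0)
        (r := W.b z) (r' := W.b z') (κ := 2) (κ' := 2) (M := C / |z|)
        (M' := C / |z'|) (by norm_num) (by norm_num) (hB z hz.le).right_le (hB z hz.le).b_le
        (hB z' hz').b_le (by rw [norm_zero]; positivity)
        (by simpa using (hB z hz.le).right_tailL) (hB z hz.le).right_tailR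
        (by simpa using (hB z' hz').right_tailL) (hB z' hz').right_tailR x
      rw [mul_zero, sub_zero, sub_zero] at this
      rw [sub_zero]
      refine this.trans (le_of_eq ?_)
      ring)
  refine ⟨l, ht, hl.trans ?_⟩
  have hc : ‖W.b z * W.b z‖ ≤ 1 := by
    rw [norm_mul]
    exact mul_le_one₀ hj.norm_b_le (norm_nonneg _) hj.norm_b_le
  have h1 := norm_nonneg (osc R.p (fun x => (R.B x : ℂ)) (freq z))
  have h2 := norm_nonneg (osc R.p (fun x => (R.K1 x : ℂ)) (freq z))
  have h3 := norm_nonneg (osc R.p (fun x => (R.K2 x : ℂ)) (freq z))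
  have hI : 0 ≤ (∫ x, |R.B x|) / |z| := div_nonneg (integral_nonneg fun x => abs_nonneg _) hz0.le
  have hd1 := norm_nonneg (deriv (osc R.p fun x => ((R.B x * 1 : ℝ) : ℂ)) (freq z))
  set d2 := ‖deriv (osc R.p fun x =>
    ((R.B x * Real.smoothTransition x : ℝ) : ℂ)) (freq z)‖ with hd2
  have hd2' : 0 ≤ d2 := norm_nonneg _
  have e := mul_le_mul_of_nonneg_right hc (add_nonneg hd2' hI)
  have hs : d2 ≤ R.spectralBound (freq z) := by
    unfold spectralBound
    linarith
  rw [norm_zero, zero_mul, zero_add, add_div, show 2 * (2 * C) = 4 * C by ring]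
  linarith

/-- The `z`-derivative of the scattering data, with a bound. -/
theorem exists_tendsto_slope_wronskian :
    ∃ C, 0 ≤ C ∧ ∀ z, 1 < |z| → ∃ M,
      Tendsto (fun z' : ℝ => (z' - z)⁻¹ • (W.a z * W.b z' - W.b z * W.a z')) (𝓝[≠] z) (𝓝 M) ∧
      |z| * ‖M‖ ≤ 6 * (R.spectralBound (freq z) + R.spectralBound (-freq z)) + C / |z| := by
  obtain ⟨C, hC, hBa⟩ := R.exists_jostBounds
  have hB : ∀ z, 1 ≤ |z| → JostBounds R C z (W.w1 z) (W.w2 z) (W.a z) (W.b z) := fun z hz =>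
    hBa hz (W.jost z (abs_pos.1 (by linarith)))
  obtain ⟨C1, hC1, hG⟩ := exists_slope_G_left W hC hB
  set C2 := C ^ 2 * ∫ x, |R.p x * R.G x|
  set C3 := 2 * ∫ x, |R.A x|
  set C4 := 3 * (∫ x, |R.B x|) + 2 * C * (∫ x, (|R.p x| + 1) * |R.B x| * R.tail x)
  set C5 := (∫ x, |R.B x|) + 4 * C * (∫ x, (|R.p x| + 1) * |R.B x| * R.tail x)
  have p1 : 0 ≤ ∫ x, |R.p x * R.G x| := integral_nonneg fun x => abs_nonneg _
  have p2 : 0 ≤ ∫ x, |R.A x| := integral_nonneg fun x => abs_nonneg _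
  have p3 : 0 ≤ ∫ x, |R.B x| := integral_nonneg fun x => abs_nonneg _
  have p4 : 0 ≤ ∫ x, (|R.p x| + 1) * |R.B x| * R.tail x := integral_nonneg fun x => by
    have := R.tail_nonneg x
    positivity
  refine ⟨C1 + C2 + C3 + C4 + C5, by positivity, fun z hz => ?_⟩
  have hz0 : 0 < |z| := by linarith
  have hzn : z ≠ 0 := abs_pos.1 hz0
  have hj := W.jost z hzn
  obtain ⟨l1, t1, b1⟩ := hG z hz
  obtain ⟨l2, t2, b2⟩ := exists_slope_B_left W hC hB hz
  obtain ⟨l3, t3, b3⟩ := exists_slope_G_right W hB hz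
  obtain ⟨l4, t4, b4⟩ := exists_slope_B_right W hC hB hz
  obtain ⟨l5, t5, b5⟩ := exists_slope_A W hz
  -- The signs are those of c₂₁, −c₁₂ and −c₁₁ in the Wronskian formula, sorted by the coefficients
  -- G, B and A.
  refine ⟨Complex.I * l1 - l2 - Complex.I * l3 - l4 + Complex.I * l5, ?_, ?_⟩
  · refine (((((t1.const_mul Complex.I).sub t2).sub (t3.const_mul Complex.I)).sub t4).add
      (t5.const_mul Complex.I)).congr' ?_
    filter_upwards [nhdsWithin_le_nhds (isOpen_ne.mem_nhds hzn)] with z' hz'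
    have hj' := W.jost z' hz'
    rw [hj.wronskian_top hj']
    simp only [mul_smul_comm, ← smul_sub, ← smul_add]
    congr 1
    have m : ∀ {c d : ℂ}, ‖c‖ ≤ 1 → ‖d‖ ≤ 1 → ‖c * d‖ ≤ 1 := fun h1 h2 => by
      rw [norm_mul]; exact mul_le_one₀ h1 (norm_nonneg _) h2
    have c1 := hj.sol.continuous_left
    have c2 := hj.sol.continuous_right
    have c1' := hj'.sol.continuous_left
    have c2' := hj'.sol.continuous_right
    have iG : ∀ θ, Integrable fun x => R.e θ x * R.G x := fun θ =>
      (R.iG.ofReal (𝕜 := ℂ)).bdd_mul (c := 1) (R.continuous_e θ).aestronglyMeasurable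
        (ae_of_all _ fun x => (R.norm_e θ x).le)
    have iB : ∀ θ z, Integrable fun x => (R.B x : ℂ) * (R.e θ x / (z : ℂ)) := fun θ z => by
      refine (R.iB.ofReal (𝕜 := ℂ)).mul_bdd (c := 1 / ‖z‖) (by
        have := R.continuous_e θ
        exact (by fun_prop : Continuous fun x => R.e θ x / z).aestronglyMeasurable)
        (ae_of_all _ fun x => ?_)
      rw [norm_div, norm_e]
    have iA : ∀ z : ℝ, Integrable fun x => (R.A x : ℂ) / z := fun z =>
      (R.iA.ofReal (𝕜 := ℂ)).div_const _
    have n11 : ∀ x, ‖W.w1 z x * W.w1 z' x‖ ≤ 1 := fun x =>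
      m (hj.norm_left_le x) (hj'.norm_left_le x)
    have n22 : ∀ x, ‖W.w2 z x * W.w2 z' x‖ ≤ 1 := fun x =>
      m (hj.norm_right_le x) (hj'.norm_right_le x)
    have n12 : ∀ x, ‖W.w1 z x * W.w2 z' x + W.w2 z x * W.w1 z' x‖ ≤ 2 := fun x => by
      have := m (hj.norm_left_le x) (hj'.norm_right_le x)
      have := m (hj.norm_right_le x) (hj'.norm_left_le x)
      exact (norm_add_le _ _).trans (by linarith)
    have i1 : Integrable fun x => Complex.I * ((R.e (-freq z') x * R.G x - R.e (-freq z) x * R.G x) *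
        (W.w1 z x * W.w1 z' x)) := (((iG _).sub (iG _)).mul_bdd (c := 1)
      (c1.mul c1').aestronglyMeasurable (ae_of_all _ n11)).const_mul _
    have i2 : Integrable fun x => ((R.B x : ℂ) * (R.e (-freq z') x / z') -
        R.B x * (R.e (-freq z) x / z)) * (W.w1 z x * W.w1 z' x) :=
      ((iB _ _).sub (iB _ _)).mul_bdd (c := 1) (c1.mul c1').aestronglyMeasurable (ae_of_all _ n11)
    have i3 : Integrable fun x => Complex.I * ((R.e (freq z') x * R.G x - R.e (freq z) x * R.G x) *
        (W.w2 z x * W.w2 z' x)) := (((iG _).sub (iG _)).mul_bdd (c := 1)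
      (c2.mul c2').aestronglyMeasurable (ae_of_all _ n22)).const_mul _
    have i4 : Integrable fun x => ((R.B x : ℂ) * (R.e (freq z') x / z') -
        R.B x * (R.e (freq z) x / z)) * (W.w2 z x * W.w2 z' x) :=
      ((iB _ _).sub (iB _ _)).mul_bdd (c := 1) (c2.mul c2').aestronglyMeasurable (ae_of_all _ n22)
    have i5 : Integrable fun x => Complex.I * (((R.A x : ℂ) / z' - R.A x / z) *
        (W.w1 z x * W.w2 z' x + W.w2 z x * W.w1 z' x)) :=
      (((iA _).sub (iA _)).mul_bdd (c := 2)
        ((c1.mul c2').add (c2.mul c1')).aestronglyMeasurable (ae_of_all _ n12)).const_mul _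
    rw [← integral_const_mul, ← integral_const_mul, ← integral_const_mul, ← integral_sub i1 i2]
    have i12 := i1.sub i2
    simp only [Pi.sub_def] at i12
    rw [← integral_sub i12 i3]
    have i123 := i12.sub i3
    simp only [Pi.sub_def] at i123
    rw [← integral_sub i123 i4]
    have i1234 := i123.sub i4
    simp only [Pi.sub_def] at i1234
    rw [← integral_add i1234 i5]
    congr 1 with x
    simp only [c11, c12, c21]
    ring
  · have n : ‖Complex.I * l1 - l2 - Complex.I * l3 - l4 + Complex.I * l5‖ ≤
        ‖l1‖ + ‖l2‖ + ‖l3‖ + ‖l4‖ + ‖l5‖ := by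
      have hI : ∀ l : ℂ, ‖Complex.I * l‖ = ‖l‖ := fun l => by
        rw [norm_mul, Complex.norm_I, one_mul]
      rw [← hI l1, ← hI l3, ← hI l5]
      refine (norm_add_le _ _).trans (add_le_add ((norm_sub_le _ _).trans (add_le_add
        ((norm_sub_le _ _).trans (add_le_add (norm_sub_le _ _) le_rfl)) le_rfl)) le_rfl)
    have s1 := R.spectralBound_nonneg (freq z)
    have e := mul_le_mul_of_nonneg_left n hz0.le
    rw [add_div, add_div, add_div, add_div]
    linarith

end Derivative

end RegularCoeffs

/-! ### Functions that are odd under the inversion `z ↦ -1/z` -/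

theorem IsPrimitive.isWeakDeriv {f g : ℝ → ℂ} (h : IsPrimitive f g) : IsWeakDeriv f g := by
  refine ⟨h.continuous.locallyIntegrable, h.1, fun φ hφ hφc => ?_⟩
  have hφp : IsPrimitive φ (deriv φ) := IsPrimitive.of_hasDerivAt
    (fun x => (hφ.differentiable (by simp) x).hasDerivAt) (hφ.continuous_deriv (by simp))
  have hm := hφp.ofReal.mul h
  have hφ0 : ∀ l : Filter ℝ, l ≤ cocompact ℝ → Tendsto (fun x => (φ x : ℂ) * f x) l (𝓝 0) := by
    intro l hl
    refine tendsto_nhds_of_eventually_eq (hl ?_)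
    filter_upwards [hφc.compl_mem_cocompact] with x hx
    rw [image_eq_zero_of_notMem_tsupport hx, Complex.ofReal_zero, zero_mul]
  have i1 : Integrable fun x => deriv φ x • f x :=
    h.continuous.locallyIntegrable.integrable_smul_left_of_hasCompactSupport
      (hφ.continuous_deriv (by simp)) hφc.deriv
  have i2 : Integrable fun x => φ x • g x :=
    h.1.integrable_smul_left_of_hasCompactSupport hφ.continuous hφc
  have key := hm.integral_eq (i1.add i2) (hφ0 _ atBot_le_cocompact) (hφ0 _ atTop_le_cocompact)
  have e : ∫ x, (((deriv φ x : ℝ) : ℂ) * f x + (φ x : ℂ) * g x) =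
      (∫ x, deriv φ x • f x) + ∫ x, φ x • g x := by
    rw [← integral_add i1 i2]
    simp only [Complex.real_smul]
  rw [sub_zero] at key
  exact eq_neg_of_add_eq_zero_left (e.symm.trans key)

theorem IsWeakDeriv.congr_ae {f f' g : ℝ → ℂ} (h : IsWeakDeriv f g) (hf : f =ᵐ[volume] f') :
    IsWeakDeriv f' g := by
  refine ⟨h.1.congr hf, h.2.1, fun φ hφ hφc => ?_⟩
  rw [← h.2.2 φ hφ hφc]
  refine integral_congr_ae ?_
  filter_upwards [hf] with x hx
  rw [hx]

theorem memLp_of_restrict {f : ℝ → ℂ} {s : Set ℝ} (hs : MeasurableSet s)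
    (h1 : MemLp f 2 (volume.restrict s)) (h2 : MemLp f 2 (volume.restrict sᶜ)) :
    MemLp f 2 volume := by
  rw [← Set.indicator_self_add_compl s f]
  exact ((memLp_indicator_iff_restrict hs).2 h1).add
    ((memLp_indicator_iff_restrict hs.compl).2 h2)

section Inversion

variable {r : ℝ → ℂ} (hodd : ∀ z ≠ 0, r (-1 / z) = -r z)

theorem one_lt_abs_inv {z : ℝ} (hz0 : z ≠ 0) (hz : |z| < 1) : 1 < |-1 / z| := by
  rw [abs_div, abs_neg, abs_one]
  exact (one_lt_div (abs_pos.2 hz0)).2 hz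

include hodd in
theorem hasDerivAt_of_inversion (hd : ∀ z, 1 < |z| → DifferentiableAt ℝ r z) {z : ℝ} (hz0 : z ≠ 0)
    (hz : |z| < 1) : HasDerivAt r (-((1 / z ^ 2) • deriv r (-1 / z))) z := by
  have h1 : HasDerivAt (fun z : ℝ => -1 / z) (1 / z ^ 2) z := by
    refine ((hasDerivAt_inv hz0).const_mul (-1)).congr_deriv (by ring)
  have h2 := ((hd _ (one_lt_abs_inv hz0 hz)).hasDerivAt.scomp z h1).neg
  refine h2.congr_of_eventuallyEq ?_
  filter_upwards [isOpen_ne.mem_nhds hz0] with w hw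
  simp [hodd w hw]

include hodd in
-- With w = −1/z one has |r'(z)| = w²|r'(w)| and dz = dw/w², so a weight w² remains. This is why the
-- bound on z r' at infinity is exactly what controls r' near 0.
theorem lintegral_deriv_inversion_le (hd : ∀ z, 1 < |z| → DifferentiableAt ℝ r z) :
    ∫⁻ z in {z : ℝ | |z| ≤ 1}, ‖deriv r z‖ₑ ^ 2 ≤
      ∫⁻ z in {z : ℝ | 1 < |z|}, ENNReal.ofReal (z ^ 2) * ‖deriv r z‖ₑ ^ 2 := by
  set u : Set ℝ := {z | z ≠ 0 ∧ |z| < 1}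
  have hu : MeasurableSet u :=
    (isOpen_ne.inter (isOpen_lt continuous_abs continuous_const)).measurableSet
  have hut : (u : Set ℝ) =ᵐ[volume] {z : ℝ | |z| ≤ 1} := by
    have hc : ∀ᵐ z : ℝ, z ∉ ({0, 1, -1} : Set ℝ) :=
      (Set.Countable.ae_notMem (by simp) volume)
    filter_upwards [hc] with z hz
    simp only [Set.mem_insert_iff, Set.mem_singleton_iff, not_or] at hz
    refine propext ⟨fun h => h.2.le, fun h => ⟨hz.1, lt_of_le_of_ne h fun h1 => ?_⟩⟩
    rcases (abs_eq zero_le_one).1 h1 with h2 | h2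
    · exact hz.2.1 h2
    · exact hz.2.2 h2
  rw [← setLIntegral_congr hut]
  set g : ℝ → ENNReal := fun w => ENNReal.ofReal (w ^ 2) * ‖deriv r w‖ₑ ^ 2
  have h1 : ∫⁻ y in (fun z : ℝ => -1 / z) '' u, g y =
      ∫⁻ z in u, ENNReal.ofReal |1 / z ^ 2| * g (-1 / z) := by
    refine lintegral_image_eq_lintegral_abs_deriv_mul hu (fun z hz => ?_) ?_ g
    · exact (((hasDerivAt_inv hz.1).const_mul (-1)).congr_deriv (by ring)).hasDerivWithinAt
    · intro a ha b hb hab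
      have h0 := ha.1
      have h0' := hb.1
      simp only at hab
      field_simp at hab
      linarith
  calc ∫⁻ z in u, ‖deriv r z‖ₑ ^ 2 = ∫⁻ z in u, ENNReal.ofReal |1 / z ^ 2| * g (-1 / z) := by
        refine setLIntegral_congr_fun hu fun z hz => ?_
        have h0 : 0 < z ^ 2 := by have := hz.1; positivity
        simp only [g]
        rw [(hasDerivAt_of_inversion hodd hd hz.1 hz.2).deriv, enorm_neg, enorm_smul, mul_pow,
          ← mul_assoc, ← ENNReal.ofReal_mul (abs_nonneg _), Real.enorm_eq_ofReal_abs,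
          ← ENNReal.ofReal_pow (abs_nonneg _)]
        congr 2
        rw [abs_of_pos (by positivity)]
        field_simp
    _ = ∫⁻ y in (fun z : ℝ => -1 / z) '' u, g y := h1.symm
    _ ≤ _ := lintegral_mono_set (by
        rintro _ ⟨z, hz, rfl⟩
        exact one_lt_abs_inv hz.1 hz.2)

include hodd in
/-- A function odd under the inversion is in `H^{1,1}` if it decays suitably near infinity. -/
theorem memH_of_inversion (hc : ∀ z ≠ 0, ContinuousAt r z)
    (hd : ∀ z, 1 < |z| → DifferentiableAt ℝ r z) {Θ : ℝ → ℝ}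
    (hΘ : MemLp Θ 2 (volume.restrict {z : ℝ | 1 < |z|}))
    (hr : ∀ z, 1 < |z| → |z| * ‖r z‖ ≤ Θ z) (hr' : ∀ z, 1 < |z| → |z| * ‖deriv r z‖ ≤ Θ z)
    {K : ℝ} (hK : ∀ z, 1 ≤ |z| → ‖r z‖ ≤ K / |z|) :
    MemH 1 1 r ∧ MemLp (fun z : ℝ => (z : ℂ) * r z) 2 volume := by
  set s : Set ℝ := {z | 1 < |z|}
  have hs : MeasurableSet s := (isOpen_lt continuous_const continuous_abs).measurableSet
  have hsc : sᶜ = {z : ℝ | |z| ≤ 1} := by ext z; simp [s]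
  have hfin : IsFiniteMeasure (volume.restrict sᶜ) := by
    refine ⟨?_⟩
    rw [Measure.restrict_apply_univ, hsc]
    have : {z : ℝ | |z| ≤ 1} = Set.Icc (-1) 1 := by ext z; simp [abs_le]
    rw [this]
    exact measure_Icc_lt_top
  have hm : AEStronglyMeasurable r volume := by
    have h1 : ContinuousOn r {0}ᶜ := fun z hz => (hc z hz).continuousWithinAt
    have h2 := h1.aestronglyMeasurable (μ := volume) (measurableSet_singleton 0).compl
    rwa [restrict_compl_singleton] at h2
  have hne : ∀ᵐ z : ℝ, z ≠ 0 := by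
    have := Set.Countable.ae_notMem (Set.countable_singleton (0 : ℝ)) volume
    simpa using this
  -- The O(1/z) bound at infinity, transported by the inversion: r extends continuously by 0 at the
  -- origin.
  have hsmall : ∀ z ≠ 0, |z| ≤ 1 → ‖r z‖ ≤ K * |z| := fun z hz hz1 => by
    have h0 : 0 < |z| := abs_pos.2 hz
    have h1 : |-1 / z| = 1 / |z| := by rw [abs_div, abs_neg, abs_one]
    have h2 := hK (-1 / z) (by rw [h1]; exact (one_le_div h0).2 hz1)
    rwa [hodd z hz, norm_neg, h1, div_div_eq_mul_div, div_one] at h2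
  have hK0 : 0 ≤ K := by
    have := (norm_nonneg _).trans (hK 1 (by simp))
    simpa using this
  have hmem : ∀ f : ℝ → ℂ, AEStronglyMeasurable f volume → (∀ z, 1 < |z| → ‖f z‖ ≤ |z| * ‖r z‖) →
      (∀ z, |z| ≤ 1 → ‖f z‖ ≤ ‖r z‖) → MemLp f 2 volume := fun f hf h1 h2 => by
    refine memLp_of_restrict hs ?_ ?_
    · refine hΘ.mono' hf.restrict ?_
      filter_upwards [ae_restrict_mem hs] with z hz using (h1 z hz).trans (hr z hz)
    · refine MemLp.of_bound hf.restrict K ?_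
      filter_upwards [ae_restrict_mem hs.compl, ae_restrict_of_ae hne] with z hz hz0
      have hz1 : |z| ≤ 1 := by rwa [hsc] at hz
      exact ((h2 z hz1).trans (hsmall z hz0 hz1)).trans (mul_le_of_le_one_right hK0 hz1)
  have hdm : AEStronglyMeasurable (deriv r) volume := (measurable_deriv r).aestronglyMeasurable
  have hd2 : MemLp (fun z : ℝ => (1 + |z| ^ (1 : ℝ)) • deriv r z) 2 volume := by
    have hm2 : AEStronglyMeasurable (fun z : ℝ => (1 + |z| ^ (1 : ℝ)) • deriv r z) volume := by
      simp only [Real.rpow_one]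
      exact (by fun_prop : Continuous fun z : ℝ => 1 + |z|).aestronglyMeasurable.smul hdm
    have hn : ∀ z : ℝ, ‖(1 + |z| ^ (1 : ℝ)) • deriv r z‖ = (1 + |z|) * ‖deriv r z‖ := fun z => by
      rw [norm_smul, Real.rpow_one, Real.norm_of_nonneg (by positivity)]
    refine memLp_of_restrict hs ?_ ?_
    · refine (hΘ.const_mul 2).mono' hm2.restrict ?_
      filter_upwards [ae_restrict_mem hs] with z hz
      rw [hn]
      have h1 := hr' z hz
      have h2 : 1 * ‖deriv r z‖ ≤ |z| * ‖deriv r z‖ :=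
        mul_le_mul_of_nonneg_right (le_of_lt hz) (norm_nonneg _)
      linarith
    · have h1 : MemLp (deriv r) 2 (volume.restrict sᶜ) := by
        rw [memLp_two_iff_lintegral hdm.restrict, hsc]
        refine (lintegral_deriv_inversion_le hodd hd).trans_lt ?_
        refine lt_of_le_of_lt (setLIntegral_mono' hs fun z hz => ?_) hΘ.lintegral_two_lt_top
        have h2 : ENNReal.ofReal (z ^ 2) = ‖z‖ₑ ^ 2 := by
          rw [Real.enorm_eq_ofReal_abs, ← ENNReal.ofReal_pow (abs_nonneg _), sq_abs]
        rw [h2, ← mul_pow]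
        gcongr
        rw [← enorm_norm (deriv r z), ← enorm_mul, Real.enorm_eq_ofReal_abs,
          Real.enorm_eq_ofReal_abs]
        refine ENNReal.ofReal_le_ofReal ?_
        rw [abs_mul, abs_norm]
        exact (hr' z hz).trans (le_abs_self _)
      refine (h1.norm.const_mul 2).mono' hm2.restrict ?_
      filter_upwards [ae_restrict_mem hs.compl] with z hz
      have hz1 : |z| ≤ 1 := by rwa [hsc] at hz
      rw [hn]
      nlinarith [norm_nonneg (deriv r z)]
  have hd1 : MemLp (deriv r) 2 volume := by
    refine hd2.mono hdm (ae_of_all _ fun z => ?_)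
    rw [norm_smul, Real.rpow_one, Real.norm_of_nonneg (by positivity)]
    nlinarith [norm_nonneg (deriv r z), abs_nonneg z]
  have hloc : LocallyIntegrable (deriv r) := hd1.locallyIntegrable (by norm_num)
  have hwd : IsWeakDeriv r (deriv r) := by
    -- Nothing is known about r at 0, so the value there is corrected to 0. The corrected function
    -- is a genuine primitive of r'; the weak derivative does not see the change.
    have hae : Function.update r 0 0 =ᵐ[volume] r := by
      filter_upwards [hne] with z hz
      rw [Function.update_of_ne hz]
    refine IsWeakDeriv.congr_ae (IsPrimitive.isWeakDeriv ⟨hloc, fun a b => ?_⟩) hae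
    have hupd : ∀ z ≠ 0, Function.update r 0 0 =ᶠ[𝓝 z] r := fun z hz => by
      filter_upwards [isOpen_ne.mem_nhds hz] with w hw
      rw [Function.update_of_ne hw]
    -- Differentiability may fail at 0 and at ±1, where the frequency vanishes; continuity at these
    -- points rules out jumps.
    refine (integral_eq_of_hasDerivAt_off_countable _ _ (s := {0, 1, -1}) (by simp) ?_ ?_
      (hloc.intervalIntegrable' a b)).symm
    · refine Continuous.continuousOn (continuous_iff_continuousAt.2 fun z => ?_)
      rcases eq_or_ne z 0 with rfl | hz
      · rw [ContinuousAt, Function.update_self]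
        have hlim : Tendsto (fun z : ℝ => K * |z|) (𝓝 0) (𝓝 0) := by
          have : ContinuousAt (fun z : ℝ => K * |z|) 0 := by fun_prop
          simpa [ContinuousAt] using this
        refine squeeze_zero_norm' ?_ hlim
        filter_upwards [Icc_mem_nhds (by norm_num : (-1 : ℝ) < 0) (by norm_num : (0 : ℝ) < 1)]
          with w hw
        rcases eq_or_ne w 0 with rfl | h0
        · simp
        · rw [Function.update_of_ne h0]
          exact hsmall w h0 (abs_le.2 hw)
      · exact (hc z hz).congr (hupd z hz).symm
    · rintro z ⟨-, hz⟩
      simp only [Set.mem_insert_iff, Set.mem_singleton_iff, not_or] at hz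
      refine HasDerivAt.congr_of_eventuallyEq ?_ (hupd z hz.1)
      rcases lt_or_ge 1 |z| with h | h
      · exact (hd z h).hasDerivAt
      · refine (hasDerivAt_of_inversion hodd hd hz.1 (lt_of_le_of_ne h fun h1 => ?_))
          |>.differentiableAt.hasDerivAt
        rcases (abs_eq zero_le_one).1 h1 with h2 | h2
        · exact hz.2.1 h2
        · exact hz.2.2 h2
  refine ⟨⟨hmem r hm (fun z hz => ?_) fun z _ => le_rfl,
    fun j => if j = 0 then r else deriv r, by simp, fun j hj => ?_⟩, ?_⟩
  · exact le_mul_of_one_le_left (norm_nonneg _) (le_of_lt hz)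
  · obtain rfl : j = 0 := by omega
    simpa using ⟨hwd, by simpa using hd2⟩
  · refine hmem _ ?_ (fun z _ => ?_) fun z hz => ?_
    · exact (by fun_prop : Continuous fun z : ℝ => (z : ℂ)).aestronglyMeasurable.mul hm
    · rw [norm_mul, Complex.norm_real, Real.norm_eq_abs]
    · rw [norm_mul, Complex.norm_real, Real.norm_eq_abs]
      exact mul_le_of_le_one_left (norm_nonneg _) hz

end Inversion

/-! ### The reflection coefficient -/

/-- On each of the two half-lines the frequency is injective with derivative at least 1/4; the
factor 2 counts the half-lines. -/
theorem lintegral_comp_phase_le {θ : ℝ → ℝ} (hθ : IsPhase θ) (g : ℝ → ENNReal) :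
    ∫⁻ z in {z : ℝ | 1 < |z|}, g (θ z) ≤ 2 * (ENNReal.ofReal (1 / 4 : ℝ)⁻¹ * ∫⁻ y, g y) := by
  have hs : {z : ℝ | 1 < |z|} = Set.Ioi 1 ∪ Set.Iio (-1) := by
    ext z; simp [lt_abs, lt_neg]
  have hinj : ∀ {z w : ℝ}, 0 < z * w → freq z = freq w → z = w := fun {z w} h0 h => by
    have hz : z ≠ 0 := left_ne_zero_of_mul h0.ne'
    have hw : w ≠ 0 := right_ne_zero_of_mul h0.ne'
    unfold freq at h
    -- The only other preimage of a frequency is w = −1/z, which has the opposite sign.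
    have h1 : (z - w) * (z * w + 1) = 0 := by field_simp at h; linarith
    rcases mul_eq_zero.1 h1 with h2 | h2
    · linarith
    · linarith
  have hinj' : ∀ {z w : ℝ}, 0 < z * w → θ z = θ w → z = w := fun {z w} h0 h => by
    rcases hθ with rfl | rfl
    · exact hinj h0 h
    · exact hinj h0 (neg_injective h)
  have key : ∀ s : Set ℝ, MeasurableSet s → (∀ z ∈ s, ∀ w ∈ s, 0 < z * w) →
      ∫⁻ z in s, g (θ z) ≤ ENNReal.ofReal (1 / 4 : ℝ)⁻¹ * ∫⁻ y, g y := fun s hms hpos => by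
    have hpos' : ∀ z ∈ s, 1 / 4 ≤ |(1 + 1 / z ^ 2) / 4| := fun z _ => by
      have : 0 ≤ 1 / z ^ 2 := by positivity
      rw [abs_of_nonneg (by positivity)]
      linarith
    have hz : ∀ z ∈ s, z ≠ 0 := fun z hz => left_ne_zero_of_mul (hpos z hz z hz).ne'
    have hI : Set.InjOn θ s := fun z hz w hw h => hinj' (hpos z hz w hw) h
    rcases hθ with rfl | rfl
    · exact lintegral_comp_le hms (fun z hz' => hasDerivAt_freq (hz z hz')) hI (by norm_num)
        hpos' g
    · exact lintegral_comp_le hms (fun z hz' => (hasDerivAt_freq (hz z hz')).neg) hI (by norm_num)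
        (fun z hz' => by rw [abs_neg]; exact hpos' z hz') g
  rw [hs]
  refine (lintegral_union_le _ _ _).trans ?_
  rw [two_mul]
  refine add_le_add (key _ measurableSet_Ioi fun z hz w hw => ?_)
    (key _ measurableSet_Iio fun z hz w hw => ?_)
  · exact mul_pos (zero_lt_one.trans hz) (zero_lt_one.trans hw)
  · simp only [Set.mem_Iio] at hz hw
    exact mul_pos_of_neg_of_neg (by linarith) (by linarith)

theorem memLp_comp_phase {θ : ℝ → ℝ} (hθ : IsPhase θ) {g : ℝ → ℝ} (hg : MemLp g 2 volume)
    (hgm : Measurable g) : MemLp (fun z => g (θ z)) 2 (volume.restrict {z : ℝ | 1 < |z|}) := by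
  have hθm : Measurable θ := by
    have : Measurable freq := by unfold freq; fun_prop
    rcases hθ with rfl | rfl
    · exact this
    · exact this.neg
  have hm : Measurable fun z => g (θ z) := hgm.comp hθm
  rw [memLp_two_iff_lintegral hm.aestronglyMeasurable.restrict]
  refine (lintegral_comp_phase_le hθ fun y => ‖g y‖ₑ ^ 2).trans_lt ?_
  exact ENNReal.mul_lt_top (by norm_num) (ENNReal.mul_lt_top ENNReal.ofReal_lt_top
    hg.lintegral_two_lt_top)

theorem memLp_one_div_abs :
    MemLp (fun z : ℝ => 1 / |z|) 2 (volume.restrict {z : ℝ | 1 < |z|}) := by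
  have hm : Measurable fun z : ℝ => 1 / |z| := by fun_prop
  rw [memLp_two_iff_integrable_sq hm.aestronglyMeasurable.restrict]
  refine ((integrable_inv_one_add_sq.const_mul 2).restrict).mono'
    (hm.pow_const 2).aestronglyMeasurable.restrict ?_
  filter_upwards [ae_restrict_mem (isOpen_lt continuous_const continuous_abs).measurableSet]
    with z hz
  have h1 : (1 : ℝ) < z ^ 2 := by
    rw [← sq_abs]
    exact one_lt_pow₀ hz (by norm_num)
  rw [Real.norm_of_nonneg (by positivity), div_pow, one_pow, sq_abs, ← div_eq_mul_inv,
    div_le_div_iff₀ (by positivity) (by positivity)]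
  linarith

namespace RegularCoeffs

open Coeffs

variable {R : RegularCoeffs}

theorem measurable_spectralBound : Measurable R.spectralBound := by
  have hp := R.continuous_p
  have h1 := (continuous_osc hp R.iB.ofReal (h := fun x => (R.B x : ℂ))).measurable
  have h2 := (continuous_osc hp R.iK1.ofReal (h := fun x => (R.K1 x : ℂ))).measurable
  have h3 := (continuous_osc hp R.iK2.ofReal (h := fun x => (R.K2 x : ℂ))).measurable
  exact ((((h1.norm.add h2.norm).add h3.norm).add (measurable_deriv _).norm).add
    (measurable_deriv _).norm)

variable (W : R.JostFamily) (ha : ∀ z ≠ 0, W.a z ≠ 0)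
include ha

/-- Beyond T the estimate |a − 1| ≤ C·mass/|z| ≤ 1/2 applies; on 1 ≤ |z| ≤ T continuity, compactness
and the absence of zeros give a positive minimum. -/
theorem exists_le_norm_a : ∃ c, 0 < c ∧ ∀ z, 1 ≤ |z| → c ≤ ‖W.a z‖ := by
  obtain ⟨C, hC, hB⟩ := R.exists_jostBounds
  have hm := R.mass_nonneg
  set T := 2 * C * R.mass + 1
  have hK : IsCompact {z : ℝ | 1 ≤ |z| ∧ |z| ≤ T} := by
    have h1 : IsClosed {z : ℝ | 1 ≤ |z|} := isClosed_le continuous_const continuous_abs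
    refine (isCompact_Icc (a := -T) (b := T)).of_isClosed_subset
      (h1.inter (isClosed_le continuous_abs continuous_const)) fun z hz => ?_
    exact abs_le.1 hz.2
  have hne : ({z : ℝ | 1 ≤ |z| ∧ |z| ≤ T}).Nonempty := ⟨1, by
    have : 0 ≤ 2 * C * R.mass := by positivity
    simp [T]; positivity⟩
  have hz0 : ∀ z : ℝ, 1 ≤ |z| → z ≠ 0 := fun z hz => abs_pos.1 (by linarith)
  obtain ⟨z0, hz0m, hmin⟩ := hK.exists_isMinOn hne (f := fun z => ‖W.a z‖)
    (fun z hz => (W.continuousAt_a (hz0 z hz.1)).norm.continuousWithinAt)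
  refine ⟨min ‖W.a z0‖ (1 / 2), lt_min (norm_pos_iff.2 (ha z0 (hz0 z0 hz0m.1))) (by norm_num),
    fun z hz => ?_⟩
  rcases le_or_gt |z| T with h | h
  · exact (min_le_left _ _).trans (hmin ⟨hz, h⟩)
  · refine (min_le_right _ _).trans ?_
    have h1 := (hB hz (W.jost z (hz0 z hz))).a_sub_le
    have h2 : C / |z| * R.mass ≤ 1 / 2 := by
      rw [div_mul_eq_mul_div, div_le_iff₀ (by linarith)]
      linarith
    have h3 := norm_sub_norm_le (1 : ℂ) (1 - W.a z)
    rw [norm_one, norm_sub_rev 1 (W.a z), sub_sub_cancel] at h3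
    linarith

/-- The reflection coefficient belongs to `H^{1,1}` and to the weighted space. -/
theorem memH_reflection {r : ℝ → ℂ} (hr : ∀ z ≠ 0, r z = W.b z / W.a z)
    (hodd : ∀ z ≠ 0, r (-1 / z) = -r z) :
    MemH 1 1 r ∧ MemLp (fun z : ℝ => (z : ℂ) * r z) 2 volume := by
  obtain ⟨C, hC, hBa⟩ := R.exists_jostBounds
  have hz0 : ∀ z : ℝ, 1 ≤ |z| → z ≠ 0 := fun z hz => abs_pos.1 (by linarith)
  have hB : ∀ z, 1 ≤ |z| → JostBounds R C z (W.w1 z) (W.w2 z) (W.a z) (W.b z) := fun z hz =>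
    hBa hz (W.jost z (hz0 z hz))
  obtain ⟨c, hc0, hc⟩ := exists_le_norm_a W ha
  obtain ⟨C1, hC1, hM⟩ := exists_tendsto_slope_wronskian W
  have hm := R.mass_nonneg
  set C2 := C * (R.mass * (∫ x, |R.B x|) + (∫ x, |R.A x|) + 3 * (R.mass * ∫ x, |R.K1 x|) +
        3 * ∫ x, |R.K x| * R.ρ x)
  have hC2 : 0 ≤ C2 := by
    have p1 : 0 ≤ ∫ x, |R.B x| := integral_nonneg fun x => abs_nonneg _
    have p2 : 0 ≤ ∫ x, |R.A x| := integral_nonneg fun x => abs_nonneg _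
    have p3 : 0 ≤ ∫ x, |R.K1 x| := integral_nonneg fun x => abs_nonneg _
    have p4 : 0 ≤ ∫ x, |R.K x| * R.ρ x := integral_nonneg fun x =>
      mul_nonneg (abs_nonneg _) (R.ρ_nonneg x)
    positivity
  set Ψ : ℝ → ℝ := fun z => R.spectralBound (freq z) + R.spectralBound (-freq z) with hΨ
  have hΨ0 : ∀ z, 0 ≤ Ψ z := fun z =>
    add_nonneg (R.spectralBound_nonneg _) (R.spectralBound_nonneg _)
  set Θ : ℝ → ℝ := fun z => (c⁻¹ + (c ^ 2)⁻¹) * (6 * Ψ z + (C1 + C2 + 4) * (1 / |z|))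
  have hΘ : MemLp Θ 2 (volume.restrict {z : ℝ | 1 < |z|}) := by
    have h1 := memLp_comp_phase (Or.inl rfl) R.memLp_spectralBound measurable_spectralBound
    have h2 := memLp_comp_phase (Or.inr rfl) R.memLp_spectralBound measurable_spectralBound
    exact (((h1.add h2).const_mul 6).add (memLp_one_div_abs.const_mul _)).const_mul _
  have hbz : ∀ z, 1 < |z| → |z| * ‖W.b z‖ ≤ 6 * Ψ z + (C1 + C2 + 4) * (1 / |z|) := fun z hz => by
    have hzp : 0 < |z| := by linarith
    have hj := W.jost z (hz0 z hz.le)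
    have s0 := hΨ0 z
    rw [mul_one_div, add_div, add_div]
    have q1 : 0 ≤ C1 / |z| := by positivity
    have q2 : 0 ≤ C2 / |z| := by positivity
    have q3 : 0 ≤ 4 / |z| := by positivity
    rcases le_or_gt 2 |z| with h2 | h2
    · have h3 := norm_mul_b_le hC h2 hj (hB z hz.le)
      have h4 : ‖osc R.p (fun x => (R.B x : ℂ)) (-freq z)‖ +
          3 * ‖osc R.p (fun x => (R.K1 x : ℂ)) (-freq z)‖ ≤ 3 * R.spectralBound (-freq z) := by
        have n1 := norm_nonneg (osc R.p (fun x => (R.B x : ℂ)) (-freq z))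
        have n2 := norm_nonneg (osc R.p (fun x => (R.K2 x : ℂ)) (-freq z))
        have n3 := norm_nonneg (deriv (osc R.p fun x => ((R.B x * 1 : ℝ) : ℂ)) (-freq z))
        have n4 := norm_nonneg (deriv (osc R.p fun x =>
          ((R.B x * Real.smoothTransition x : ℝ) : ℂ)) (-freq z))
        unfold spectralBound
        linarith
      have s1 := R.spectralBound_nonneg (freq z)
      have s2 := R.spectralBound_nonneg (-freq z)
      have h5 : Ψ z = R.spectralBound (freq z) + R.spectralBound (-freq z) := rfl
      linarith
    · have h3 : |z| * ‖W.b z‖ ≤ |z| * 1 := by gcongr; exact hj.norm_b_le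
      -- Near |z| = 1 the trivial |b| ≤ 1 is used; this is the origin of the 4 in the constant.
      have h4 : |z| ≤ 4 / |z| := by rw [le_div_iff₀ hzp]; nlinarith
      linarith
  have ha2 : ∀ z, 1 ≤ |z| → ‖W.a z‖⁻¹ ≤ c⁻¹ := fun z hz => inv_anti₀ hc0 (hc z hz)
  have hcc : 0 < c⁻¹ ∧ 0 < (c ^ 2)⁻¹ := ⟨by positivity, by positivity⟩
  have hE : ∀ z, 0 ≤ 6 * Ψ z + (C1 + C2 + 4) * (1 / |z|) := fun z => by
    have := hΨ0 z
    positivity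
  -- r(z') − r(z) is the Wronskian divided by a(z)a(z'), so neither a nor b has to be differentiated
  -- separately.
  have hder : ∀ z, 1 < |z| → ∃ M, HasDerivAt r (M / W.a z ^ 2) z ∧
      |z| * ‖M‖ ≤ 6 * Ψ z + C1 / |z| := fun z hz => by
    obtain ⟨M, ht, hb⟩ := hM z hz
    have hzn := hz0 z hz.le
    refine ⟨M, hasDerivAt_iff_tendsto_slope.2 ?_, hb⟩
    have hca : Tendsto (fun z' => (W.a z * W.a z')⁻¹) (𝓝[≠] z) (𝓝 (W.a z * W.a z)⁻¹) :=
      (((continuousAt_const.mul (W.continuousAt_a hzn)).inv₀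
        (mul_ne_zero (ha z hzn) (ha z hzn))).tendsto).mono_left nhdsWithin_le_nhds
    have h3 := ht.mul hca
    rw [← div_eq_mul_inv, ← sq] at h3
    refine h3.congr' ?_
    filter_upwards [nhdsWithin_le_nhds (isOpen_ne.mem_nhds hzn)] with z' hz'
    have e1 := ha z hzn
    have e2 := ha z' hz'
    rw [slope, vsub_eq_sub, hr z hzn, hr z' hz', smul_mul_assoc]
    congr 1
    field_simp
  refine memH_of_inversion hodd (fun z hz => ?_) (fun z hz => ?_) hΘ (fun z hz => ?_)
    (fun z hz => ?_) (K := C * c⁻¹) (fun z hz => ?_)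
  · refine ((W.continuousAt_b hz).div (W.continuousAt_a hz) (ha z hz)).congr ?_
    filter_upwards [isOpen_ne.mem_nhds hz] with w hw
    exact (hr w hw).symm
  · obtain ⟨M, h, -⟩ := hder z hz
    exact h.differentiableAt
  · rw [hr z (hz0 z hz.le), norm_div, ← mul_div_assoc, div_eq_mul_inv]
    calc _ ≤ (6 * Ψ z + (C1 + C2 + 4) * (1 / |z|)) * c⁻¹ :=
          mul_le_mul (hbz z hz) (ha2 z hz.le) (by positivity) (hE z)
      _ = c⁻¹ * (6 * Ψ z + (C1 + C2 + 4) * (1 / |z|)) := mul_comm _ _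
      _ ≤ _ := mul_le_mul_of_nonneg_right (by linarith [hcc.2]) (hE z)
  · obtain ⟨M, h, hb⟩ := hder z hz
    have hzp : 0 < |z| := by linarith
    rw [h.deriv, norm_div, norm_pow, ← mul_div_assoc, div_eq_mul_inv]
    have q2 : 0 ≤ C2 / |z| := by positivity
    have q3 : 0 ≤ 4 / |z| := by positivity
    have e1 : 6 * Ψ z + C1 / |z| ≤ 6 * Ψ z + (C1 + C2 + 4) * (1 / |z|) := by
      rw [mul_one_div, add_div, add_div]
      linarith
    have e2 : (‖W.a z‖ ^ 2)⁻¹ ≤ (c ^ 2)⁻¹ :=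
      inv_anti₀ (by positivity) (pow_le_pow_left₀ hc0.le (hc z hz.le) 2)
    calc _ ≤ (6 * Ψ z + (C1 + C2 + 4) * (1 / |z|)) * (c ^ 2)⁻¹ :=
          mul_le_mul (hb.trans e1) e2 (by positivity) (hE z)
      _ = (c ^ 2)⁻¹ * (6 * Ψ z + (C1 + C2 + 4) * (1 / |z|)) := mul_comm _ _
      _ ≤ _ := mul_le_mul_of_nonneg_right (by linarith [hcc.1]) (hE z)
  · rw [hr z (hz0 z hz), norm_div, div_eq_mul_inv]
    calc _ ≤ C / |z| * c⁻¹ := mul_le_mul (hB z hz).b_le (ha2 z hz) (by positivity)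
          ((norm_nonneg _).trans (hB z hz).b_le)
      _ = _ := by ring

end RegularCoeffs

/-! ### The coefficients of the modified Camassa–Holm scattering problem -/

/-- `(1 + x²) f` is square-integrable. -/
def Weighted (f : ℝ → ℝ) : Prop := MemLp (fun x => (1 + x ^ 2) * f x) 2 volume

namespace Weighted

variable {f g : ℝ → ℝ}

theorem aestronglyMeasurable (h : Weighted f) : AEStronglyMeasurable f volume := by
  have h1 : Continuous fun x : ℝ => (1 + x ^ 2)⁻¹ :=
    Continuous.inv₀ (by fun_prop) fun x => by positivity
  refine (h1.aestronglyMeasurable.mul h.1).congr (ae_of_all _ fun x => ?_)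
  have : (1 + x ^ 2 : ℝ) ≠ 0 := by positivity
  simp only [Pi.mul_apply]
  field_simp

theorem mul_le (h : Weighted g) {w : ℝ → ℝ} (hw : Continuous w) {c : ℝ}
    (hf : AEStronglyMeasurable f volume)
    (hb : ∀ x, |w x * f x| ≤ c * ((1 + x ^ 2) * |g x|)) : MemLp (fun x => w x * f x) 2 volume := by
  refine MemLp.of_le_mul (c := c) h (hw.aestronglyMeasurable.mul hf) (ae_of_all _ fun x => ?_)
  rw [Real.norm_eq_abs, Real.norm_eq_abs, abs_mul (1 + x ^ 2),
    abs_of_nonneg (by positivity : (0 : ℝ) ≤ 1 + x ^ 2)]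
  exact hb x

theorem mono (h : Weighted g) (hf : AEStronglyMeasurable f volume) {c : ℝ}
    (hb : ∀ x, |f x| ≤ c * |g x|) : Weighted f :=
  h.mul_le (by fun_prop) (c := c) hf fun x => by
    have h0 : (0 : ℝ) ≤ 1 + x ^ 2 := by positivity
    rw [abs_mul, abs_of_nonneg h0]
    calc _ ≤ (1 + x ^ 2) * (c * |g x|) := mul_le_mul_of_nonneg_left (hb x) h0
      _ = _ := by ring

theorem add (hf : Weighted f) (hg : Weighted g) : Weighted fun x => f x + g x :=
  (MemLp.add hf hg).ae_eq (ae_of_all _ fun x => by simp only [Pi.add_apply]; ring)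

theorem abs (h : Weighted f) : Weighted fun x => |f x| :=
  h.mono (c := 1) h.aestronglyMeasurable.norm fun x => by rw [abs_abs, one_mul]

theorem const_mul (h : Weighted f) (c : ℝ) : Weighted fun x => c * f x :=
  h.mono (c := |c|) (h.aestronglyMeasurable.const_mul c) fun _ => (abs_mul _ _).le

theorem two (h : Weighted f) : MemLp f 2 volume := by
  have := h.mul_le (w := fun _ => 1) continuous_const (c := 1) h.aestronglyMeasurable fun x => by
    rw [one_mul, one_mul]
    nlinarith [abs_nonneg (f x), sq_nonneg x]
  simpa using this

theorem id_mul_two (h : Weighted f) : MemLp (fun x => x * f x) 2 volume :=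
  h.mul_le continuous_id (c := 1) h.aestronglyMeasurable fun x => by
    rw [one_mul, abs_mul]
    gcongr
    nlinarith [sq_nonneg (|x| - 1), sq_abs x]

theorem integrable (h : Weighted f) : Integrable f :=
  integrable_of_memLp_weight h.aestronglyMeasurable h.two h.id_mul_two

/-- Both powers of the weight are used: xf and x²f lie in L². This is available for m_x and its
derivative, but not for m. -/
theorem id_mul_integrable (h : Weighted f) : Integrable fun x => x * f x := by
  refine integrable_of_memLp_weight (continuous_id.aestronglyMeasurable.mul h.aestronglyMeasurable)
    h.id_mul_two ?_
  have := h.mul_le (w := fun x => x ^ 2) (by fun_prop) (c := 1) h.aestronglyMeasurable fun x => by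
    rw [one_mul, abs_mul, abs_of_nonneg (sq_nonneg x)]
    gcongr
    linarith
  exact this.ae_eq (ae_of_all _ fun x => by ring)

variable {p : ℝ → ℝ} (hp : Continuous p) {c : ℝ} (hpc : ∀ x, |p x| ≤ |x| + c)
include hp hpc

theorem phase_mul_integrable (h : Weighted f) : Integrable fun x => p x * f x := by
  refine (h.id_mul_integrable.abs.add (h.integrable.abs.const_mul c)).mono'
    (hp.aestronglyMeasurable.mul h.aestronglyMeasurable) (ae_of_all _ fun x => ?_)
  simp only [Pi.add_apply]
  rw [norm_mul, Real.norm_eq_abs, Real.norm_eq_abs, abs_mul, ← add_mul]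
  exact mul_le_mul_of_nonneg_right (hpc x) (abs_nonneg _)

end Weighted

theorem memLp_phase_mul {f p : ℝ → ℝ} (h1 : MemLp f 2 volume)
    (h2 : MemLp (fun x => x * f x) 2 volume) (hp : Continuous p) {c : ℝ}
    (hpc : ∀ x, |p x| ≤ |x| + c) : MemLp (fun x => p x * f x) 2 volume := by
  refine (h2.norm.add (h1.norm.const_mul c)).mono' (hp.aestronglyMeasurable.mul h1.1)
    (ae_of_all _ fun x => ?_)
  simp only [Pi.add_apply]
  rw [norm_mul, norm_mul, Real.norm_eq_abs, Real.norm_eq_abs, Real.norm_eq_abs, ← add_mul]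
  exact mul_le_mul_of_nonneg_right (hpc x) (abs_nonneg _)

theorem IsPrimitive.tendsto_zero {f g : ℝ → ℝ} (h : IsPrimitive f g) (hg : Integrable g)
    (hf : MemLp f 2 volume) : Tendsto f atBot (𝓝 0) ∧ Tendsto f atTop (𝓝 0) := by
  obtain ⟨r, hr⟩ := h.exists_tendsto_atBot hg
  obtain ⟨s, hs⟩ := h.exists_tendsto_atTop hg
  rw [tendsto_zero_of_memLp_two (Or.inr rfl) hf hr] at hr
  rw [tendsto_zero_of_memLp_two (Or.inl rfl) hf hs] at hs
  exact ⟨hr, hs⟩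

/-- The regularity and decay of the momentum `m`; `mx` is its derivative and `n` the derivative of
`mx`. -/
structure MomentumDecay (m mx n : ℝ → ℝ) : Prop where
  hasDerivAt : ∀ x, HasDerivAt m (mx x) x
  prim : IsPrimitive mx n
  two : MemLp m 2 volume
  weight1 : Weighted mx
  weight2 : Weighted n

section Speed

variable (m : ℝ → ℝ)

theorem q_sq (x : ℝ) : q m x ^ 2 = m x ^ 2 + 1 := Real.sq_sqrt (by positivity)

theorem one_le_q (x : ℝ) : 1 ≤ q m x :=
  Real.one_le_sqrt.2 (by nlinarith [sq_nonneg (m x)])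

theorem q_pos (x : ℝ) : 0 < q m x := zero_lt_one.trans_le (one_le_q m x)

theorem abs_le_q (x : ℝ) : |m x| ≤ q m x := Real.abs_le_sqrt (by linarith)

theorem q_sub_one_le (x : ℝ) : q m x - 1 ≤ m x ^ 2 := by
  nlinarith [q_sq m x, one_le_q m x]

end Speed

namespace MomentumDecay

variable {m mx n : ℝ → ℝ} (h : MomentumDecay m mx n)
include h

theorem continuous : Continuous m := continuous_iff_continuousAt.2 fun x => (h.hasDerivAt x).continuousAt

theorem continuous_deriv : Continuous mx := h.prim.continuous

theorem isPrimitive : IsPrimitive m mx := IsPrimitive.of_hasDerivAt h.hasDerivAt h.continuous_deriv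

theorem tendsto : Tendsto m atBot (𝓝 0) ∧ Tendsto m atTop (𝓝 0) :=
  h.isPrimitive.tendsto_zero h.weight1.integrable h.two

theorem tendsto_deriv : Tendsto mx atBot (𝓝 0) ∧ Tendsto mx atTop (𝓝 0) :=
  h.prim.tendsto_zero h.weight2.integrable h.weight1.two

/-- No weight on m is assumed. Hardy's inequality trades the weight x² on m_x for the weight x on m,
one power short of making xm integrable. -/
theorem id_mul_two : MemLp (fun x => x * m x) 2 volume := by
  have h1 : MemLp (fun x => x ^ (1 + 1) * mx x) 2 volume :=
    h.weight1.mul_le (by fun_prop) (c := 1) h.weight1.aestronglyMeasurable fun x => by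
      rw [one_mul, abs_mul, abs_of_nonneg (sq_nonneg x)]
      gcongr
      linarith
  simpa using memLp_pow_mul_of_deriv 1 h.hasDerivAt h.continuous_deriv h.tendsto.1 h.tendsto.2 h1

theorem integrable : Integrable m :=
  integrable_of_memLp_weight h.two.1 h.two h.id_mul_two

theorem abs_le (x : ℝ) : |m x| ≤ ∫ x, |mx x| := by
  simpa using h.isPrimitive.norm_sub_le h.weight1.integrable h.tendsto.1 x

theorem abs_deriv_le (x : ℝ) : |mx x| ≤ ∫ x, |n x| := by
  simpa using h.prim.norm_sub_le h.weight2.integrable h.tendsto_deriv.1 x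

theorem hasDerivAt_q (x : ℝ) : HasDerivAt (q m) (m x * mx x / q m x) x := by
  have h1 : HasDerivAt (fun x => m x ^ 2 + 1) (2 * m x * mx x) x :=
    (((h.hasDerivAt x).fun_pow 2).add_const 1).congr_deriv (by simp)
  have h2 : m x ^ 2 + 1 ≠ 0 := by positivity
  exact (h1.sqrt h2).congr_deriv (by rw [q]; ring)

theorem continuous_q : Continuous (q m) := by
  have := h.continuous
  unfold q; fun_prop

theorem integrable_q_sub_one : Integrable fun x => q m x - 1 := by
  have h2 := (memLp_two_iff_integrable_sq h.two.1).1 h.two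
  have := h.continuous_q
  refine h2.mono' (by fun_prop) (ae_of_all _ fun x => ?_)
  rw [Real.norm_of_nonneg (sub_nonneg.2 (one_le_q m x))]
  exact q_sub_one_le m x

theorem p_eq (x : ℝ) : p m x = x - (∫ y, (q m y - 1)) + ∫ y in Set.Iic x, (q m y - 1) := by
  have := intervalIntegral.integral_Iic_add_Ioi (b := x) h.integrable_q_sub_one.integrableOn
    h.integrable_q_sub_one.integrableOn
  rw [p, ← this]
  ring

theorem hasDerivAt_p (x : ℝ) : HasDerivAt (p m) (q m x) x := by
  have : p m = fun x => x - (∫ y, (q m y - 1)) + ∫ y in Set.Iic x, (q m y - 1) :=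
    funext h.p_eq
  rw [this]
  have hc := h.continuous_q
  exact (((hasDerivAt_id x).sub_const _).add
    (hasDerivAt_integral_Iic (by fun_prop) h.integrable_q_sub_one x)).congr_deriv (by ring)

theorem abs_p_le (x : ℝ) : |p m x| ≤ |x| + ∫ y, (q m y - 1) := by
  have h0 : ∀ y, 0 ≤ q m y - 1 := fun y => sub_nonneg.2 (one_le_q m y)
  unfold p
  refine (abs_sub _ _).trans ?_
  rw [abs_of_nonneg (integral_nonneg h0)]
  refine add_le_add le_rfl ?_
  exact setIntegral_le_integral h.integrable_q_sub_one (ae_of_all _ h0)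

end MomentumDecay

theorem abs_div_le_of_one_le {a b c : ℝ} (hb : 1 ≤ b) (h : |a| ≤ c) : |a / b| ≤ c := by
  rw [abs_div, abs_of_pos (zero_lt_one.trans_le hb)]
  exact (div_le_self (abs_nonneg _) hb).trans h

theorem one_le_two_mul_q_pow (m : ℝ → ℝ) (k : ℕ) (x : ℝ) : 1 ≤ 2 * q m x ^ k := by
  have := one_le_pow₀ (n := k) (one_le_q m x)
  linarith

theorem two_mul_q_pow_ne_zero (m : ℝ → ℝ) (k : ℕ) (x : ℝ) : 2 * q m x ^ k ≠ 0 :=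
  (zero_lt_one.trans_le (one_le_two_mul_q_pow m k x)).ne'

theorem abs_div_two_mul_q_pow_le (m : ℝ → ℝ) (k : ℕ) (x a : ℝ) : |a / (2 * q m x ^ k)| ≤ |a| :=
  abs_div_le_of_one_le (one_le_two_mul_q_pow m k x) le_rfl

namespace MomentumDecay

variable {m mx n : ℝ → ℝ} (h : MomentumDecay m mx n)
include h

theorem continuous_div_q {f : ℝ → ℝ} (hf : Continuous f) (k : ℕ) :
    Continuous fun x => f x / (2 * q m x ^ k) :=
  hf.div (continuous_const.mul (h.continuous_q.pow k)) (two_mul_q_pow_ne_zero m k)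

/-- The coefficients determined by the momentum. -/
noncomputable def toCoeffs : Coeffs where
  p := p m
  q := q m
  -- The exponent 1 keeps all coefficients in the common shape f/(2qᵏ), to which one continuity
  -- lemma and one bound apply.
  A x := m x ^ 2 / (2 * q m x ^ 1)
  B x := m x / (2 * q m x ^ 1)
  G x := mx x / (2 * q m x ^ 2)
  hp := h.hasDerivAt_p
  hq := one_le_q m
  hA := h.continuous_div_q (h.continuous.pow 2) 1
  hB := h.continuous_div_q h.continuous 1
  hG := h.continuous_div_q h.continuous_deriv 2
  iA := ((memLp_two_iff_integrable_sq h.two.1).1 h.two).mono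
    (h.continuous_div_q (h.continuous.pow 2) 1).aestronglyMeasurable
    (ae_of_all _ fun x => abs_div_two_mul_q_pow_le m 1 x _)
  iB := h.integrable.mono (h.continuous_div_q h.continuous 1).aestronglyMeasurable
    (ae_of_all _ fun x => abs_div_two_mul_q_pow_le m 1 x _)
  iG := h.weight1.integrable.mono (h.continuous_div_q h.continuous_deriv 2).aestronglyMeasurable
    (ae_of_all _ fun x => abs_div_two_mul_q_pow_le m 2 x _)

theorem abs_A_le (x : ℝ) : |h.toCoeffs.A x| ≤ m x ^ 2 :=
  (abs_div_two_mul_q_pow_le m 1 x _).trans (abs_of_nonneg (sq_nonneg _)).le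

theorem abs_B_le (x : ℝ) : |h.toCoeffs.B x| ≤ |m x| := abs_div_two_mul_q_pow_le m 1 x _

theorem abs_G_le (x : ℝ) : |h.toCoeffs.G x| ≤ |mx x| := abs_div_two_mul_q_pow_le m 2 x _

theorem weighted_G : Weighted h.toCoeffs.G :=
  h.weight1.mono (c := 1) h.toCoeffs.hG.aestronglyMeasurable fun x => by
    rw [one_mul]; exact h.abs_G_le x

theorem memLp_B : MemLp h.toCoeffs.B 2 volume :=
  h.two.mono h.toCoeffs.hB.aestronglyMeasurable (ae_of_all _ h.abs_B_le)

theorem memLp_id_mul_B : MemLp (fun x => x * h.toCoeffs.B x) 2 volume := by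
  refine h.id_mul_two.mono (continuous_id.mul h.toCoeffs.hB).aestronglyMeasurable
    (ae_of_all _ fun x => ?_)
  rw [norm_mul, norm_mul]
  exact mul_le_mul_of_nonneg_left (h.abs_B_le x) (norm_nonneg _)

/-- m is bounded, so A ≤ m² is at most a constant times |m|, and xm is in L². -/
theorem memLp_id_mul_A : MemLp (fun x => x * h.toCoeffs.A x) 2 volume := by
  refine MemLp.of_le_mul (c := ∫ x, |mx x|) h.id_mul_two
    (continuous_id.mul h.toCoeffs.hA).aestronglyMeasurable (ae_of_all _ fun x => ?_)
  rw [norm_mul, norm_mul, Real.norm_eq_abs, Real.norm_eq_abs, Real.norm_eq_abs]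
  have h1 : |h.toCoeffs.A x| ≤ (∫ x, |mx x|) * |m x| := by
    refine (h.abs_A_le x).trans ?_
    rw [← sq_abs, sq]
    exact mul_le_mul_of_nonneg_right (h.abs_le x) (abs_nonneg _)
  calc _ ≤ |x| * ((∫ x, |mx x|) * |m x|) := mul_le_mul_of_nonneg_left h1 (abs_nonneg _)
    _ = _ := by ring

theorem memLp_id_mul_ρ : MemLp (fun x => x * h.toCoeffs.ρ x) 2 volume := by
  have h1 := (h.memLp_id_mul_A.norm.add h.memLp_id_mul_B.norm).add h.weighted_G.id_mul_two.norm
  refine h1.mono (continuous_id.mul h.toCoeffs.continuous_ρ).aestronglyMeasurable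
    (ae_of_all _ fun x => ?_)
  simp only [Pi.add_apply, norm_mul, Real.norm_eq_abs, Coeffs.ρ]
  rw [← mul_add, ← mul_add, abs_mul, abs_abs]

theorem memLp_p_mul_B : MemLp (fun x => h.toCoeffs.p x * h.toCoeffs.B x) 2 volume :=
  memLp_phase_mul h.memLp_B h.memLp_id_mul_B h.toCoeffs.continuous_p h.abs_p_le

theorem hasDerivAt_K_factor (x : ℝ) : HasDerivAt (fun x => (2 * q m x ^ 3)⁻¹)
    (-(3 * m x * mx x) / (2 * q m x ^ 5)) x := by
  have h0 := (q_pos m x).ne'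
  refine ((((h.hasDerivAt_q x).fun_pow 3).const_mul 2).fun_inv (by positivity)).congr_deriv ?_
  field_simp
  ring

/-- The derivative of `m_x / (2 q³)`. -/
noncomputable def K1 (_ : MomentumDecay m mx n) (x : ℝ) : ℝ :=
  mx x * (-(3 * m x * mx x) / (2 * q m x ^ 5)) + n x * (2 * q m x ^ 3)⁻¹

theorem isPrimitive_K : IsPrimitive (fun x => mx x / (2 * q m x ^ 3)) h.K1 := by
  have hc := h.continuous
  have hc' := h.continuous_deriv
  have h1 := IsPrimitive.of_hasDerivAt h.hasDerivAt_K_factor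
    (h.continuous_div_q (f := fun x => -(3 * m x * mx x)) (by fun_prop) 5)
  have h2 := h1.mul_real h.prim
  have e1 : (fun x => mx x / (2 * q m x ^ 3)) = fun x => (2 * q m x ^ 3)⁻¹ * mx x :=
    funext fun x => by rw [div_eq_mul_inv, mul_comm]
  rw [e1]
  exact h2.congr (ae_of_all _ fun x => by simp only [K1]; ring)

/-- The quadratic term in m_x is reduced to a weighted linear one by the sup bound on m_x, the L¹
norm of its derivative. -/
theorem weighted_K1 : Weighted h.K1 := by
  have h1 := h.weight2.abs.add (h.weight1.abs.const_mul (2 * ∫ x, |n x|))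
  refine h1.mono (c := 1) ?_ fun x => ?_
  · exact h.isPrimitive_K.1.aestronglyMeasurable
  have hN : 0 ≤ ∫ x, |n x| := integral_nonneg fun x => abs_nonneg _
  rw [one_mul, abs_of_nonneg (a := |n x| + _) (by positivity), K1, add_comm]
  refine (abs_add_le _ _).trans (add_le_add ?_ ?_)
  · rw [← div_eq_mul_inv]
    exact abs_div_le_of_one_le (one_le_two_mul_q_pow m 3 x) le_rfl
  · have hq := q_pos m x
    have e1 : |-(3 * m x * mx x) / (2 * q m x ^ 5)| ≤ 2 * |mx x| := by
      rw [abs_div, abs_neg, abs_mul, abs_mul, abs_of_pos (by positivity : 0 < 2 * q m x ^ 5),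
        abs_of_pos (by norm_num : (0 : ℝ) < 3), div_le_iff₀ (by positivity)]
      have e2 : |m x| ≤ q m x ^ 5 := (abs_le_q m x).trans (le_self_pow₀ (one_le_q m x) (by norm_num))
      nlinarith [mul_le_mul_of_nonneg_right e2 (abs_nonneg (mx x)),
        mul_nonneg (pow_nonneg hq.le 5) (abs_nonneg (mx x))]
    rw [abs_mul]
    calc _ ≤ (∫ x, |n x|) * (2 * |mx x|) :=
          mul_le_mul (h.abs_deriv_le x) e1 (abs_nonneg _) hN
      _ = _ := by ring

theorem weighted_K : Weighted fun x => mx x / (2 * q m x ^ 3) :=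
  h.weight1.mono (c := 1) h.isPrimitive_K.continuous.aestronglyMeasurable fun x => by
    rw [one_mul]; exact abs_div_two_mul_q_pow_le m 3 x _

/-- The derivative of `p m_x / (2 q³)`. -/
noncomputable def K2 (x : ℝ) : ℝ := q m x * (mx x / (2 * q m x ^ 3)) + p m x * h.K1 x

omit h in
theorem q_mul_K (x : ℝ) : q m x * (mx x / (2 * q m x ^ 3)) = mx x / (2 * q m x ^ 2) := by
  have := (q_pos m x).ne'
  field_simp

theorem isPrimitive_pK : IsPrimitive (fun x => p m x * (mx x / (2 * q m x ^ 3))) h.K2 :=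
  (IsPrimitive.of_hasDerivAt h.hasDerivAt_p h.continuous_q).mul_real h.isPrimitive_K

theorem K2_eq : h.K2 = fun x => h.toCoeffs.G x + p m x * h.K1 x :=
  funext fun x => by rw [K2, q_mul_K]; rfl

theorem integrable_K2 : Integrable h.K2 := by
  rw [h.K2_eq]
  exact h.toCoeffs.iG.add (h.weighted_K1.phase_mul_integrable h.toCoeffs.continuous_p h.abs_p_le)

theorem memLp_K2 : MemLp h.K2 2 volume := by
  rw [h.K2_eq]
  exact h.weighted_G.two.add (memLp_phase_mul h.weighted_K1.two h.weighted_K1.id_mul_two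
    h.toCoeffs.continuous_p h.abs_p_le)

theorem tendsto_K : Tendsto (fun x => mx x / (2 * q m x ^ 3)) atBot (𝓝 0) ∧
    Tendsto (fun x => mx x / (2 * q m x ^ 3)) atTop (𝓝 0) :=
  h.isPrimitive_K.tendsto_zero h.weighted_K1.integrable h.weighted_K.two

theorem tendsto_pK : Tendsto (fun x => p m x * (mx x / (2 * q m x ^ 3))) atBot (𝓝 0) ∧
    Tendsto (fun x => p m x * (mx x / (2 * q m x ^ 3))) atTop (𝓝 0) :=
  h.isPrimitive_pK.tendsto_zero h.integrable_K2
    (memLp_phase_mul h.weighted_K.two h.weighted_K.id_mul_two h.toCoeffs.continuous_p h.abs_p_le)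

/-- The derivative of `m / (2 q²)`. -/
noncomputable def L1 (_ : MomentumDecay m mx n) (x : ℝ) : ℝ :=
  mx x / (2 * q m x ^ 2) - 2 * m x ^ 2 * mx x / (2 * q m x ^ 4)

theorem hasDerivAt_L (x : ℝ) : HasDerivAt (fun x => m x / (2 * q m x ^ 2)) (h.L1 x) x := by
  have h0 := (q_pos m x).ne'
  refine ((h.hasDerivAt x).fun_div (((h.hasDerivAt_q x).fun_pow 2).const_mul 2)
    (by positivity)).congr_deriv ?_
  rw [L1]
  field_simp
  ring

theorem continuous_L1 : Continuous h.L1 := by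
  have hc := h.continuous
  have hc' := h.continuous_deriv
  exact (h.continuous_div_q hc' 2).sub
    (h.continuous_div_q (f := fun x => 2 * m x ^ 2 * mx x) (by fun_prop) 4)

theorem weighted_L1 : Weighted h.L1 := by
  refine h.weight1.mono (c := 2) h.continuous_L1.aestronglyMeasurable fun x => ?_
  have h1 := abs_div_two_mul_q_pow_le m 2 x (mx x)
  have h2 : |2 * m x ^ 2 * mx x / (2 * q m x ^ 4)| ≤ |mx x| := by
    have hq := one_le_q m x
    have e : m x ^ 2 ≤ q m x ^ 4 := by nlinarith [q_sq m x, sq_nonneg (m x)]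
    rw [abs_div, abs_mul, abs_of_nonneg (by positivity : 0 ≤ 2 * m x ^ 2),
      abs_of_pos (by positivity : 0 < 2 * q m x ^ 4), div_le_iff₀ (by positivity)]
    nlinarith [mul_le_mul_of_nonneg_right e (abs_nonneg (mx x))]
  rw [L1]
  refine (abs_sub _ _).trans ?_
  linarith

theorem tendsto_L : Tendsto (fun x => m x / (2 * q m x ^ 2)) atBot (𝓝 0) ∧
    Tendsto (fun x => m x / (2 * q m x ^ 2)) atTop (𝓝 0) := by
  refine (IsPrimitive.of_hasDerivAt h.hasDerivAt_L h.continuous_L1).tendsto_zero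
    h.weighted_L1.integrable (h.two.mono (h.continuous_div_q h.continuous 2).aestronglyMeasurable
      (ae_of_all _ fun x => abs_div_two_mul_q_pow_le m 2 x _))

/-- By Cauchy–Schwarz: pB is in L², and since xρ is in L², Hardy's inequality with k = 0 puts the
tail of ρ in L² on the half-line. -/
theorem integrableOn_tail_neg : IntegrableOn (fun x => h.toCoeffs.p x * h.toCoeffs.B x *
    ∫ t in Set.Iic x, h.toCoeffs.ρ t) (Set.Iic 0) := by
  set D := h.toCoeffs
  have hd := fun x => hasDerivAt_integral_Iic D.continuous_ρ D.integrable_ρ x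
  have hlim : Tendsto (fun x => ∫ t in Set.Iic x, D.ρ t) atBot (𝓝 0) :=
    tendsto_integral_Iic_zero tendsto_id
  have h2 := hardy_Iio 0 hd D.continuous_ρ hlim (by
    simpa using ((memLp_two_iff_integrable_sq h.memLp_id_mul_ρ.1).1 h.memLp_id_mul_ρ).integrableOn)
  have hc : Continuous fun x => ∫ t in Set.Iic x, D.ρ t :=
    continuous_iff_continuousAt.2 fun x => (hd x).continuousAt
  rw [← integrableOn_Iic_iff_integrableOn_Iio] at h2
  have h3 : MemLp (fun x => ∫ t in Set.Iic x, D.ρ t) 2 (volume.restrict (Set.Iic 0)) := by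
    rw [memLp_two_iff_integrable_sq hc.aestronglyMeasurable]
    simpa [IntegrableOn] using h2
  exact (h.memLp_p_mul_B.restrict _).integrable_mul h3

theorem integrableOn_tail_pos : IntegrableOn (fun x => h.toCoeffs.p x * h.toCoeffs.B x *
    ∫ t in Set.Ioi x, h.toCoeffs.ρ t) (Set.Ioi 0) := by
  set D := h.toCoeffs
  have e : ∀ x, ∫ t in Set.Ioi x, D.ρ t = (∫ t, D.ρ t) - ∫ t in Set.Iic x, D.ρ t := fun x => by
    have := intervalIntegral.integral_Iic_add_Ioi (b := x) D.integrable_ρ.integrableOn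
      D.integrable_ρ.integrableOn
    rw [← this]; ring
  have hd : ∀ x, HasDerivAt (fun x => ∫ t in Set.Ioi x, D.ρ t) (-D.ρ x) x := fun x => by
    simp only [e]
    exact (hasDerivAt_integral_Iic D.continuous_ρ D.integrable_ρ x).const_sub _
  have hlim : Tendsto (fun x => ∫ t in Set.Ioi x, D.ρ t) atTop (𝓝 0) :=
    tendsto_integral_Ioi_zero tendsto_id
  have h2 := hardy_Ioi 0 hd D.continuous_ρ.neg hlim (by
    simpa using ((memLp_two_iff_integrable_sq h.memLp_id_mul_ρ.1).1 h.memLp_id_mul_ρ).integrableOn)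
  have hc : Continuous fun x => ∫ t in Set.Ioi x, D.ρ t :=
    continuous_iff_continuousAt.2 fun x => (hd x).continuousAt
  have h3 : MemLp (fun x => ∫ t in Set.Ioi x, D.ρ t) 2 (volume.restrict (Set.Ioi 0)) := by
    rw [memLp_two_iff_integrable_sq hc.aestronglyMeasurable]
    simpa [IntegrableOn] using h2
  exact (h.memLp_p_mul_B.restrict _).integrable_mul h3

/-- The regular coefficients determined by the momentum. -/
noncomputable def toRegularCoeffs : RegularCoeffs where
  toCoeffs := h.toCoeffs
  K x := mx x / (2 * q m x ^ 3)
  K1 := h.K1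
  K2 := h.K2
  L x := m x / (2 * q m x ^ 2)
  L1 := h.L1
  hK x := (q_mul_K x).symm
  primK := h.isPrimitive_K
  iK1 := h.weighted_K1.integrable
  K1_two := h.weighted_K1.two
  K_bot := h.tendsto_K.1
  K_top := h.tendsto_K.2
  ipG := h.weighted_G.phase_mul_integrable h.toCoeffs.continuous_p h.abs_p_le
  primpK := h.isPrimitive_pK
  iK2 := h.integrable_K2
  K2_two := h.memLp_K2
  pK_bot := h.tendsto_pK.1
  pK_top := h.tendsto_pK.2
  hL x := by
    have := (q_pos m x).ne'
    simp only [toCoeffs]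
    field_simp
  derivL := h.hasDerivAt_L
  iL1 := h.weighted_L1.integrable
  ipL1 := h.weighted_L1.phase_mul_integrable h.toCoeffs.continuous_p h.abs_p_le
  L_bot := h.tendsto_L.1
  L_top := h.tendsto_L.2
  B_two := h.memLp_B
  pB_two := h.memLp_p_mul_B
  tail_neg := h.integrableOn_tail_neg
  tail_pos := h.integrableOn_tail_pos

end MomentumDecay

/-! ### Jost functions and scattering matrices -/

namespace Coeffs

variable (D : Coeffs)

theorem e_ne_zero (θ x : ℝ) : D.e θ x ≠ 0 := Complex.exp_ne_zero _

theorem e_neg_mul_e (θ x : ℝ) : D.e (-θ) x * D.e θ x = 1 := by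
  rw [mul_comm, e_mul_e_neg]

theorem hasDerivAt_e_mul {f : ℝ → ℂ} {d : ℂ} {x : ℝ} (θ : ℝ) (h : HasDerivAt f d x) :
    HasDerivAt (fun x => D.e θ x * f x) (D.e θ x * (2 * Complex.I * θ * D.q x * f x + d)) x :=
  ((D.hasDerivAt_e θ x).mul h).congr_deriv (by ring)

theorem tendsto_e_mul_zero {f : ℝ → ℂ} {l : Filter ℝ} (θ : ℝ) (h : Tendsto f l (𝓝 0)) :
    Tendsto (fun x => D.e θ x * f x) l (𝓝 0) := by
  rw [tendsto_zero_iff_norm_tendsto_zero] at h ⊢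
  simpa [norm_e] using h

/-- A fundamental matrix of the scalar system with limit `1` along `l`. -/
structure IsNormalized (z : ℝ) (l : Filter ℝ) (w11 w21 w12 w22 : ℝ → ℂ) : Prop where
  left : D.IsSol z w11 w21
  right : D.IsSol z w12 w22
  t11 : Tendsto w11 l (𝓝 1)
  t21 : Tendsto w21 l (𝓝 0)
  t12 : Tendsto w12 l (𝓝 0)
  t22 : Tendsto w22 l (𝓝 1)

variable {D} {z : ℝ} {w1 w2 : ℝ → ℂ} {a b : ℂ}

theorem IsJostPair.isNormalized_atBot (h : D.IsJostPair z w1 w2 a b) :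
    D.IsNormalized z atBot w1 w2 (fun x => -star (w2 x)) (fun x => star (w1 x)) :=
  ⟨h.sol, h.sol.conj, h.bot1, h.bot2, by simpa using h.bot2.star.neg, by simpa using h.bot1.star⟩

theorem IsJostPair.star_mul_add (h : D.IsJostPair z w1 w2 a b) :
    a * star a + b * star b = 1 := by
  rw [Complex.star_def, Complex.mul_conj', Complex.mul_conj']
  exact_mod_cast h.normSq_top

/-- The fundamental matrix normalized at −∞ has limit S at +∞. Since S is unitary of determinant 1,
multiplying on the right by its adjoint normalizes at +∞. -/
theorem IsJostPair.isNormalized_atTop (h : D.IsJostPair z w1 w2 a b) :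
    D.IsNormalized z atTop (fun x => w1 x * star a + -star (w2 x) * -b)
      (fun x => w2 x * star a + star (w1 x) * -b)
      (fun x => w1 x * star b + -star (w2 x) * a)
      (fun x => w2 x * star b + star (w1 x) * a) := by
  have hn := h.star_mul_add
  have t1 := h.top1
  have t2 := h.top2
  refine ⟨h.sol.comb h.sol.conj _ _, h.sol.comb h.sol.conj _ _, ?_, ?_, ?_, ?_⟩
  · have := (t1.mul_const (star a)).add (t2.star.neg.mul_const (-b))
    rwa [show a * star a + -star b * -b = 1 by linear_combination hn] at this
  · have := (t2.mul_const (star a)).add (t1.star.mul_const (-b))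
    rwa [show b * star a + star a * -b = 0 by ring] at this
  · have := (t1.mul_const (star b)).add (t2.star.neg.mul_const a)
    rwa [show a * star b + -star b * a = 0 by ring] at this
  · have := (t2.mul_const (star b)).add (t1.star.mul_const a)
    rwa [show b * star b + star a * a = 1 by linear_combination hn] at this

theorem IsJostPair.unique {w1' w2' : ℝ → ℂ} {a' b' : ℂ} (h : D.IsJostPair z w1 w2 a b)
    (h' : D.IsJostPair z w1' w2' a' b') : a = a' ∧ b = b' := by
  obtain ⟨rfl, rfl⟩ := h.sol.eq_of_tendsto h'.sol h.bot1 h.bot2 h'.bot1 h'.bot2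
  exact ⟨tendsto_nhds_unique h.top1 h'.top1, tendsto_nhds_unique h.top2 h'.top2⟩

theorem IsNormalized.unique {l : Filter ℝ} [l.NeBot] {w11 w21 w12 w22 v11 v21 v12 v22 : ℝ → ℂ}
    (h : D.IsNormalized z l w11 w21 w12 w22) (h' : D.IsNormalized z l v11 v21 v12 v22) :
    (w11 = v11 ∧ w21 = v21) ∧ w12 = v12 ∧ w22 = v22 :=
  ⟨h.left.eq_of_tendsto h'.left h.t11 h.t21 h'.t11 h'.t21,
    h.right.eq_of_tendsto h'.right h.t12 h.t22 h'.t12 h'.t22⟩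

end Coeffs

namespace MomentumDecay

open Coeffs

variable {m mx n : ℝ → ℝ} (h : MomentumDecay m mx n) {z : ℝ}
include h

theorem P_eq (x : ℝ) : P m z x = !![h.toCoeffs.c11 z x, Complex.I * h.toCoeffs.G x + h.toCoeffs.B x / z;
    Complex.I * h.toCoeffs.G x - h.toCoeffs.B x / z, -h.toCoeffs.c11 z x] := by
  rw [P, (h.hasDerivAt x).deriv]
  ext i j
  fin_cases i <;> fin_cases j <;> simp [σ₁, c11, toCoeffs] <;> ring

/-- The commutator with σ₃ acts only on off-diagonal entries, where it is exactly the logarithmic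
derivative of the phase factor. Multiplying those entries by e^{±2iθp} removes it, and since the
factors are unimodular the limits 0 are unaffected. -/
theorem isJost_iff {l : Filter ℝ} {μ : ℝ → Matrix (Fin 2) (Fin 2) ℂ} :
    IsJost m z l μ ↔ h.toCoeffs.IsNormalized z l (fun x => μ x 0 0)
      (fun x => h.toCoeffs.e (-freq z) x * μ x 1 0) (fun x => h.toCoeffs.e (freq z) x * μ x 0 1)
      (fun x => μ x 1 1) := by
  set D := h.toCoeffs with hD
  have hq : ∀ x, q m x = D.q x := fun x => rfl
  have eqs : ∀ x, -(Complex.I / 4 * (z - 1 / z) * q m x) • (σ₃ * μ x - μ x * σ₃) + P m z x * μ x =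
      !![D.c11 z x * μ x 0 0 + (Complex.I * D.G x + D.B x / z) * μ x 1 0,
        -(2 * Complex.I * freq z * D.q x * μ x 0 1) + D.c11 z x * μ x 0 1 +
          (Complex.I * D.G x + D.B x / z) * μ x 1 1;
        2 * Complex.I * freq z * D.q x * μ x 1 0 + (Complex.I * D.G x - D.B x / z) * μ x 0 0 -
          D.c11 z x * μ x 1 0,
        (Complex.I * D.G x - D.B x / z) * μ x 0 1 - D.c11 z x * μ x 1 1] := fun x => by
    rw [h.P_eq, ← hD, hq]
    ext i j
    fin_cases i <;> fin_cases j <;>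
      simp [σ₃, Matrix.mul_apply, Fin.sum_univ_two, Matrix.vecMul, dotProduct, freq] <;> ring
  have k1 : ∀ x, D.e (freq z) x * D.e (-freq z) x = 1 := fun x => D.e_mul_e_neg _ x
  have cast : (((-freq z : ℝ)) : ℂ) = -(freq z : ℂ) := by push_cast; rfl
  constructor
  · rintro ⟨hd, ht⟩
    have ht' : ∀ i j, Tendsto (fun x => μ x i j) l (𝓝 ((1 : Matrix (Fin 2) (Fin 2) ℂ) i j)) :=
      fun i j => tendsto_pi_nhds.1 (tendsto_pi_nhds.1 ht i) j
    simp only [eqs] at hd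
    refine ⟨fun x => ⟨?_, ?_⟩, fun x => ⟨?_, ?_⟩, ?_, ?_, ?_, ?_⟩
    · refine (hd x 0 0).congr_deriv ?_
      simp only [c12, Matrix.of_apply, Matrix.cons_val', Matrix.cons_val_zero]
      linear_combination (-(Complex.I * D.G x + D.B x / z) * μ x 1 0) * k1 x
    · refine (D.hasDerivAt_e_mul (-freq z) (hd x 1 0)).congr_deriv ?_
      simp [c21, cast]
      ring
    · refine (D.hasDerivAt_e_mul (freq z) (hd x 0 1)).congr_deriv ?_
      simp [c12]
      ring
    · refine (hd x 1 1).congr_deriv ?_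
      simp [c21]
      linear_combination (-(Complex.I * D.G x - D.B x / z) * μ x 0 1) * k1 x
    · simpa using ht' 0 0
    · exact D.tendsto_e_mul_zero _ (by simpa using ht' 1 0)
    · exact D.tendsto_e_mul_zero _ (by simpa using ht' 0 1)
    · simpa using ht' 1 1
  · rintro ⟨hl, hr, t11, t21, t12, t22⟩
    have e10 : ∀ x, D.e (freq z) x * (D.e (-freq z) x * μ x 1 0) = μ x 1 0 := fun x => by
      rw [← mul_assoc, k1, one_mul]
    have e01 : ∀ x, D.e (-freq z) x * (D.e (freq z) x * μ x 0 1) = μ x 0 1 := fun x => by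
      rw [← mul_assoc, e_neg_mul_e, one_mul]
    refine ⟨fun x i j => ?_, ?_⟩
    · rw [eqs]
      fin_cases i <;> fin_cases j
      · refine (hl x).1.congr_deriv ?_
        simp [c12]
        linear_combination ((Complex.I * D.G x + D.B x / z) * μ x 1 0) * k1 x
      · have := D.hasDerivAt_e_mul (-freq z) (hr x).1
        simp only [e01] at this
        refine this.congr_deriv ?_
        simp [c12, cast]
        linear_combination (-(2 * Complex.I * freq z * D.q x * μ x 0 1) + D.c11 z x * μ x 0 1 +
          (Complex.I * D.G x + D.B x / z) * μ x 1 1) * k1 x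
      · have := D.hasDerivAt_e_mul (freq z) (hl x).2
        simp only [e10] at this
        refine this.congr_deriv ?_
        simp [c21]
        linear_combination (2 * Complex.I * freq z * D.q x * μ x 1 0 +
          (Complex.I * D.G x - D.B x / z) * μ x 0 0 - D.c11 z x * μ x 1 0) * k1 x
      · refine (hr x).2.congr_deriv ?_
        simp [c21]
        linear_combination ((Complex.I * D.G x - D.B x / z) * μ x 0 1) * k1 x
    · refine tendsto_pi_nhds.2 fun i => tendsto_pi_nhds.2 fun j => ?_
      have s10 := D.tendsto_e_mul_zero (freq z) t21
      have s01 := D.tendsto_e_mul_zero (-freq z) t12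
      simp only [e10] at s10
      simp only [e01] at s01
      fin_cases i <;> fin_cases j
      · simpa using t11
      · simpa using s01
      · simpa using s10
      · simpa using t22

theorem isJost_unique {l : Filter ℝ} [l.NeBot] {μ ν : ℝ → Matrix (Fin 2) (Fin 2) ℂ}
    (hμ : IsJost m z l μ) (hν : IsJost m z l ν) : μ = ν := by
  obtain ⟨⟨h1, h2⟩, h3, h4⟩ := (h.isJost_iff.1 hμ).unique (h.isJost_iff.1 hν)
  funext x
  ext i j
  fin_cases i <;> fin_cases j
  · exact congrFun h1 x
  · exact mul_left_cancel₀ (e_ne_zero _ _ _) (congrFun h3 x)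
  · exact mul_left_cancel₀ (e_ne_zero _ _ _) (congrFun h2 x)
  · exact congrFun h4 x

theorem isJost_of_isNormalized {l : Filter ℝ} {w11 w21 w12 w22 : ℝ → ℂ}
    (hw : h.toCoeffs.IsNormalized z l w11 w21 w12 w22) :
    IsJost m z l fun x => !![w11 x, h.toCoeffs.e (-freq z) x * w12 x;
      h.toCoeffs.e (freq z) x * w21 x, w22 x] := by
  rw [h.isJost_iff]
  simpa [← mul_assoc, e_mul_e_neg, e_neg_mul_e] using hw

/-- The unimodular oscillating diagonal factor. -/
theorem Phi_eq (μ : ℝ → Matrix (Fin 2) (Fin 2) ℂ) (x : ℝ) :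
    Phi m z μ x = F m x * !![Complex.exp (-(Complex.I * freq z * p m x)), 0;
        0, Complex.exp (Complex.I * freq z * p m x)] *
      !![μ x 0 0, h.toCoeffs.e (freq z) x * μ x 0 1;
        h.toCoeffs.e (-freq z) x * μ x 1 0, μ x 1 1] := by
  rw [Phi, mul_assoc (F m x), mul_assoc (F m x)]
  congr 1
  have e1 : Complex.I / 4 * (z - 1 / z) * p m x = Complex.I * freq z * p m x := by
    simp only [freq]; push_cast; ring
  have e2 : Complex.exp (-(Complex.I * freq z * p m x)) * h.toCoeffs.e (freq z) x =
      Complex.exp (Complex.I * freq z * p m x) := by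
    rw [e, ← Complex.exp_add]
    congr 1
    simp only [toCoeffs]; ring
  have e3 : Complex.exp (Complex.I * freq z * p m x) * h.toCoeffs.e (-freq z) x =
      Complex.exp (-(Complex.I * freq z * p m x)) := by
    rw [e, ← Complex.exp_add]
    congr 1
    simp only [toCoeffs]; push_cast; ring
  rw [e1]
  ext i j
  fin_cases i <;> fin_cases j <;> simp [Matrix.mul_apply, Fin.sum_univ_two]
  · ring
  · linear_combination (-μ x 0 1) * e2
  · linear_combination (-μ x 1 0) * e3
  · ring

omit h in
theorem isUnit_F (x : ℝ) : IsUnit (F m x) := by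
  rw [Matrix.isUnit_iff_isUnit_det, isUnit_iff_ne_zero, F, Matrix.det_smul, Matrix.det_fin_two_of]
  have hq := q_pos m x
  have h1 : (1 * 1 - -Complex.I * m x / (q m x + 1) * (-Complex.I * m x / (q m x + 1)) : ℂ) =
      ((1 + m x ^ 2 / (q m x + 1) ^ 2 : ℝ) : ℂ) := by
    have h2 : -Complex.I * m x * (-Complex.I * m x) = -(m x : ℂ) ^ 2 := by
      linear_combination (m x : ℂ) ^ 2 * Complex.I_sq
    rw [div_mul_div_comm, h2]
    push_cast
    ring
  rw [h1]
  refine mul_ne_zero (pow_ne_zero _ ?_) ?_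
  · rw [Complex.ofReal_ne_zero, Real.sqrt_ne_zero']
    positivity
  · rw [Complex.ofReal_ne_zero]
    positivity

/-- Both sides share the invertible left factor made of the gauge F and the diagonal exponentials,
so it cancels and the relation becomes one between fundamental matrices of the scalar system. -/
theorem Phi_eq_iff {μ ν : ℝ → Matrix (Fin 2) (Fin 2) ℂ} {S : Matrix (Fin 2) (Fin 2) ℂ} {x : ℝ} :
    Phi m z μ x = Phi m z ν x * S ↔
      !![μ x 0 0, h.toCoeffs.e (freq z) x * μ x 0 1;
        h.toCoeffs.e (-freq z) x * μ x 1 0, μ x 1 1] =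
      !![ν x 0 0, h.toCoeffs.e (freq z) x * ν x 0 1;
        h.toCoeffs.e (-freq z) x * ν x 1 0, ν x 1 1] * S := by
  have hE : IsUnit (!![Complex.exp (-(Complex.I * freq z * p m x)), 0;
        0, Complex.exp (Complex.I * freq z * p m x)]) := by
    rw [Matrix.isUnit_iff_isUnit_det, isUnit_iff_ne_zero, Matrix.det_fin_two_of]
    simp [Complex.exp_ne_zero]
  rw [h.Phi_eq, h.Phi_eq, mul_assoc _ _ S]
  exact ((isUnit_F x).mul hE).mul_right_inj

/-- The scattering matrix in terms of the normalized scalar solution. -/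
theorem isScatteringMatrix_iff {w1 w2 : ℝ → ℂ} {a b : ℂ}
    (hj : h.toCoeffs.IsJostPair z w1 w2 a b) {S : Matrix (Fin 2) (Fin 2) ℂ} :
    IsScatteringMatrix m z S ↔ S = !![a, -star b; b, star a] := by
  constructor
  · rintro ⟨μp, μm, hp, hm, hS⟩
    obtain ⟨⟨h1, h2⟩, h3, h4⟩ := (h.isJost_iff.1 hm).unique hj.isNormalized_atBot
    have hp' := h.isJost_iff.1 hp
    have hS' := fun x => h.Phi_eq_iff.1 (hS x)
    -- As x → +∞ the matrix normalized there tends to 1, so S is read off as the limit of the matrix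
    -- normalized at −∞.
    have lim : ∀ j, Tendsto (fun x => μp x 0 0 * S 0 j + h.toCoeffs.e (freq z) x * μp x 0 1 * S 1 j)
        atTop (𝓝 (S 0 j)) ∧ Tendsto (fun x => h.toCoeffs.e (-freq z) x * μp x 1 0 * S 0 j +
          μp x 1 1 * S 1 j) atTop (𝓝 (S 1 j)) := fun j => by
      constructor
      · simpa using (hp'.t11.mul_const (S 0 j)).add (hp'.t12.mul_const (S 1 j))
      · simpa using (hp'.t21.mul_const (S 0 j)).add (hp'.t22.mul_const (S 1 j))
    have ent : ∀ i j x, (!![μm x 0 0, h.toCoeffs.e (freq z) x * μm x 0 1;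
        h.toCoeffs.e (-freq z) x * μm x 1 0, μm x 1 1] : Matrix (Fin 2) (Fin 2) ℂ) i j =
        (!![μp x 0 0, h.toCoeffs.e (freq z) x * μp x 0 1;
        h.toCoeffs.e (-freq z) x * μp x 1 0, μp x 1 1] * S) i j := fun i j x => by rw [hS' x]
    simp only [Matrix.mul_apply, Fin.sum_univ_two] at ent
    have f1 : ∀ x, w1 x = μp x 0 0 * S 0 0 + h.toCoeffs.e (freq z) x * μp x 0 1 * S 1 0 :=
      fun x => by rw [← congrFun h1 x]; simpa using ent 0 0 x
    have f2 : ∀ x, w2 x = h.toCoeffs.e (-freq z) x * μp x 1 0 * S 0 0 + μp x 1 1 * S 1 0 :=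
      fun x => by rw [← congrFun h2 x]; simpa using ent 1 0 x
    have f3 : ∀ x, -star (w2 x) = μp x 0 0 * S 0 1 + h.toCoeffs.e (freq z) x * μp x 0 1 * S 1 1 :=
      fun x => by rw [← congrFun h3 x]; simpa using ent 0 1 x
    have f4 : ∀ x, star (w1 x) = h.toCoeffs.e (-freq z) x * μp x 1 0 * S 0 1 + μp x 1 1 * S 1 1 :=
      fun x => by rw [← congrFun h4 x]; simpa using ent 1 1 x
    ext i j
    fin_cases i <;> fin_cases j
    · exact tendsto_nhds_unique (lim 0).1 (by simp only [← f1]; exact hj.top1)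
    · exact tendsto_nhds_unique (lim 1).1 (by simp only [← f3]; exact hj.top2.star.neg)
    · exact tendsto_nhds_unique (lim 0).2 (by simp only [← f2]; exact hj.top2)
    · exact tendsto_nhds_unique (lim 1).2 (by simp only [← f4]; exact hj.top1.star)
  · rintro rfl
    refine ⟨_, _, h.isJost_of_isNormalized hj.isNormalized_atTop,
      h.isJost_of_isNormalized hj.isNormalized_atBot, fun x => h.Phi_eq_iff.2 ?_⟩
    have hn := hj.star_mul_add
    have k1 : ∀ x c, h.toCoeffs.e (freq z) x * (h.toCoeffs.e (-freq z) x * c) = c := fun x c => by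
      rw [← mul_assoc, e_mul_e_neg, one_mul]
    have k2 : ∀ x c, h.toCoeffs.e (-freq z) x * (h.toCoeffs.e (freq z) x * c) = c := fun x c => by
      rw [← mul_assoc, e_neg_mul_e, one_mul]
    ext i j
    fin_cases i <;> fin_cases j <;>
      simp only [Matrix.of_apply, Matrix.cons_val', Matrix.cons_val_zero, Matrix.cons_val_one,
        Matrix.mul_apply, Fin.sum_univ_two, Matrix.cons_val_fin_one, Fin.zero_eta, Fin.mk_one,
        k1, k2]
    · linear_combination (-w1 x) * hn
    · linear_combination star (w2 x) * hn
    · linear_combination (-w2 x) * hn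
    · linear_combination (-star (w1 x)) * hn

end MomentumDecay

/-! ### The symmetry `z ↦ -1/z` -/

theorem freq_neg_inv (z : ℝ) : freq (-1 / z) = freq z := by
  simp only [freq, one_div, neg_div, inv_neg, inv_inv]
  ring

namespace MomentumDecay

open Coeffs

variable {m mx n : ℝ → ℝ} (h : MomentumDecay m mx n) {z : ℝ}
include h

/-- The transformation is F⁻¹σ₃F, with rows (1, −im)/q and (im, −1)/q, written in the oscillating
coordinates. It expresses conjugation by σ₃ in the original Lax pair after the gauge F. -/
theorem isSol_inversion (hz : z ≠ 0) {w1 w2 : ℝ → ℂ} (hw : h.toCoeffs.IsSol z w1 w2) :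
    h.toCoeffs.IsSol (-1 / z)
      (fun x => (w1 x - Complex.I * m x * (h.toCoeffs.e (freq z) x * w2 x)) / q m x)
      (fun x => (Complex.I * m x * (h.toCoeffs.e (-freq z) x * w1 x) - w2 x) / q m x) := by
  intro x
  have hzc : (z : ℂ) ≠ 0 := by exact_mod_cast hz
  have hq0 : (q m x : ℂ) ≠ 0 := by exact_mod_cast (q_pos m x).ne'
  have hq2 : (q m x : ℂ) ^ 2 = (m x : ℂ) ^ 2 + 1 := by exact_mod_cast q_sq m x
  have hI : Complex.I ^ 2 = -1 := Complex.I_sq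
  have he0 := h.toCoeffs.e_ne_zero (freq z) x
  have hm := (h.hasDerivAt x).ofReal_comp
  have hq := (h.hasDerivAt_q x).ofReal_comp
  have he : h.toCoeffs.e (-freq z) x = (h.toCoeffs.e (freq z) x)⁻¹ :=
    eq_inv_of_mul_eq_one_left (h.toCoeffs.e_neg_mul_e _ _)
  have e1 := h.toCoeffs.hasDerivAt_e_mul (freq z) (hw x).2
  have e2 := h.toCoeffs.hasDerivAt_e_mul (-freq z) (hw x).1
  have d1 := ((hw x).1.sub ((hm.const_mul Complex.I).mul e1)).div hq hq0
  have d2 := (((hm.const_mul Complex.I).mul e2).sub (hw x).2).div hq hq0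
  refine ⟨d1.congr_deriv ?_, d2.congr_deriv ?_⟩
  -- Once all functions are replaced by independent letters, what remains is a rational identity
  -- modulo Q² = M² + 1 and J² = −1.
  all_goals
    simp only [c11, c12, c21, freq_neg_inv, Pi.sub_apply, Pi.mul_apply, he]
    generalize h.toCoeffs.e (freq z) x = E at he0
    simp only [toCoeffs, freq]
    push_cast
    generalize (m x : ℂ) = M at *
    generalize (mx x : ℂ) = N at *
    generalize (q m x : ℂ) = Q at *
    generalize (z : ℂ) = Z at *
    generalize w1 x = u at *
    generalize w2 x = v at *
    generalize Complex.I = J at *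
    clear d1 d2 e1 e2 he hm hq hw
    field_simp
    grind

/-- As m → 0 the gauge matrix tends to σ₃ at both ends, so the normalization at −∞ is kept and only
the second component changes sign. -/
theorem isJostPair_inversion (hz : z ≠ 0) {w1 w2 : ℝ → ℂ} {a b : ℂ}
    (hj : h.toCoeffs.IsJostPair z w1 w2 a b) : h.toCoeffs.IsJostPair (-1 / z)
      (fun x => (w1 x - Complex.I * m x * (h.toCoeffs.e (freq z) x * w2 x)) / q m x)
      (fun x => (Complex.I * m x * (h.toCoeffs.e (-freq z) x * w1 x) - w2 x) / q m x) a (-b) := by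
  have lim : ∀ {l : Filter ℝ} {c d : ℂ}, Tendsto m l (𝓝 0) → Tendsto w1 l (𝓝 c) →
      Tendsto w2 l (𝓝 d) →
      Tendsto (fun x => (w1 x - Complex.I * m x * (h.toCoeffs.e (freq z) x * w2 x)) / q m x) l
        (𝓝 c) ∧
      Tendsto (fun x => (Complex.I * m x * (h.toCoeffs.e (-freq z) x * w1 x) - w2 x) / q m x) l
        (𝓝 (-d)) := fun {l c d} hm h1 h2 => by
    have hq : Tendsto (fun x => (q m x : ℂ)) l (𝓝 1) := by
      have h3 : Tendsto (fun x => q m x) l (𝓝 (Real.sqrt (0 ^ 2 + 1))) :=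
        ((hm.pow 2).add_const 1).sqrt
      have h4 := (Complex.continuous_ofReal.tendsto _).comp h3
      simpa [Function.comp_def] using h4
    have hmc : Tendsto (fun x => (m x : ℂ)) l (𝓝 0) := by
      have h4 := (Complex.continuous_ofReal.tendsto _).comp hm
      simpa [Function.comp_def] using h4
    have hs : ∀ (θ : ℝ) {w : ℝ → ℂ} {c : ℂ}, Tendsto w l (𝓝 c) →
        Tendsto (fun x => Complex.I * m x * (h.toCoeffs.e θ x * w x)) l (𝓝 0) :=
      fun θ {w c} hw => by
        have h5 : Tendsto (fun x => Complex.I * m x * w x) l (𝓝 0) := by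
          simpa using (hmc.const_mul Complex.I).mul hw
        refine (h.toCoeffs.tendsto_e_mul_zero θ h5).congr fun x => by ring
    constructor
    · simpa [Pi.div_def] using (h1.sub (hs (freq z) h2)).div hq one_ne_zero
    · simpa [Pi.div_def] using ((hs (-freq z) h1).sub h2).div hq one_ne_zero
  obtain ⟨b1, b2⟩ := lim h.tendsto.1 hj.bot1 hj.bot2
  obtain ⟨t1, t2⟩ := lim h.tendsto.2 hj.top1 hj.top2
  exact ⟨h.isSol_inversion hz hj.sol, b1, by simpa using b2, t1, t2⟩

end MomentumDecay

end MCH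

theorem mainTheorem2 (u : ℝ → ℝ) (hu_cont : Continuous u) (hu : MCH.MemH 4 2 u) :
    (∀ z : ℝ, z ≠ 0 →
      (∃! μ, MCH.IsJost (MCH.momentum u) z atTop μ) ∧
      (∃! μ, MCH.IsJost (MCH.momentum u) z atBot μ) ∧
      ∃! S, MCH.IsScatteringMatrix (MCH.momentum u) z S) ∧
    ∀ S : ℝ → Matrix (Fin 2) (Fin 2) ℂ,
      (∀ z : ℝ, z ≠ 0 → MCH.IsScatteringMatrix (MCH.momentum u) z (S z)) →
      (∀ z : ℝ, z ≠ 0 → S z 0 0 ≠ 0) →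
      MCH.MemH 1 1 (fun z : ℝ => S z 1 0 / S z 0 0) ∧
      MemLp (fun z : ℝ => (z : ℂ) * (S z 1 0 / S z 0 0)) 2 volume := by
  obtain ⟨mx, n, h1, h2, h3, h4, h5⟩ := MCH.exists_momentum_regularity hu_cont hu
  have h : MCH.MomentumDecay (MCH.momentum u) mx n := ⟨h1, h2, h3, h4, h5⟩
  obtain ⟨W⟩ := h.toRegularCoeffs.toCoeffs.exists_jostFamily
  have hW : ∀ z ≠ 0, h.toCoeffs.IsJostPair z (W.w1 z) (W.w2 z) (W.a z) (W.b z) := W.jost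
  refine ⟨fun z hz => ⟨?_, ?_, ?_⟩, fun S hS hS0 => ?_⟩
  · exact ⟨_, h.isJost_of_isNormalized (hW z hz).isNormalized_atTop,
      fun μ hμ => h.isJost_unique hμ (h.isJost_of_isNormalized (hW z hz).isNormalized_atTop)⟩
  · exact ⟨_, h.isJost_of_isNormalized (hW z hz).isNormalized_atBot,
      fun μ hμ => h.isJost_unique hμ (h.isJost_of_isNormalized (hW z hz).isNormalized_atBot)⟩
  · exact ⟨_, (h.isScatteringMatrix_iff (hW z hz)).2 rfl,
      fun S hS => (h.isScatteringMatrix_iff (hW z hz)).1 hS⟩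
  · have hSz : ∀ z ≠ 0, S z 0 0 = W.a z ∧ S z 1 0 = W.b z := fun z hz => by
      rw [(h.isScatteringMatrix_iff (hW z hz)).1 (hS z hz)]
      exact ⟨rfl, rfl⟩
    refine MCH.RegularCoeffs.memH_reflection W (fun z hz => ?_) (fun z hz => ?_) fun z hz => ?_
    · rw [← (hSz z hz).1]
      exact hS0 z hz
    · rw [(hSz z hz).1, (hSz z hz).2]
    -- The transformed solution at −1/z has the Jost normalization, so by uniqueness its limits are
    -- the scattering data at −1/z.
    · have hz' : -1 / z ≠ 0 := div_ne_zero (by norm_num) hz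
      obtain ⟨ea, eb⟩ := (hW _ hz').unique (h.isJostPair_inversion hz (hW z hz))
      rw [(hSz _ hz').1, (hSz _ hz').2, (hSz z hz).1, (hSz z hz).2, ea, eb, neg_div]
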